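/- **Notation.** Let $[n]=\{1,\dots,n\}$, let $-$ be a blank symbol, and let $\mathrm{inv}(w)$ be the number of inversions of $w\in S_n$. For a polynomial $f$ put $\partial_i f=(f-s_if)/(x_i-x_{i+1})$, where $s_i$ exchanges $x_i$ and $x_{i+1}$. The Schubert polynomial of $w\in S_n$ is $\mathfrak S_w=x_1^{n-1}x_2^{n-2}\cdots x_{n-1}$ if $w=(n,n-1,\dots,1)$, and $\mathfrak S_w=\partial_i\mathfrak S_{ws_i}$ if $w(i)<w(i+1)$. The Schubert coefficients $c^w_{u,v}$ are the unique integers with $\mathfrak S_u\mathfrak S_v=\sum_{w\in S_\infty}c^w_{u,v}\mathfrak S_w$, a finite sum, where $S_\infty=\bigcup_N S_N$. **Puzzle pieces.** The set $\mathcal T_n$ consists of labeled unit triangles (not to be rotated or reflected): white triangles, pointing down, and shaded and dark triangles, pointing up. The horizontal side (top side of a white triangle, bottom side of the others) carries permutation labels in $[n]^3$. The left and right sides carry an indicator $\circ$ or $\ast$, and may carry permutation labels in $[n]^3$, feedback labels $\langle d,e,f\rangle$ and transmuter labels $(g,h)$, with entries in $[n]\cup\{-\}$. All letters below are in $[n]$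 unless said otherwise. *White*, with permutation labels $(a,b,c)$ on all three sides and equal left and right sides. Five types, according to the other labels on the left and right sides: none; $(g,h)$; $\langle d,e,f\rangle$ with at least one of $d,e,f\in[n]\cup\{-\}$ blank; $\langle -,e,-\rangle$ and $(g,h)$; $\langle -,e,-\rangle$ and $(-,-)$. Here $g<h$. The indicator is arbitrary for the first two types and $\ast$ for the other three. In addition, for each $(a,b,c)$, there is the variant of the first type with indicator $\circ$ in which the permutation labels on the left side are omitted. *Shaded*, with $(a,b,c)$ on the left side, $(p,q,r)$ on the right side, $a\ne p$, $b\neq q$, $c\neq r$, equal indicators on the left and right sides, and indicator $\ast$ if $a<p$. Ten types, written as [additional labels on the left side] $\to$ [additional labels on the right side]: bottom labels. 1. $[\,]\to[\,]$: $(a,b,c)$ 2. $[(g,h)]\to[(g,h)]$, $g<h$: $(a,b,c)$ 3. $[\,]\to[(a,h)]$, $a<h$: $(h,b,c)$ 4. $[(g,a)]\to[\,]$, $g<a$: $(g,b,c)$ 5. $[\langle d,-,f\rangle]\to[\,]$: $(d,b,f)$ 6. $[\langle d,e,-\rangle]\to[\,]$: $(d,e,c)$ 7. $[\langle -,e,-\rangle]\to[\,]$: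 $(a,e,c)$ 8. $[\langle -,e,-\rangle,(g,h)]\to[(g,h)]$, $g<h$: $(a,e,c)$ 9. $[\langle -,e,-\rangle,(g,a)]\to[\,]$, $g<a$: $(g,e,c)$ 10. $[\langle -,e,-\rangle,(-,-)]\to[(a,h)]$, $a<h$: $(h,e,c)$ In addition, for the types with no additional labels on the right side, there is the variant with indicator $\ast$ in which the right permutation labels $(p,q,r)$ (and the conditions on them) are omitted. *Dark*, with $\circ$ and $(a,b,c)$ on the left side, $\ast$ and $(p,q,r)$ on the right side, and $a<p$. Eight types, distinguished by color and docket number, in the same notation. * Yellow 1, $b<q$, $c<r$: $[\,]\to[\langle a,-,c\rangle]$: $(p,b,r)$ * Yellow 2, $b>q$, $c>r$: $[\,]\to[\langle a,b,-\rangle]$: $(p,q,c)$ * Yellow 3, $b>q$, $c<r$: $[\,]\to[\langle a,-,c\rangle]$: $(p,b,r)$ * Yellow 4, $b>q$, $c<r$: $[\,]\to[\langle a,b,-\rangle]$: $(p,q,c)$ * Blue 1, $b>q$, $c<r$, $a<h\neq p$: $[\,]\to[\langle -,b,-\rangle,(a,h)]$: $(h,q,c)$ * Blue 2, $b>q$,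 $c<r$, $g<p$: $[(g,p)]\to[\langle -,b,-\rangle,(g,p)]$: $(a,q,c)$ * Red 1, $b>q$, $c<r$, $g<a$: $[(g,a)]\to[\langle -,b,-\rangle]$: $(g,q,c)$ * Red 2, $b>q$, $c<r$: $[\,]\to[\langle -,b,-\rangle,(-,-)]$: $(a,q,c)$ **Region and puzzles.** For $u,v,w\in S_n$ let $\ell=\binom n2-\mathrm{inv}(u)$, and let $\Gamma(u,v,w)$ be the $n\times\ell$ parallelogram in the triangular grid with $\ell$ rows, each consisting from left to right of $n$ white (down-pointing) and $n$ shaded (up-pointing) unit triangles in alternation, beginning with a white one, in which the bottom side of the $i$-th shaded triangle of a row is the top side of the $i$-th white triangle of the next row. The top boundary edges are labeled $(u(i),v(i),w(i))$ and the bottom ones $(n+1-i,i,n+1-i)$, $i=1,\dots,n$. All left boundary edges are marked $\circ$ and all right ones $\ast$, with no other labels. A puzzle of $\Gamma$ with $\mathcal T_n$ is a tiling of $\Gamma$ by translates of pieces of $\mathcal T_n$, white pieces on white positions and shaded or dark pieces on shaded positions, such that all labels and indicators agree along common sides and along the boundary. Its sign is $(-1)^m$, where $m$ is its number of red triangles.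 The number of signed puzzles is the sum of the signs of all puzzles. **Theorem.** $|\mathcal T_n|=O(n^9)$. For all $n$ and all $u,v,w\in S_n$ with $\mathrm{inv}(u)+\mathrm{inv}(v)=\mathrm{inv}(w)$, the number of signed puzzles of $\Gamma(u,v,w)$ with $\mathcal T_n$ is the Schubert coefficient $c^w_{u,v}$. -/

import Mathlib

namespace SchubertPuzzle

open Equiv MvPolynomial

/-! ## Permutations -/

/-- The number of inversions of a permutation. -/
def inv {n : ℕ} (w : Perm (Fin n)) : ℕ :=
  (Finset.univ.filter fun p : Fin n × Fin n => p.1 < p.2 ∧ w p.2 < w p.1).card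

/-! ## Schubert polynomials and Schubert coefficients

The variables `x_1, x_2, …` are `X 0, X 1, …`, and `S_n` is `Perm (Fin n)`. -/

theorem exists_divDiff (i : ℕ) (f : MvPolynomial ℕ ℤ) :
    ∃ g : MvPolynomial ℕ ℤ, (X i - X (i + 1)) * g = f - rename (swap i (i + 1)) f := by
  induction f using MvPolynomial.induction_on with
  | C a => exact ⟨0, by simp⟩
  | add p q hp hq =>
    obtain ⟨g, hg⟩ := hp
    obtain ⟨h, hh⟩ := hq
    refine ⟨g + h, ?_⟩
    rw [mul_add, hg, hh, map_add]
    ring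
  | mul_X p j hp =>
    obtain ⟨g, hg⟩ := hp
    have key : ∃ e : MvPolynomial ℕ ℤ,
        (X i - X (i + 1)) * e = X j - X (swap i (i + 1) j) := by
      by_cases h1 : j = i
      · exact ⟨1, by subst h1; simp⟩
      · by_cases h2 : j = i + 1
        · exact ⟨-1, by subst h2; simp⟩
        · exact ⟨0, by rw [swap_apply_of_ne_of_ne h1 h2]; simp⟩
    obtain ⟨e, he⟩ := key
    refine ⟨g * X j + rename (swap i (i + 1)) p * e, ?_⟩
    rw [map_mul, rename_X]
    linear_combination X j * hg + rename (swap i (i + 1)) p * he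

/-- The divided difference `∂_i f = (f - s_i f) / (x_i - x_{i+1})`; the quotient is unique because
polynomials over `ℤ` form a domain. -/
noncomputable def divDiff (i : ℕ) (f : MvPolynomial ℕ ℤ) : MvPolynomial ℕ ℤ :=
  Classical.choose (exists_divDiff i f)

/-- `i` is an ascent of `w`. -/
def IsAscent {n : ℕ} (w : Perm (Fin n)) (i : Fin n) : Prop :=
  ∃ h : i.val + 1 < n, w i < w ⟨i.val + 1, h⟩

/-- The product `w s_i` (multiplication on the right acts on positions). -/
def mulSimple {n : ℕ} (w : Perm (Fin n)) (i : Fin n) (h : i.val + 1 < n) : Perm (Fin n) :=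
  w * swap i ⟨i.val + 1, h⟩

/-- A quantity that decreases along `w ↦ w s_i` at an ascent; used only for termination. -/
def weight {n : ℕ} (w : Perm (Fin n)) : ℕ := ∑ j : Fin n, j.val * (w j).val

theorem weight_mulSimple_lt {n : ℕ} (w : Perm (Fin n)) (i : Fin n) (h : i.val + 1 < n)
    (hw : w i < w ⟨i.val + 1, h⟩) : weight (mulSimple w i h) < weight w := by
  have hne : i ≠ ⟨i.val + 1, h⟩ := by
    intro e
    have := congrArg Fin.val e
    simp at this
  set k : Fin n := ⟨i.val + 1, h⟩ with hk
  have hmem : k ∈ Finset.univ.erase i := Finset.mem_erase.2 ⟨hne.symm, Finset.mem_univ _⟩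
  unfold weight mulSimple
  rw [← hk, ← Finset.add_sum_erase _ _ (Finset.mem_univ i), ← Finset.add_sum_erase _ _ hmem,
    ← Finset.add_sum_erase (a := i) Finset.univ (fun j : Fin n => j.val * (w j).val)
      (Finset.mem_univ i), ← Finset.add_sum_erase _ (fun j : Fin n => j.val * (w j).val) hmem]
  have hrest : ∑ x ∈ (Finset.univ.erase i).erase k, x.val * ((w * swap i k) x).val
      = ∑ x ∈ (Finset.univ.erase i).erase k, x.val * (w x).val := by
    refine Finset.sum_congr rfl fun x hx => ?_
    simp only [Finset.mem_erase, Finset.mem_univ, and_true] at hx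
    rw [Perm.mul_apply, swap_apply_of_ne_of_ne hx.2 hx.1]
  rw [hrest, Perm.mul_apply, Perm.mul_apply, swap_apply_left, swap_apply_right]
  have hkv : k.val = i.val + 1 := rfl
  have hv : (w i).val < (w k).val := hw
  rw [hkv]
  nlinarith

open Classical in
/-- The Schubert polynomial of `w ∈ S_n`: it is `x_1^{n-1} x_2^{n-2} ⋯ x_{n-1}` for the long
permutation (the one without ascents), and `∂_i` of the Schubert polynomial of `w s_i` when `i` is
an ascent of `w`. -/
noncomputable def schubert {n : ℕ} (w : Perm (Fin n)) : MvPolynomial ℕ ℤ :=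
  if h : ∃ i, IsAscent w i then
    divDiff (Classical.choose h).val
      (schubert (mulSimple w (Classical.choose h) (Classical.choose_spec h).choose))
  else ∏ i : Fin n, X i.val ^ (n - 1 - i.val)
termination_by weight w
decreasing_by exact weight_mulSimple_lt w _ _ (Classical.choose_spec h).choose_spec

/-- The embedding of `S_n` into `S_N` by fixing the remaining points. -/
noncomputable def embed {n N : ℕ} (h : n ≤ N) (w : Perm (Fin n)) : Perm (Fin N) :=
  w.viaEmbedding (Fin.castLEEmb h)

/-- `k` is the Schubert coefficient `c^w_{u,v}`: the coefficient of the Schubert polynomial of `w`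
in the expansion of the product of those of `u` and `v` into Schubert polynomials. The expansion
runs over `S_∞`, the union of all `S_N`; a finite expansion lives in one `S_N`. -/
def IsSchubertCoeff {n : ℕ} (u v w : Perm (Fin n)) (k : ℤ) : Prop :=
  ∃ (N : ℕ) (hN : n ≤ N) (c : Perm (Fin N) → ℤ),
    schubert u * schubert v = ∑ z : Perm (Fin N), c z • schubert z ∧ c (embed hN w) = k

/-! ## Puzzle pieces

The label set `[n] = {1, …, n}` is `Fin n`; a blank entry is `none`. -/

/-- The indicators `∘` and `∗` on the left and right sides of a triangle. -/
inductive Indicator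
  | circ
  | star
  deriving DecidableEq

instance : Fintype Indicator := ⟨{.circ, .star}, by intro x; cases x <;> simp⟩

/-- Permutation labels `(a, b, c)`. -/
abbrev Triple (n : ℕ) := Fin n × Fin n × Fin n

/-- What is written on a left or right (non-horizontal) side of a triangle: an indicator and
optional permutation labels, feedback labels `(d, e, f)` and transmuter labels `(g, h)`, where the
entries of the latter two may be blank. Equality of two such sides is the matching condition. -/
abbrev Side (n : ℕ) :=
  Indicator × Option (Triple n) ×
    Option (Option (Fin n) × Option (Fin n) × Option (Fin n)) ×
    Option (Option (Fin n) × Option (Fin n))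

/-- Type of a triangle: white, shaded, or dark with a color and a docket number. -/
inductive Kind
  | white
  | shaded
  | yellow1
  | yellow2
  | yellow3
  | yellow4
  | blue1
  | blue2
  | red1
  | red2
  deriving DecidableEq

instance : Fintype Kind :=
  ⟨{.white, .shaded, .yellow1, .yellow2, .yellow3, .yellow4, .blue1, .blue2, .red1, .red2}, by
    intro x; cases x <;> simp⟩

/-- A labeled unit triangle: its kind, its left side, its right side, and the permutation labels on
its horizontal side, which is the top side of a white triangle and the bottom side of a shaded or
dark triangle. -/
abbrev Piece (n : ℕ) := Kind × Side n × Side n × Triple n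

/-- The kind of a piece. -/
def Piece.kind {n : ℕ} (t : Piece n) : Kind := t.1

/-- The labels on the left side of a piece. -/
def Piece.left {n : ℕ} (t : Piece n) : Side n := t.2.1

/-- The labels on the right side of a piece. -/
def Piece.right {n : ℕ} (t : Piece n) : Side n := t.2.2.1

/-- The labels on the horizontal side of a piece. -/
def Piece.horiz {n : ℕ} (t : Piece n) : Triple n := t.2.2.2

/-- Sides without feedback and transmuter labels. -/
def plain {n : ℕ} (s : Indicator) (x : Option (Triple n)) : Side n := (s, x, none, none)

/-- Sides with transmuter labels `(g, h)` only. -/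
def withTr {n : ℕ} (s : Indicator) (x : Option (Triple n)) (g h : Fin n) : Side n :=
  (s, x, none, some (some g, some h))

/-- Sides with feedback labels `(d, e, f)` only. -/
def withFb {n : ℕ} (s : Indicator) (x : Option (Triple n)) (d e f : Option (Fin n)) : Side n :=
  (s, x, some (d, e, f), none)

/-- Sides with feedback labels `(-, e, -)` and transmuter labels `(g, h)`. -/
def withFbTr {n : ℕ} (s : Indicator) (x : Option (Triple n)) (e g h : Fin n) : Side n :=
  (s, x, some (none, some e, none), some (some g, some h))

/-- Sides with feedback labels `(-, e, -)` and blank transmuter labels `(-, -)`. -/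
def withFbBlank {n : ℕ} (s : Indicator) (x : Option (Triple n)) (e : Fin n) : Side n :=
  (s, x, some (none, some e, none), some (none, none))

/-- White triangles. The five types repeat everything on the left and right sides; the constructor
`boundary` is the version of `perm` whose left side carries only the marking `∘` of the left
boundary of the region (empty permutation label). -/
inductive IsWhite {n : ℕ} : Piece n → Prop
  | perm (s : Indicator) (x : Triple n) :
      IsWhite (.white, plain s (some x), plain s (some x), x)
  | boundary (x : Triple n) :
      IsWhite (.white, plain .circ none, plain .circ (some x), x)
  | transmuter (s : Indicator) (x : Triple n) (g h : Fin n) (hgh : g < h) :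
      IsWhite (.white, withTr s (some x) g h, withTr s (some x) g h, x)
  | feedback (x : Triple n) (d e f : Option (Fin n)) (hb : d = none ∨ e = none ∨ f = none) :
      IsWhite (.white, withFb .star (some x) d e f, withFb .star (some x) d e f, x)
  | both (x : Triple n) (e g h : Fin n) (hgh : g < h) :
      IsWhite (.white, withFbTr .star (some x) e g h, withFbTr .star (some x) e g h, x)
  | blank (x : Triple n) (e : Fin n) :
      IsWhite (.white, withFbBlank .star (some x) e, withFbBlank .star (some x) e, x)

/-- Condition on the indicator `s` (of both sides) of a shaded triangle with permutation labels `x`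
on the left and `y` on the right. If `y` is present, corresponding entries differ, and an ascent in
the first entries forces `∗` (the ascent condition). An empty right permutation label aligns with
the right boundary of the region, so it comes with the boundary marking `∗`. -/
def ShadedOK {n : ℕ} (s : Indicator) (x : Triple n) : Option (Triple n) → Prop
  | some y => x.1 ≠ y.1 ∧ x.2.1 ≠ y.2.1 ∧ x.2.2 ≠ y.2.2 ∧ (x.1 < y.1 → s = .star)
  | none => s = .star

/-- Shaded triangles: ten types. The horizontal side shows the left permutation labels after the
(dominating) feedback and transmuter labels have been substituted. A right side that carries
transmuter labels cannot lie on the boundary, so there the right permutation label is present. -/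
inductive IsShaded {n : ℕ} : Piece n → Prop
  /-- No feedback, no transmuter. -/
  | perm (s : Indicator) (a b c : Fin n) (y : Option (Triple n))
      (hy : ShadedOK s (a, b, c) y) :
      IsShaded (.shaded, plain s (some (a, b, c)), plain s y, (a, b, c))
  /-- Transmuter labels pass through. -/
  | pass (s : Indicator) (a b c g h : Fin n) (y : Triple n)
      (hy : ShadedOK s (a, b, c) (some y)) (hgh : g < h) :
      IsShaded (.shaded, withTr s (some (a, b, c)) g h, withTr s (some y) g h, (a, b, c))
  /-- A transmuter signal starts. -/
  | emit (s : Indicator) (a b c h : Fin n) (y : Triple n)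
      (hy : ShadedOK s (a, b, c) (some y)) (hah : a < h) :
      IsShaded (.shaded, plain s (some (a, b, c)), withTr s (some y) a h, (h, b, c))
  /-- A transmuter signal stops. -/
  | absorb (s : Indicator) (a b c g : Fin n) (y : Option (Triple n))
      (hy : ShadedOK s (a, b, c) y) (hga : g < a) :
      IsShaded (.shaded, withTr s (some (a, b, c)) g a, plain s y, (g, b, c))
  /-- Feedback in the first and third entries. -/
  | fbUW (s : Indicator) (a b c d f : Fin n) (y : Option (Triple n))
      (hy : ShadedOK s (a, b, c) y) :
      IsShaded (.shaded, withFb s (some (a, b, c)) (some d) none (some f), plain s y, (d, b, f))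
  /-- Feedback in the first and second entries. -/
  | fbUV (s : Indicator) (a b c d e : Fin n) (y : Option (Triple n))
      (hy : ShadedOK s (a, b, c) y) :
      IsShaded (.shaded, withFb s (some (a, b, c)) (some d) (some e) none, plain s y, (d, e, c))
  /-- Feedback in the second entry. -/
  | fbV (s : Indicator) (a b c e : Fin n) (y : Option (Triple n))
      (hy : ShadedOK s (a, b, c) y) :
      IsShaded (.shaded, withFb s (some (a, b, c)) none (some e) none, plain s y, (a, e, c))
  /-- Feedback in the second entry; transmuter labels pass through. -/
  | fbVPass (s : Indicator) (a b c e g h : Fin n) (y : Triple n)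
      (hy : ShadedOK s (a, b, c) (some y)) (hgh : g < h) :
      IsShaded (.shaded, withFbTr s (some (a, b, c)) e g h, withTr s (some y) g h, (a, e, c))
  /-- Feedback in the second entry; a transmuter signal stops. -/
  | fbVAbsorb (s : Indicator) (a b c e g : Fin n) (y : Option (Triple n))
      (hy : ShadedOK s (a, b, c) y) (hga : g < a) :
      IsShaded (.shaded, withFbTr s (some (a, b, c)) e g a, plain s y, (g, e, c))
  /-- Feedback in the second entry; a blank transmuter signal makes a transmuter signal start. -/
  | fbVEmit (s : Indicator) (a b c e h : Fin n) (y : Triple n)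
      (hy : ShadedOK s (a, b, c) (some y)) (hah : a < h) :
      IsShaded (.shaded, withFbBlank s (some (a, b, c)) e, withTr s (some y) a h, (h, e, c))

/-- Dark triangles: `∘` and `(a, b, c)` on the left side, `∗` and `(p, q, r)` on the right side, an
ascent `a < p`, and the constraints of the color and the docket number. -/
inductive IsDark {n : ℕ} : Piece n → Prop
  | yellow1 (a b c p q r : Fin n) (hu : a < p) (hv : b < q) (hw : c < r) :
      IsDark (.yellow1, plain .circ (some (a, b, c)),
        withFb .star (some (p, q, r)) (some a) none (some c), (p, b, r))
  | yellow2 (a b c p q r : Fin n) (hu : a < p) (hv : q < b) (hw : r < c) :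
      IsDark (.yellow2, plain .circ (some (a, b, c)),
        withFb .star (some (p, q, r)) (some a) (some b) none, (p, q, c))
  | yellow3 (a b c p q r : Fin n) (hu : a < p) (hv : q < b) (hw : c < r) :
      IsDark (.yellow3, plain .circ (some (a, b, c)),
        withFb .star (some (p, q, r)) (some a) none (some c), (p, b, r))
  | yellow4 (a b c p q r : Fin n) (hu : a < p) (hv : q < b) (hw : c < r) :
      IsDark (.yellow4, plain .circ (some (a, b, c)),
        withFb .star (some (p, q, r)) (some a) (some b) none, (p, q, c))
  /-- Transposition with `j = i`: a transmuter signal `(a, h)` starts here, `k ≠ i + 1`. -/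
  | blue1 (a b c p q r h : Fin n) (hu : a < p) (hv : q < b) (hw : c < r)
      (hah : a < h) (hhp : h ≠ p) :
      IsDark (.blue1, plain .circ (some (a, b, c)),
        withFbTr .star (some (p, q, r)) b a h, (h, q, c))
  /-- Transposition with `k = i + 1`: the signal `(g, p)` passes through to the next column. -/
  | blue2 (a b c p q r g : Fin n) (hu : a < p) (hv : q < b) (hw : c < r) (hgp : g < p) :
      IsDark (.blue2, withTr .circ (some (a, b, c)) g p,
        withFbTr .star (some (p, q, r)) b g p, (a, q, c))
  /-- Transposition with `k = i`: the signal `(g, a)` stops here. -/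
  | red1 (a b c p q r g : Fin n) (hu : a < p) (hv : q < b) (hw : c < r) (hga : g < a) :
      IsDark (.red1, withTr .circ (some (a, b, c)) g a,
        withFb .star (some (p, q, r)) none (some b) none, (g, q, c))
  /-- Transposition with `j = i + 1`: a blank signal makes the next column start a signal. -/
  | red2 (a b c p q r : Fin n) (hu : a < p) (hv : q < b) (hw : c < r) :
      IsDark (.red2, plain .circ (some (a, b, c)),
        withFbBlank .star (some (p, q, r)) b, (a, q, c))

open Classical in
/-- The set `𝒯_n` of puzzle pieces. -/
noncomputable def pieces (n : ℕ) : Finset (Piece n) :=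
  Finset.univ.filter fun t => IsWhite t ∨ IsShaded t ∨ IsDark t

/-! ## The region and its puzzles -/

/-- The positions (unit triangles) of an `n × ℓ` parallelogram in the triangular grid. Its `ℓ` rows
are indexed from top to bottom; each row consists, from left to right, of the white (downward
pointing) and shaded (upward pointing) positions
`white r 0, shaded r 0, white r 1, shaded r 1, …, white r (n-1), shaded r (n-1)`,
consecutive ones sharing a side. The bottom side of `shaded r i` is the top side of
`white (r+1) i`. -/
inductive Position (n l : ℕ)
  | white (r : Fin l) (i : Fin n)
  | shaded (r : Fin l) (i : Fin n)
  deriving DecidableEq, Fintype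

/-- An `n × ℓ` parallelogram region with labels on its boundary. -/
structure Region (n l : ℕ) where
  top : Fin n → Triple n
  bottom : Fin n → Triple n
  left : Fin l → Side n
  right : Fin l → Side n

/-- The region `Γ(u, v, w)`. The bottom labels are `(n, 1, n), (n-1, 2, n-1), …, (1, n, 1)`. -/
def gamma {n : ℕ} (u v w : Perm (Fin n)) : Region n (n.choose 2 - inv u) where
  top i := (u i, v i, w i)
  bottom i := (i.rev, i, i.rev)
  left _ := plain .circ none
  right _ := plain .star none

/-- `T` is a puzzle of the region `G` with the set of pieces `P`: a tiling by translates of pieces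
in `P` such that all labels and indicators match along common sides and along the boundary. -/
structure IsPuzzle {n l : ℕ} (P : Finset (Piece n)) (G : Region n l)
    (T : Position n l → Piece n) : Prop where
  mem : ∀ x, T x ∈ P
  white_kind : ∀ r i, (T (.white r i)).kind = .white
  shaded_kind : ∀ r i, (T (.shaded r i)).kind ≠ .white
  match_column : ∀ r i, (T (.white r i)).right = (T (.shaded r i)).left
  match_next : ∀ r i (h : i.val + 1 < n),
    (T (.shaded r i)).right = (T (.white r ⟨i.val + 1, h⟩)).left
  match_down : ∀ r i (h : r.val + 1 < l),
    (T (.shaded r i)).horiz = (T (.white ⟨r.val + 1, h⟩ i)).horiz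
  top : ∀ (r : Fin l) i, r.val = 0 → (T (.white r i)).horiz = G.top i
  bottom : ∀ (r : Fin l) i, r.val + 1 = l → (T (.shaded r i)).horiz = G.bottom i
  left : ∀ r (i : Fin n), i.val = 0 → (T (.white r i)).left = G.left r
  right : ∀ r (i : Fin n), i.val + 1 = n → (T (.shaded r i)).right = G.right r

/-- A piece is red. -/
def Piece.IsRed {n : ℕ} (t : Piece n) : Prop := t.kind = .red1 ∨ t.kind = .red2

open Classical in
/-- The sign `(-1)^(number of red triangles)` of a puzzle. -/
noncomputable def sign {n l : ℕ} (T : Position n l → Piece n) : ℤ :=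
  (-1) ^ (Finset.univ.filter fun x => (T x).IsRed).card

open Classical in
/-- The number of signed puzzles: the sum of the signs of all puzzles. -/
noncomputable def signedCount {n l : ℕ} (P : Finset (Piece n)) (G : Region n l) : ℤ :=
  ∑ T ∈ Finset.univ.filter (fun T : Position n l → Piece n => IsPuzzle P G T), sign T

end SchubertPuzzle

/-!
Both sides of the identity satisfy the same recurrence in `u`, which starts at the longest
permutation; each row of a puzzle performs one step of the recurrence.

*Structure constants.* `structureCoeff u v w` is the constant term of `∂_w (𝔖_u 𝔖_v)`. It extracts
the coefficient of `𝔖_w`, because the constant term of `∂_w 𝔖_z` is `1` for `z = w` and `0`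
otherwise (`isSchubertCoeff_iff`). Let `i` be an ascent of `u` and `s = s_i`, so that `𝔖_u = ∂_i
𝔖_{us}`. If `v` has an ascent at `i`, then `𝔖_v` is symmetric in `x_i` and `x_{i+1}`, so `𝔖_u 𝔖_v =
∂_i (𝔖_{us} 𝔖_v)`, and the coefficient of `w` is that of `ws` in `𝔖_{us} 𝔖_v`, or zero, according to
whether `w` has an ascent or a descent at `i`. If `v` has a descent at `i` and `w` a descent as
well, then the same argument at the ascent `i` of `vs` moves `s` from `u` to `v`. If `v` has a
descent and `w` an ascent, then the twisted Leibniz rule gives `𝔖_u 𝔖_v = ∂_i (𝔖_{us} 𝔖_v) - 𝔖_{us}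
𝔖_{vs} + (x_i - x_{i+1}) 𝔖_u 𝔖_{vs}`. Monk's rule turns the last two terms into a combination of the
`𝔖_{u(a b)} 𝔖_{vs}` over the covers `u(a b)` of `u`, with coefficients `mixedCoeff`
(`structureCoeff_descent_ascent`). It is used in its dual form for the functional "coefficient of
`w`" (`schubertCoeff_X_mul`), which follows from the Leibniz rule by induction on `w`.

*Expansions.* The choice of ascents in the definition of `𝔖_w` does not matter, because divided
differences satisfy the braid relations (`eq_of_ascent`). A polynomial whose exponents are bounded
by the staircase `N - 1, N - 2, …, 0` is determined by its coefficients for `S_N`: if they vanish,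
then so do, by induction on the degree, all its divided differences, and it is symmetric in
infinitely many variables, hence constant. So the product `𝔖_u 𝔖_v` has an expansion
(`eq_sum_schubert`), and the coefficients do not depend on `N` (`schubertCoeff_embed`).

*Puzzles.* Cutting off the first row gives `tilingCount_succ`, a sum over the labels below that row
of the signed number of rows with given labels above and below. The left side of a piece, its bottom
label and its right permutation label determine the piece, so there is at most one such row, and
rows are the runs of a deterministic automaton that reads the columns from left to right (`Run`).
The indicator `∘` must change to `∗` exactly once; this happens in a dark piece at an ascent of `u`.
A run that starts with the labels of `u, v, w` ends with the labels of three permutations, where the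
transmuter signals multiply `u` by transpositions that create inversions. Hence every row increases
`inv u`, and since the number of rows is `n(n-1)/2 - inv u`, it increases it by exactly one in a
puzzle. Shaded pieces with `∘` do not allow ascents of `u`, so the dark piece sits at the first
ascent `i`. A signal that is not used by this dark piece would create an additional inversion, so
the rows that remain are the terms of the recurrence at `i` with their signs (`Run.exists_labels`,
`IsTransition.run`).

*The size of the set of pieces.* A piece contains at most nine different letters, so it comes from
one of the pieces over nine letters by substitution.
-/

namespace SchubertPuzzle

open Equiv

variable {n : ℕ}

/-! ### Inversions and descents -/

/-- The Lehmer code of a permutation. -/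
def code (w : Perm (Fin n)) (j : Fin n) : ℕ :=
  (Finset.univ.filter fun k : Fin n => j < k ∧ w k < w j).card

theorem inv_eq_sum_code (w : Perm (Fin n)) : inv w = ∑ j, code w j := by
  unfold inv code
  simp only [Finset.card_filter]
  rw [← Finset.univ_product_univ, Finset.sum_product]

theorem lt_next {i : Fin n} {h : i.val + 1 < n} : i < (⟨i.val + 1, h⟩ : Fin n) :=
  Fin.lt_def.2 (Nat.lt_succ_self _)

theorem code_mulSimple_left (w : Perm (Fin n)) (i : Fin n) (h : i.val + 1 < n)
    (hw : w i < w ⟨i.val + 1, h⟩) : code (mulSimple w i h) i = code w ⟨i.val + 1, h⟩ + 1 := by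
  unfold code mulSimple
  rw [← Finset.card_insert_of_notMem (a := (⟨i.val + 1, h⟩ : Fin n)) (by simp)]
  congr 1
  ext k
  simp only [Finset.mem_filter, Finset.mem_univ, true_and, Finset.mem_insert, Perm.mul_apply,
    swap_apply_left]
  by_cases hk : k = ⟨i.val + 1, h⟩
  · subst hk; simp [hw, lt_next]
  · by_cases hk' : k = i
    · subst hk'
      simp only [lt_irrefl, false_and, false_iff, not_or, hk, not_false_iff, true_and]
      exact fun h1 => absurd h1.1 (not_lt.2 lt_next.le)
    · rw [swap_apply_of_ne_of_ne hk' hk]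
      simp only [Fin.ext_iff, Fin.lt_def] at *
      constructor
      · rintro ⟨h1, h2⟩; right; exact ⟨by omega, h2⟩
      · rintro (h1 | ⟨h1, h2⟩)
        · omega
        · exact ⟨by omega, h2⟩

theorem code_mulSimple_right (w : Perm (Fin n)) (i : Fin n) (h : i.val + 1 < n)
    (hw : w i < w ⟨i.val + 1, h⟩) : code (mulSimple w i h) ⟨i.val + 1, h⟩ = code w i := by
  unfold code mulSimple
  congr 1
  ext k
  simp only [Finset.mem_filter, Finset.mem_univ, true_and, Perm.mul_apply, swap_apply_right]
  by_cases hk : k = ⟨i.val + 1, h⟩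
  · subst hk; simp [hw.le]
  · by_cases hk' : k = i
    · subst hk'
      simp only [lt_irrefl, false_and, iff_false, not_and]
      exact fun h1 => absurd h1 (not_lt.2 lt_next.le)
    · rw [swap_apply_of_ne_of_ne hk' hk]
      simp only [Fin.ext_iff, Fin.lt_def] at *
      constructor
      · rintro ⟨h1, h2⟩; exact ⟨by omega, h2⟩
      · rintro ⟨h1, h2⟩; exact ⟨by omega, h2⟩

theorem code_mulSimple_of_ne (w : Perm (Fin n)) (i : Fin n) (h : i.val + 1 < n) (j : Fin n)
    (h1 : j ≠ i) (h2 : j ≠ ⟨i.val + 1, h⟩) : code (mulSimple w i h) j = code w j := by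
  unfold code mulSimple
  refine Finset.card_equiv (swap i ⟨i.val + 1, h⟩) fun k => ?_
  simp only [Finset.mem_filter, Finset.mem_univ, true_and, Perm.mul_apply,
    swap_apply_of_ne_of_ne h1 h2]
  refine and_congr_left fun _ => ?_
  by_cases hk : k = ⟨i.val + 1, h⟩
  · subst hk
    rw [swap_apply_right]
    simp only [Fin.ext_iff, Fin.lt_def, ne_eq] at *
    omega
  · by_cases hk' : k = i
    · subst hk'
      rw [swap_apply_left]
      simp only [Fin.ext_iff, Fin.lt_def, ne_eq] at *
      omega
    · rw [swap_apply_of_ne_of_ne hk' hk]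

theorem inv_mulSimple (w : Perm (Fin n)) (i : Fin n) (h : i.val + 1 < n)
    (hw : w i < w ⟨i.val + 1, h⟩) : inv (mulSimple w i h) = inv w + 1 := by
  have hmem : (⟨i.val + 1, h⟩ : Fin n) ∈ Finset.univ.erase i :=
    Finset.mem_erase.2 ⟨lt_next.ne', Finset.mem_univ _⟩
  rw [inv_eq_sum_code, inv_eq_sum_code, ← Finset.add_sum_erase _ _ (Finset.mem_univ i),
    ← Finset.add_sum_erase _ _ hmem, ← Finset.add_sum_erase _ (code w) (Finset.mem_univ i),
    ← Finset.add_sum_erase _ (code w) hmem, code_mulSimple_left w i h hw,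
    code_mulSimple_right w i h hw,
    Finset.sum_congr rfl fun x hx => code_mulSimple_of_ne w i h x
      (Finset.mem_erase.1 (Finset.mem_erase.1 hx).2).1 (Finset.mem_erase.1 hx).1]
  ring

theorem mulSimple_mulSimple (w : Perm (Fin n)) (i : Fin n) (h : i.val + 1 < n) :
    mulSimple (mulSimple w i h) i h = w := by
  simp [mulSimple, mul_assoc]

@[simp] theorem mulSimple_apply_left (w : Perm (Fin n)) (i : Fin n) (h : i.val + 1 < n) :
    mulSimple w i h i = w ⟨i.val + 1, h⟩ := by simp [mulSimple]

@[simp] theorem mulSimple_apply_right (w : Perm (Fin n)) (i : Fin n) (h : i.val + 1 < n) :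
    mulSimple w i h ⟨i.val + 1, h⟩ = w i := by simp [mulSimple]

theorem mulSimple_apply_of_ne (w : Perm (Fin n)) (i : Fin n) (h : i.val + 1 < n) (j : Fin n)
    (h1 : j ≠ i) (h2 : j ≠ ⟨i.val + 1, h⟩) : mulSimple w i h j = w j := by
  simp [mulSimple, swap_apply_of_ne_of_ne h1 h2]

theorem inv_mulSimple_of_gt (w : Perm (Fin n)) (i : Fin n) (h : i.val + 1 < n)
    (hw : w ⟨i.val + 1, h⟩ < w i) : inv (mulSimple w i h) + 1 = inv w := by
  rw [← inv_mulSimple (mulSimple w i h) i h (by simpa using hw), mulSimple_mulSimple]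

theorem lt_or_gt_next (w : Perm (Fin n)) (i : Fin n) (h : i.val + 1 < n) :
    w i < w ⟨i.val + 1, h⟩ ∨ w ⟨i.val + 1, h⟩ < w i :=
  lt_or_gt_of_ne (w.injective.ne lt_next.ne)

/-- A transposition that exchanges two values in increasing order creates inversions. It is
conjugate by a simple transposition to one of smaller width. -/
theorem inv_lt_inv_mul_swap (w : Perm (Fin n)) (a b : Fin n) (hab : a < b) (hw : w a < w b) :
    inv w < inv (w * swap a b) := by
  obtain ⟨d, hd⟩ : ∃ d, b.val = a.val + 1 + d := ⟨b.val - a.val - 1, by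
    have := Fin.lt_def.1 hab; omega⟩
  induction d generalizing w b with
  | zero =>
    obtain ⟨b, hb⟩ := b
    obtain rfl : b = a.val + 1 := hd
    have := inv_mulSimple w a hb hw
    unfold mulSimple at this
    omega
  | succ d ih =>
    obtain ⟨b, hb⟩ := b
    obtain rfl : b = a.val + 1 + d + 1 := hd
    set c : Fin n := ⟨a.val + 1 + d, by omega⟩ with hc
    have hac : a < c := Fin.lt_def.2 (by simp [hc]; omega)
    have hcb : c < ⟨a.val + 1 + d + 1, hb⟩ := Fin.lt_def.2 (by simp [hc])
    set b : Fin n := ⟨a.val + 1 + d + 1, hb⟩ with hb'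
    have h1 := ih (mulSimple w c hb) c hac (by
      rw [mulSimple_apply_left, mulSimple_apply_of_ne _ _ _ _ hac.ne hab.ne]; exact hw) rfl
    have hconj : mulSimple (mulSimple w c hb * swap a c) c hb = w * swap a b := by
      change w * swap c b * swap a c * swap c b = _
      rw [mul_assoc, mul_assoc, ← mul_assoc (swap c b), swap_mul_swap_mul_swap hac.ne hab.ne,
        swap_comm a b]
    have e1 : (mulSimple w c hb * swap a c) c = w a := by
      rw [Perm.mul_apply, swap_apply_right, mulSimple_apply_of_ne _ _ _ _ hac.ne hab.ne]
    have e2 : (mulSimple w c hb * swap a c) b = w c := by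
      rw [Perm.mul_apply, swap_apply_of_ne_of_ne hab.ne' hcb.ne']
      exact mulSimple_apply_right w c hb
    rw [← hconj]
    rcases lt_or_gt_next w c hb with h2 | h2
    · have h3 := inv_mulSimple w c hb h2
      rcases lt_or_gt_next (mulSimple w c hb * swap a c) c hb with h4 | h4
      · have := inv_mulSimple _ c hb h4; omega
      · have := inv_mulSimple_of_gt _ c hb h4; omega
    · have h3 := inv_mulSimple_of_gt w c hb h2
      have := inv_mulSimple (mulSimple w c hb * swap a c) c hb (by
        change _ < (mulSimple w c hb * swap a c) b
        rw [e1, e2]; exact hw.trans h2)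
      omega

theorem inv_mul_swap_lt_inv (w : Perm (Fin n)) (a b : Fin n) (hab : a < b) (hw : w b < w a) :
    inv (w * swap a b) < inv w := by
  have := inv_lt_inv_mul_swap (w * swap a b) a b hab (by simpa using hw)
  simpa [mul_assoc] using this

theorem lt_of_inv_lt_mul_swap {w : Perm (Fin n)} {a b : Fin n} (hab : a < b)
    (h : inv w < inv (w * swap a b)) : w a < w b := by
  rcases lt_or_gt_of_ne (w.injective.ne hab.ne) with h1 | h1
  · exact h1
  · have := inv_mul_swap_lt_inv w a b hab h1; omega

theorem inv_one : inv (1 : Perm (Fin n)) = 0 := by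
  unfold inv
  rw [Finset.card_eq_zero, Finset.filter_eq_empty_iff]
  rintro ⟨a, b⟩ - ⟨h1, h2⟩
  exact absurd h1 (not_lt.2 h2.le)

theorem eq_one_of_forall_ascent (w : Perm (Fin n))
    (h : ∀ (i : Fin n) (h : i.val + 1 < n), w i < w ⟨i.val + 1, h⟩) : w = 1 := by
  have hm : StrictMono w := by
    intro a b hab
    obtain ⟨d, hd⟩ : ∃ d, b.val = a.val + 1 + d := ⟨b.val - a.val - 1, by
      have := Fin.lt_def.1 hab; omega⟩
    induction d generalizing b with
    | zero =>
      obtain ⟨b, hb⟩ := b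
      obtain rfl : b = a.val + 1 := hd
      exact h a hb
    | succ d ih =>
      obtain ⟨b, hb⟩ := b
      obtain rfl : b = a.val + 1 + d + 1 := hd
      exact (ih (b := ⟨a.val + 1 + d, by omega⟩) (Fin.lt_def.2 (by simp; omega)) rfl).trans
        (h ⟨a.val + 1 + d, by omega⟩ hb)
  ext i
  have : (hm.orderIsoOfSurjective w w.surjective) = OrderIso.refl _ := Subsingleton.elim _ _
  exact congrArg Fin.val (congrArg (fun e : Fin n ≃o Fin n => e i) this)

theorem exists_descent {w : Perm (Fin n)} (hw : w ≠ 1) :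
    ∃ (i : Fin n) (h : i.val + 1 < n), w ⟨i.val + 1, h⟩ < w i := by
  by_contra hc
  push Not at hc
  exact hw (eq_one_of_forall_ascent w fun i h => lt_of_le_of_ne (hc i h)
    (w.injective.ne lt_next.ne))

theorem inv_pos {w : Perm (Fin n)} (hw : w ≠ 1) : 0 < inv w := by
  obtain ⟨i, h, hi⟩ := exists_descent hw
  have := inv_mulSimple_of_gt w i h hi
  omega

theorem revPerm_mul_lt (w : Perm (Fin n)) (i j : Fin n) :
    ((Fin.revPerm : Perm (Fin n)) * w) i < ((Fin.revPerm : Perm (Fin n)) * w) j ↔ w j < w i := by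
  simp [Perm.mul_apply]

theorem eq_revPerm_of_forall_descent (w : Perm (Fin n))
    (h : ∀ (i : Fin n) (h : i.val + 1 < n), w ⟨i.val + 1, h⟩ < w i) : w = Fin.revPerm := by
  have := eq_one_of_forall_ascent (Fin.revPerm * w) fun i hi => (revPerm_mul_lt _ _ _).2 (h i hi)
  have h2 : (Fin.revPerm : Perm (Fin n)) * Fin.revPerm = 1 := by ext; simp
  calc w = Fin.revPerm * (Fin.revPerm * w) := by rw [← mul_assoc, h2, one_mul]
    _ = _ := by rw [this, mul_one]

/-- Induction over permutations along descents. -/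
theorem perm_induction {P : Perm (Fin n) → Prop} (one : P 1)
    (step : ∀ (w : Perm (Fin n)) (i : Fin n) (h : i.val + 1 < n), w i < w ⟨i.val + 1, h⟩ → P w →
      P (mulSimple w i h)) (w : Perm (Fin n)) : P w := by
  induction hk : inv w using Nat.strong_induction_on generalizing w with
  | _ k ih =>
    by_cases hw : w = 1
    · exact hw ▸ one
    · obtain ⟨i, h, hi⟩ := exists_descent hw
      have h1 := inv_mulSimple_of_gt w i h hi
      rw [← mulSimple_mulSimple w i h]
      exact step _ i h (by simpa using hi) (ih _ (by omega) _ rfl)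

theorem inv_le_choose (w : Perm (Fin n)) : inv w ≤ n.choose 2 := by
  have hb : ∀ j, code w j ≤ n - 1 - j.val := by
    intro j
    refine (Finset.card_le_card (t := Finset.Ioi j) ?_).trans ?_
    · intro k; simp; tauto
    · simp
  rw [inv_eq_sum_code]
  refine (Finset.sum_le_sum fun j _ => hb j).trans ?_
  rw [Fin.sum_univ_eq_sum_range (fun j => n - 1 - j), Finset.sum_range_reflect (fun j => j),
    Finset.sum_range_id, Nat.choose_two_right]

theorem code_revPerm (j : Fin n) : code (Fin.revPerm : Perm (Fin n)) j = n - 1 - j.val := by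
  unfold code
  rw [show (Finset.univ.filter fun k : Fin n => j < k ∧ Fin.revPerm k < Fin.revPerm j)
    = Finset.Ioi j by ext; simp]
  simp

theorem inv_revPerm : inv (Fin.revPerm : Perm (Fin n)) = n.choose 2 := by
  rw [inv_eq_sum_code, Finset.sum_congr rfl fun j _ => code_revPerm j,
    Fin.sum_univ_eq_sum_range (fun j => n - 1 - j), Finset.sum_range_reflect (fun j => j),
    Finset.sum_range_id, Nat.choose_two_right]

theorem eq_revPerm_of_choose_le_inv {w : Perm (Fin n)} (h : n.choose 2 ≤ inv w) :
    w = Fin.revPerm := by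
  refine eq_revPerm_of_forall_descent w fun i hi => ?_
  refine (lt_or_gt_next w i hi).resolve_left fun h1 => ?_
  have := inv_mulSimple w i hi h1
  have := inv_le_choose (mulSimple w i hi)
  omega

theorem exists_first_ascent {w : Perm (Fin n)} (hw : w ≠ Fin.revPerm) :
    ∃ (i : Fin n) (h : i.val + 1 < n), w i < w ⟨i.val + 1, h⟩ ∧
      ∀ (j : Fin n) (h' : j.val + 1 < n), j < i → w ⟨j.val + 1, h'⟩ < w j := by
  have hex : ∃ k : ℕ, ∃ h : k + 1 < n, w ⟨k, by omega⟩ < w ⟨k + 1, h⟩ := by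
    by_contra hc
    push Not at hc
    exact hw (eq_revPerm_of_forall_descent w fun i h => lt_of_le_of_ne (hc i.val h)
      (w.injective.ne lt_next.ne'))
  classical
  obtain ⟨h, hk⟩ := Nat.find_spec hex
  refine ⟨⟨Nat.find hex, by omega⟩, h, hk, fun j h' hj => ?_⟩
  refine (lt_or_gt_next w j h').resolve_left fun h1 => ?_
  exact Nat.find_min hex (Fin.lt_def.1 hj) ⟨h', h1⟩

section Polynomials

open MvPolynomial

/-! ### Divided differences -/

theorem divDiff_spec (i : ℕ) (f : MvPolynomial ℕ ℤ) :
    (X i - X (i + 1)) * divDiff i f = f - rename (swap i (i + 1)) f :=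
  Classical.choose_spec (exists_divDiff i f)

theorem X_sub_X_ne_zero {i j : ℕ} (h : i ≠ j) : (X i - X j : MvPolynomial ℕ ℤ) ≠ 0 :=
  sub_ne_zero.2 fun e => h (X_injective e)

theorem divDiff_eq_of_mul_eq {i : ℕ} {f g : MvPolynomial ℕ ℤ}
    (h : (X i - X (i + 1)) * g = f - rename (swap i (i + 1)) f) : divDiff i f = g :=
  mul_left_cancel₀ (X_sub_X_ne_zero (Nat.succ_ne_self i).symm) ((divDiff_spec i f).trans h.symm)

theorem divDiff_eq_zero_iff {i : ℕ} {f : MvPolynomial ℕ ℤ} :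
    divDiff i f = 0 ↔ rename (swap i (i + 1)) f = f := by
  constructor
  · intro h
    have := divDiff_spec i f
    rw [h, mul_zero] at this
    exact (sub_eq_zero.1 this.symm).symm
  · intro h
    exact divDiff_eq_of_mul_eq (by rw [h, mul_zero, sub_self])

theorem rename_swap_rename_swap (i j : ℕ) (f : MvPolynomial ℕ ℤ) :
    rename (swap i j) (rename (swap i j) f) = f := by
  rw [rename_rename]
  have : (swap i j : ℕ → ℕ) ∘ (swap i j) = id := by ext; simp
  rw [this, rename_id_apply]

theorem rename_perm_mul (σ τ : Perm ℕ) (f : MvPolynomial ℕ ℤ) :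
    rename (σ * τ : Perm ℕ) f = rename σ (rename τ f) := by
  rw [rename_rename, Perm.coe_mul]

/-- A divided difference is symmetric in the two variables involved. -/
theorem rename_divDiff (i : ℕ) (f : MvPolynomial ℕ ℤ) :
    rename (swap i (i + 1)) (divDiff i f) = divDiff i f := by
  have h := congrArg (rename (swap i (i + 1))) (divDiff_spec i f)
  simp only [map_mul, map_sub, rename_X, swap_apply_left, swap_apply_right,
    rename_swap_rename_swap] at h
  refine mul_left_cancel₀ (X_sub_X_ne_zero (Nat.succ_ne_self i)) ?_
  rw [h]
  linear_combination divDiff_spec i f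

theorem divDiff_divDiff (i : ℕ) (f : MvPolynomial ℕ ℤ) : divDiff i (divDiff i f) = 0 :=
  divDiff_eq_zero_iff.2 (rename_divDiff i f)

/-- The twisted Leibniz rule. -/
theorem divDiff_mul (i : ℕ) (f g : MvPolynomial ℕ ℤ) :
    divDiff i (f * g) = divDiff i f * g + rename (swap i (i + 1)) f * divDiff i g := by
  apply divDiff_eq_of_mul_eq
  rw [map_mul]
  linear_combination g * divDiff_spec i f + rename (swap i (i + 1)) f * divDiff_spec i g

theorem divDiff_mul_of_symm {i : ℕ} {f g : MvPolynomial ℕ ℤ} (hf : divDiff i f = 0) :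
    divDiff i (f * g) = f * divDiff i g := by
  rw [divDiff_mul, hf, divDiff_eq_zero_iff.1 hf, zero_mul, zero_add]

/-- The divided difference as a linear map. -/
noncomputable def divDiffLin (i : ℕ) : MvPolynomial ℕ ℤ →ₗ[ℤ] MvPolynomial ℕ ℤ where
  toFun := divDiff i
  map_add' f g := divDiff_eq_of_mul_eq (by
    rw [map_add]; linear_combination divDiff_spec i f + divDiff_spec i g)
  map_smul' c f := divDiff_eq_of_mul_eq (by
    simp only [map_smul, RingHom.id_apply, mul_smul_comm, divDiff_spec, smul_sub])

@[simp] theorem divDiffLin_apply (i : ℕ) (f : MvPolynomial ℕ ℤ) :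
    divDiffLin i f = divDiff i f := rfl

theorem divDiff_X (i k : ℕ) :
    divDiff i (X k) = C ((if k = i then 1 else 0) - (if k = i + 1 then 1 else 0)) := by
  apply divDiff_eq_of_mul_eq
  rw [rename_X]
  by_cases h1 : k = i
  · subst h1; simp
  · by_cases h2 : k = i + 1
    · subst h2; simp
    · rw [swap_apply_of_ne_of_ne h1 h2]; simp [h1, h2]

theorem divDiff_comm {i j : ℕ} (h : i + 2 ≤ j) (f : MvPolynomial ℕ ℤ) :
    divDiff i (divDiff j f) = divDiff j (divDiff i f) := by
  have hs : ∀ g : MvPolynomial ℕ ℤ, rename (swap i (i + 1)) (rename (swap j (j + 1)) g)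
      = rename (swap j (j + 1)) (rename (swap i (i + 1)) g) := by
    intro g
    rw [← rename_perm_mul, ← rename_perm_mul]
    have : swap i (i + 1) * swap j (j + 1) = swap j (j + 1) * swap i (i + 1) :=
      (Perm.disjoint_swap_swap (by simp; omega)).commute.eq
    rw [this]
  have e1 := divDiff_spec i (divDiff j f)
  have e2 := divDiff_spec j (divDiff i f)
  have e3 := congrArg (rename (swap i (i + 1))) (divDiff_spec j f)
  have e4 := congrArg (rename (swap j (j + 1))) (divDiff_spec i f)
  simp only [map_mul, map_sub, rename_X] at e3 e4
  rw [swap_apply_of_ne_of_ne (by omega) (by omega),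
    swap_apply_of_ne_of_ne (by omega) (by omega)] at e3 e4
  have e5 := divDiff_spec i f
  have e6 := divDiff_spec j f
  rw [hs] at e3
  refine mul_left_cancel₀ (mul_ne_zero (X_sub_X_ne_zero (Nat.succ_ne_self i).symm)
    (X_sub_X_ne_zero (Nat.succ_ne_self j).symm)) ?_
  linear_combination (X j - X (j + 1)) * e1 - (X i - X (i + 1)) * e2 + e6 - e5 - e3 + e4

theorem divDiff_braid (i : ℕ) (f : MvPolynomial ℕ ℤ) :
    divDiff i (divDiff (i + 1) (divDiff i f))
      = divDiff (i + 1) (divDiff i (divDiff (i + 1) f)) := by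
  have hs : ∀ g : MvPolynomial ℕ ℤ,
      rename (swap i (i + 1)) (rename (swap (i + 1) (i + 1 + 1)) (rename (swap i (i + 1)) g))
      = rename (swap (i + 1) (i + 1 + 1)) (rename (swap i (i + 1))
          (rename (swap (i + 1) (i + 1 + 1)) g)) := by
    intro g
    simp only [← rename_perm_mul, ← mul_assoc]
    have : swap i (i + 1) * swap (i + 1) (i + 1 + 1) * swap i (i + 1)
        = swap (i + 1) (i + 1 + 1) * swap i (i + 1) * swap (i + 1) (i + 1 + 1) := by
      rw [swap_mul_swap_mul_swap (by omega) (by omega), swap_comm i (i + 1),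
        swap_comm (i + 1) (i + 1 + 1),
        swap_mul_swap_mul_swap (by omega) (by omega), swap_comm]
    rw [this]
  -- Both sides, times the Vandermonde product, are the antisymmetrization of `f`.
  set s : MvPolynomial ℕ ℤ →ₐ[ℤ] MvPolynomial ℕ ℤ := rename (swap i (i + 1)) with hsdef
  set t : MvPolynomial ℕ ℤ →ₐ[ℤ] MvPolynomial ℕ ℤ := rename (swap (i + 1) (i + 1 + 1)) with htdef
  have s0 : s (X i) = X (i + 1) := by simp [hsdef]
  have s1 : s (X (i + 1)) = X i := by simp [hsdef]
  have s2 : s (X (i + 1 + 1)) = X (i + 1 + 1) := by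
    rw [hsdef, rename_X, swap_apply_of_ne_of_ne (by omega) (by omega)]
  have t0 : t (X i) = X i := by
    rw [htdef, rename_X, swap_apply_of_ne_of_ne (by omega) (by omega)]
  have t1 : t (X (i + 1)) = X (i + 1 + 1) := by simp [htdef]
  have t2 : t (X (i + 1 + 1)) = X (i + 1) := by simp [htdef]
  have ss : ∀ g, s (s g) = g := rename_swap_rename_swap _ _
  have tt : ∀ g, t (t g) = g := rename_swap_rename_swap _ _
  have as : ∀ g, (X i - X (i + 1)) * divDiff i g = g - s g := divDiff_spec i
  have at' : ∀ g, (X (i + 1) - X (i + 1 + 1)) * divDiff (i + 1) g = g - t g := divDiff_spec (i + 1)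
  have inv1 : ∀ g, s (divDiff i g) = divDiff i g := rename_divDiff i
  have inv2 : ∀ g, t (divDiff (i + 1) g) = divDiff (i + 1) g := rename_divDiff (i + 1)
  set a : MvPolynomial ℕ ℤ := X i
  set b : MvPolynomial ℕ ℤ := X (i + 1)
  set c : MvPolynomial ℕ ℤ := X (i + 1 + 1)
  set A := divDiff i
  set B := divDiff (i + 1)
  have ne : (a - b) * ((b - c) * (a - c)) ≠ 0 :=
    mul_ne_zero (X_sub_X_ne_zero (by omega))
      (mul_ne_zero (X_sub_X_ne_zero (by omega)) (X_sub_X_ne_zero (by omega)))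
  refine mul_left_cancel₀ ne ?_
  -- Expand each side one operator at a time.
  have l1 : (b - c) * ((a - b) * B (A f)) = (f - s f) - (a - b) * t (A f) := by
    linear_combination (a - b) * at' (A f) + as f
  have l2 : (a - c) * t (A f) = t f - t (s f) := by
    have := congrArg t (as f)
    simpa only [map_mul, map_sub, t0, t1] using this
  have l3 : (a - c) * s (B (A f)) = A f - s (t (A f)) := by
    have := congrArg s (at' (A f))
    simpa only [map_mul, map_sub, s1, s2, inv1] using this
  have l4 : (b - c) * s (t (A f)) = s (t f) - s (t (s f)) := by
    have := congrArg s l2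
    simpa only [map_mul, map_sub, s0, s2] using this
  have r1 : (a - c) * t (A (B f)) = B f - t (s (B f)) := by
    have := congrArg t (as (B f))
    simpa only [map_mul, map_sub, t0, t1, inv2] using this
  have r2 : (a - c) * s (B f) = s f - s (t f) := by
    have := congrArg s (at' f)
    simpa only [map_mul, map_sub, s1, s2] using this
  have r3 : (a - b) * t (s (B f)) = t (s f) - t (s (t f)) := by
    have := congrArg t r2
    simpa only [map_mul, map_sub, t0, t2] using this
  have L : (a - b) * ((b - c) * (a - c)) * A (B (A f))
      = f - s f - t f + t (s f) + s (t f) - s (t (s f)) := by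
    linear_combination (b - c) * (a - c) * as (B (A f)) + (a - c) * at' (A f) - l2
      - (b - c) * l3 + l4 + as f
  have R : (a - b) * ((b - c) * (a - c)) * B (A (B f))
      = f - s f - t f + t (s f) + s (t f) - t (s (t f)) := by
    linear_combination (a - b) * (a - c) * at' (A (B f)) + (a - c) * as (B f) - r2
      - (a - b) * r1 + r3 + at' f
  rw [L, R, hs]

theorem isHomogeneous_divDiff_monomial (i : ℕ) (d : ℕ) (s : ℕ →₀ ℕ) (hs : s.degree = d + 1) :
    (divDiff i (monomial s 1)).IsHomogeneous d := by
  induction d generalizing s with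
  | zero =>
    obtain ⟨j, hj⟩ := Finsupp.sum_eq_one_iff s |>.1 hs
    subst hj
    change (divDiff i (X j)).IsHomogeneous 0
    rw [divDiff_X]
    exact isHomogeneous_C _ _
  | succ d ih =>
    have : s ≠ 0 := by rintro rfl; simp at hs
    obtain ⟨j, hj⟩ := Finsupp.ne_iff.1 this
    have hle : Finsupp.single j 1 ≤ s := by
      rw [Finsupp.single_le_iff]; exact Nat.one_le_iff_ne_zero.2 hj
    have hsplit : s = Finsupp.single j 1 + (s - Finsupp.single j 1) :=
      (add_tsub_cancel_of_le hle).symm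
    have hdeg : (s - Finsupp.single j 1).degree = d + 1 := by
      have h := congrArg Finsupp.degree hsplit
      rw [map_add, hs, Finsupp.degree_single] at h
      omega
    have hm : (monomial s 1 : MvPolynomial ℕ ℤ) = X j * monomial (s - Finsupp.single j 1) 1 := by
      rw [X, monomial_mul, ← hsplit, one_mul]
    rw [hm, divDiff_mul, divDiff_X, rename_X]
    refine IsHomogeneous.add ?_ ?_
    · have := (isHomogeneous_monomial (1 : ℤ) hdeg).C_mul
        ((if j = i then 1 else 0) - (if j = i + 1 then 1 else 0))
      exact this
    · rw [add_comm d 1]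
      exact (isHomogeneous_X _ _).mul (ih _ hdeg)

theorem isHomogeneous_divDiff {i d : ℕ} {f : MvPolynomial ℕ ℤ} (hf : f.IsHomogeneous (d + 1)) :
    (divDiff i f).IsHomogeneous d := by
  rw [← divDiffLin_apply, f.as_sum, map_sum]
  refine IsHomogeneous.sum _ _ _ fun s hs => ?_
  have : (monomial s (coeff s f) : MvPolynomial ℕ ℤ) = coeff s f • monomial s 1 := by
    rw [smul_monomial, smul_eq_mul, mul_one]
  rw [this, map_smul, smul_eq_C_mul]
  refine (isHomogeneous_divDiff_monomial i d s ?_).C_mul _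
  rw [Finsupp.degree_eq_weight_one]
  exact hf (mem_support_iff.1 hs)

theorem totalDegree_divDiff_lt {i : ℕ} {f : MvPolynomial ℕ ℤ} (h : divDiff i f ≠ 0) :
    (divDiff i f).totalDegree + 1 ≤ f.totalDegree := by
  have h1 : (X i - X (i + 1) : MvPolynomial ℕ ℤ).totalDegree = 1 :=
    ((isHomogeneous_X ℤ i).sub (isHomogeneous_X ℤ (i + 1))).totalDegree
      (X_sub_X_ne_zero (Nat.succ_ne_self i).symm)
  have h2 := totalDegree_mul_of_isDomain (X_sub_X_ne_zero (Nat.succ_ne_self i).symm) h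
  rw [divDiff_spec, h1] at h2
  have h3 := totalDegree_sub f (rename (swap i (i + 1)) f)
  have h4 := totalDegree_rename_le (swap i (i + 1)) f
  omega

/-! ### Functions on permutations that follow divided differences -/

/-- If `F` satisfies `F w = D_i (F (w s_i))` for one ascent `i` of every `w` that has ascents, and
the operators `D_i` satisfy the braid relations, then this holds for all ascents. -/
theorem eq_of_ascent {M : Type*} (D : ℕ → M → M)
    (comm : ∀ i j m, i + 2 ≤ j → D i (D j m) = D j (D i m))
    (braid : ∀ i m, D i (D (i + 1) (D i m)) = D (i + 1) (D i (D (i + 1) m)))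
    (F : Perm (Fin n) → M)
    (hF : ∀ w, (∃ i, IsAscent w i) → ∃ (i : Fin n) (h : i.val + 1 < n),
      w i < w ⟨i.val + 1, h⟩ ∧ F w = D i.val (F (mulSimple w i h)))
    (w : Perm (Fin n)) (i : Fin n) (h : i.val + 1 < n) (hw : w i < w ⟨i.val + 1, h⟩) :
    F w = D i.val (F (mulSimple w i h)) := by
  induction hk : weight w using Nat.strong_induction_on generalizing w i with
  | _ k ih =>
    subst hk
    obtain ⟨j, hj, hwj, e⟩ := hF w ⟨i, h, hw⟩
    have IH : ∀ (z : Perm (Fin n)), weight z < weight w → ∀ (i : Fin n) (h : i.val + 1 < n),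
      z i < z ⟨i.val + 1, h⟩ → F z = D i.val (F (mulSimple z i h)) :=
      fun z hz i h hi => ih _ hz z i h hi rfl
    have far : ∀ (i : Fin n) (h : i.val + 1 < n) (j : Fin n) (hj : j.val + 1 < n),
        w i < w ⟨i.val + 1, h⟩ → w j < w ⟨j.val + 1, hj⟩ → i.val + 2 ≤ j.val →
        D i.val (F (mulSimple w i h)) = D j.val (F (mulSimple w j hj)) := by
      intro i h j hj hwi hwj hij
      rw [IH _ (weight_mulSimple_lt w i h hwi) j hj (by
          rwa [mulSimple_apply_of_ne, mulSimple_apply_of_ne] <;>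
            simp only [ne_eq, Fin.ext_iff] <;> omega),
        IH _ (weight_mulSimple_lt w j hj hwj) i h (by
          rwa [mulSimple_apply_of_ne, mulSimple_apply_of_ne] <;>
            simp only [ne_eq, Fin.ext_iff] <;> omega), comm _ _ _ hij]
      congr 3
      simp only [mulSimple, mul_assoc]
      rw [(Perm.disjoint_swap_swap (by simp [Fin.ext_iff]; omega)).commute.eq]
    have near : ∀ (i : Fin n) (h : i.val + 1 < n) (h' : i.val + 1 + 1 < n),
        w i < w ⟨i.val + 1, h⟩ → w ⟨i.val + 1, h⟩ < w ⟨i.val + 1 + 1, h'⟩ →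
        D i.val (F (mulSimple w i h))
          = D (i.val + 1) (F (mulSimple w ⟨i.val + 1, h⟩ h')) := by
      intro i h h' hwi hwj
      set j : Fin n := ⟨i.val + 1, h⟩ with hjdef
      set k : Fin n := ⟨i.val + 1 + 1, h'⟩ with hkdef
      have hij : i ≠ j := by simp [hjdef, Fin.ext_iff]
      have hjk : j ≠ k := by simp [hjdef, hkdef]
      have hik : i ≠ k := by simp only [hkdef, ne_eq, Fin.ext_iff]; omega
      have a1 : mulSimple w i h = w * swap i j := rfl
      have a2 : mulSimple (mulSimple w i h) j h' = w * swap i j * swap j k := rfl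
      have a3 : mulSimple (mulSimple (mulSimple w i h) j h') i h
        = w * swap i j * swap j k * swap i j := rfl
      have b1 : mulSimple w j h' = w * swap j k := rfl
      have b2 : mulSimple (mulSimple w j h') i h = w * swap j k * swap i j := rfl
      have b3 : mulSimple (mulSimple (mulSimple w j h') i h) j h'
        = w * swap j k * swap i j * swap j k := rfl
      have hperm : w * swap i j * swap j k * swap i j = w * swap j k * swap i j * swap j k := by
        simp only [mul_assoc]
        rw [← mul_assoc (swap i j), ← mul_assoc (swap j k), swap_mul_swap_mul_swap hij hik,
          swap_comm i j, swap_comm j k, swap_mul_swap_mul_swap hjk.symm hik.symm, swap_comm]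
      have w1 := weight_mulSimple_lt w i h hwi
      have w2 := weight_mulSimple_lt w j h' hwj
      have c1 : mulSimple w i h j < mulSimple w i h k := by
        rw [a1, Perm.mul_apply, Perm.mul_apply, swap_apply_right,
          swap_apply_of_ne_of_ne hik.symm hjk.symm]
        exact hwi.trans hwj
      have c2 : mulSimple w j h' i < mulSimple w j h' j := by
        rw [b1, Perm.mul_apply, Perm.mul_apply, swap_apply_left,
          swap_apply_of_ne_of_ne hij hik]
        exact hwi.trans hwj
      have c3 : mulSimple (mulSimple w i h) j h' i < mulSimple (mulSimple w i h) j h' j := by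
        rw [a2]
        simp only [Perm.mul_apply, swap_apply_left, swap_apply_of_ne_of_ne hij hik,
          swap_apply_of_ne_of_ne hik.symm hjk.symm]
        exact hwj
      have c4 : mulSimple (mulSimple w j h') i h j < mulSimple (mulSimple w j h') i h k := by
        rw [b2]
        simp only [Perm.mul_apply, swap_apply_right, swap_apply_of_ne_of_ne hij hik,
          swap_apply_of_ne_of_ne hik.symm hjk.symm]
        exact hwi
      rw [IH _ w1 j h' c1, IH _ ((weight_mulSimple_lt _ j h' c1).trans w1) i h c3,
        IH _ w2 i h c2, IH _ ((weight_mulSimple_lt _ i h c2).trans w2) j h' c4, a3, b3, hperm]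
      exact braid _ _
    rw [e]
    rcases lt_trichotomy i.val j.val with hlt | heq | hgt
    · rcases Nat.lt_or_ge (i.val + 1) j.val with h2 | h2
      · exact (far i h j hj hw hwj h2).symm
      · obtain ⟨j, hjn⟩ := j
        obtain rfl : j = i.val + 1 := by simp only at hlt h2; omega
        exact (near i h hj hw hwj).symm
    · obtain rfl : i = j := Fin.ext heq
      rfl
    · rcases Nat.lt_or_ge (j.val + 1) i.val with h2 | h2
      · exact far j hj i h hwj hw h2
      · obtain ⟨i, hin⟩ := i
        obtain rfl : i = j.val + 1 := by simp only at hgt h2; omega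
        exact near j hj h hwj hw

/-! ### Schubert polynomials -/

theorem schubert_eq_divDiff (w : Perm (Fin n)) (i : Fin n) (h : i.val + 1 < n)
    (hw : w i < w ⟨i.val + 1, h⟩) : schubert w = divDiff i.val (schubert (mulSimple w i h)) := by
  refine eq_of_ascent divDiff (fun i j m hij => divDiff_comm hij m) divDiff_braid schubert ?_ w i h
    hw
  intro w hex
  refine ⟨Classical.choose hex, (Classical.choose_spec hex).choose,
    (Classical.choose_spec hex).choose_spec, ?_⟩
  conv_lhs => rw [schubert, dif_pos hex]

theorem divDiff_schubert_of_ascent (w : Perm (Fin n)) (i : Fin n) (h : i.val + 1 < n)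
    (hw : w i < w ⟨i.val + 1, h⟩) : divDiff i.val (schubert w) = 0 := by
  rw [schubert_eq_divDiff w i h hw, divDiff_divDiff]

theorem divDiff_schubert_of_descent (w : Perm (Fin n)) (i : Fin n) (h : i.val + 1 < n)
    (hw : w ⟨i.val + 1, h⟩ < w i) : divDiff i.val (schubert w) = schubert (mulSimple w i h) := by
  rw [schubert_eq_divDiff (mulSimple w i h) i h (by simpa using hw), mulSimple_mulSimple]

theorem schubert_revPerm :
    schubert (Fin.revPerm : Perm (Fin n)) = ∏ i : Fin n, X i.val ^ (n - 1 - i.val) := by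
  rw [schubert, dif_neg]
  rintro ⟨i, h, hi⟩
  simp only [Fin.revPerm_apply, Fin.rev_lt_rev] at hi
  exact absurd hi (not_lt.2 lt_next.le)

theorem isHomogeneous_schubert (w : Perm (Fin n)) : (schubert w).IsHomogeneous (inv w) := by
  induction hk : weight w using Nat.strong_induction_on generalizing w with
  | _ k ih =>
    by_cases hw : w = Fin.revPerm
    · subst hw
      rw [schubert_revPerm, inv_eq_sum_code, Finset.sum_congr rfl fun j _ => code_revPerm j]
      exact IsHomogeneous.prod _ _ _ fun j _ => isHomogeneous_X_pow _ _
    · obtain ⟨i, h, hi, -⟩ := exists_first_ascent hw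
      rw [schubert_eq_divDiff w i h hi]
      apply isHomogeneous_divDiff
      rw [← inv_mulSimple w i h hi]
      exact ih _ (hk ▸ weight_mulSimple_lt w i h hi) _ rfl

/-- The Schubert polynomial of a dominant permutation, one whose code is weakly decreasing, is the
monomial of its code. At its first ascent `i` the code takes equal values at `i` and `i + 1`,
so `w s_i` is dominant again and its monomial is `x_i` times one that is symmetric in
`x_i, x_{i+1}`. -/
theorem schubert_of_dominant (w : Perm (Fin n))
    (hd : ∀ (i : Fin n) (h : i.val + 1 < n), code w ⟨i.val + 1, h⟩ ≤ code w i) :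
    schubert w = ∏ i : Fin n, X i.val ^ code w i := by
  induction hk : weight w using Nat.strong_induction_on generalizing w with
  | _ k ih =>
    by_cases hw : w = Fin.revPerm
    · subst hw
      rw [schubert_revPerm]
      exact Finset.prod_congr rfl fun j _ => by rw [code_revPerm]
    · obtain ⟨i, h, hi, hfirst⟩ := exists_first_ascent hw
      set i' : Fin n := ⟨i.val + 1, h⟩ with hi'
      have hne : i' ≠ i := lt_next.ne'
      have hle : code w i ≤ code w i' := by
        refine Finset.card_le_card fun k => ?_
        simp only [Finset.mem_filter, Finset.mem_univ, true_and]
        rintro ⟨h1, h2⟩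
        refine ⟨lt_of_le_of_ne (Fin.le_def.2 (Fin.lt_def.1 h1)) ?_, h2.trans hi⟩
        rintro rfl
        exact absurd h2 (not_lt.2 hi.le)
      have heq : code w i' = code w i := le_antisymm (hd i h) hle
      have hstrict : ∀ (j : Fin n) (h' : j.val + 1 < n), j < i →
          code w ⟨j.val + 1, h'⟩ < code w j := by
        intro j h' hj
        have := code_mulSimple_left (mulSimple w j h') j h' (by simpa using hfirst j h' hj)
        have h2 := code_mulSimple_right (mulSimple w j h') j h' (by simpa using hfirst j h' hj)
        rw [mulSimple_mulSimple] at this h2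
        have h3 : code (mulSimple w j h') j ≤ code (mulSimple w j h') ⟨j.val + 1, h'⟩ := by
          refine Finset.card_le_card fun k => ?_
          simp only [Finset.mem_filter, Finset.mem_univ, true_and]
          have hlt : mulSimple w j h' j < mulSimple w j h' ⟨j.val + 1, h'⟩ := by
            simpa using hfirst j h' hj
          rintro ⟨h1, h2⟩
          refine ⟨lt_of_le_of_ne (Fin.le_def.2 (Fin.lt_def.1 h1)) ?_, h2.trans hlt⟩
          rintro rfl
          exact absurd h2 (not_lt.2 hlt.le)
        omega
      have c1 : code (mulSimple w i h) i = code w i + 1 := by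
        rw [code_mulSimple_left w i h hi]; exact congrArg (· + 1) heq
      have c2 : code (mulSimple w i h) i' = code w i := code_mulSimple_right w i h hi
      have c3 : ∀ j, j ≠ i → j ≠ i' → code (mulSimple w i h) j = code w j :=
        code_mulSimple_of_ne w i h
      rw [schubert_eq_divDiff w i h hi, ih _ (hk ▸ weight_mulSimple_lt w i h hi) _ ?_ rfl]
      · have hmem : i' ∈ Finset.univ.erase i := Finset.mem_erase.2 ⟨hne, Finset.mem_univ _⟩
        rw [← Finset.mul_prod_erase _ _ (Finset.mem_univ i), ← Finset.mul_prod_erase _ _ hmem,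
          ← Finset.mul_prod_erase _ (fun j => X j.val ^ code w j) (Finset.mem_univ i),
          ← Finset.mul_prod_erase _ (fun j => X j.val ^ code w j) hmem, c1, c2, heq,
          Finset.prod_congr rfl fun j hj => by
            rw [c3 j (Finset.mem_erase.1 (Finset.mem_erase.1 hj).2).1 (Finset.mem_erase.1 hj).1]]
        set P : MvPolynomial ℕ ℤ := ∏ j ∈ (Finset.univ.erase i).erase i', X j.val ^ code w j
          with hP
        have hPs : rename (swap i.val (i.val + 1)) P = P := by
          rw [hP, map_prod]
          refine Finset.prod_congr rfl fun j hj => ?_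
          obtain ⟨h1, h2⟩ := Finset.mem_erase.1 hj
          have h3 := (Finset.mem_erase.1 h2).1
          rw [map_pow, rename_X, swap_apply_of_ne_of_ne (fun e => h3 (Fin.ext e))
            (fun e => h1 (Fin.ext e))]
        apply divDiff_eq_of_mul_eq
        simp only [map_mul, map_pow, rename_X, hPs, hi', swap_apply_left, swap_apply_right]
        ring
      · intro j hj
        by_cases hji : j = i
        · subst hji
          change code _ i' ≤ _
          rw [c1, c2]; exact Nat.le_succ _
        · by_cases hji' : j = i'
          · subst hji'
            rw [c2, c3 _ (by simp [Fin.ext_iff, hi']; omega) (by simp [Fin.ext_iff])]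
            exact (hd _ _).trans heq.le
          · rw [c3 j hji hji']
            by_cases hj2 : (⟨j.val + 1, hj⟩ : Fin n) = i
            · rw [hj2, c1]
              have := hstrict j hj (by rw [← hj2]; exact lt_next)
              rw [hj2] at this
              exact this
            · rw [c3 _ hj2 (fun e => hji (Fin.ext (by
                have := congrArg Fin.val e
                simp only [hi'] at this
                omega)))]
              exact hd j hj

theorem code_one (j : Fin n) : code (1 : Perm (Fin n)) j = 0 := by
  have h := inv_eq_sum_code (1 : Perm (Fin n))
  rw [inv_one] at h
  exact Finset.sum_eq_zero_iff.1 h.symm j (Finset.mem_univ _)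

theorem schubert_one : schubert (1 : Perm (Fin n)) = 1 := by
  rw [schubert_of_dominant _ (by simp [code_one])]
  simp [code_one]

theorem constantCoeff_schubert (w : Perm (Fin n)) :
    constantCoeff (schubert w) = if w = 1 then 1 else 0 := by
  split_ifs with h
  · rw [h, schubert_one, map_one]
  · exact (isHomogeneous_schubert w).coeff_eq_zero (by simpa using (inv_pos h).ne)

/-! ### Coefficient functionals -/

/-- The constant coefficient as a linear functional. -/
noncomputable def constLin : MvPolynomial ℕ ℤ →ₗ[ℤ] ℤ :=
  (constantCoeff : MvPolynomial ℕ ℤ →+* ℤ).toAddMonoidHom.toIntLinearMap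

open Classical in
/-- The functional `f ↦ (∂_{w₀ w} f)(0)`, by recursion along the ascents of `w`; see
`schubertCoeff`. -/
noncomputable def revCoeff {n : ℕ} (w : Perm (Fin n)) : MvPolynomial ℕ ℤ →ₗ[ℤ] ℤ :=
  if h : ∃ i, IsAscent w i then
    (revCoeff (mulSimple w (Classical.choose h) (Classical.choose_spec h).choose)).comp
      (divDiffLin (Classical.choose h).val)
  else constLin
termination_by weight w
decreasing_by exact weight_mulSimple_lt w _ _ (Classical.choose_spec h).choose_spec

theorem revCoeff_of_ascent (w : Perm (Fin n)) (i : Fin n) (h : i.val + 1 < n)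
    (hw : w i < w ⟨i.val + 1, h⟩) :
    revCoeff w = (revCoeff (mulSimple w i h)).comp (divDiffLin i.val) := by
  refine eq_of_ascent (fun i (φ : MvPolynomial ℕ ℤ →ₗ[ℤ] ℤ) => φ.comp (divDiffLin i)) ?_ ?_
    revCoeff ?_ w i h hw
  · intro i j φ hij
    exact LinearMap.ext fun f => by simp [divDiff_comm hij]
  · intro i φ
    exact LinearMap.ext fun f => by simp [divDiff_braid]
  · intro w hex
    refine ⟨Classical.choose hex, (Classical.choose_spec hex).choose,
      (Classical.choose_spec hex).choose_spec, ?_⟩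
    conv_lhs => rw [revCoeff, dif_pos hex]

/-- The functional `f ↦ (∂_w f)(0)`. It reads off the coefficient of `schubert w` from an expansion
into Schubert polynomials, see `schubertCoeff_schubert`. -/
noncomputable def schubertCoeff {n : ℕ} (w : Perm (Fin n)) : MvPolynomial ℕ ℤ →ₗ[ℤ] ℤ :=
  revCoeff (Fin.revPerm * w)

theorem schubertCoeff_one (f : MvPolynomial ℕ ℤ) :
    schubertCoeff (1 : Perm (Fin n)) f = constantCoeff f := by
  rw [schubertCoeff, revCoeff, dif_neg]
  · rfl
  · rintro ⟨i, h, hi⟩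
    rw [revPerm_mul_lt] at hi
    exact absurd hi (not_lt.2 lt_next.le)

theorem schubertCoeff_of_descent (w : Perm (Fin n)) (i : Fin n) (h : i.val + 1 < n)
    (hw : w ⟨i.val + 1, h⟩ < w i) (f : MvPolynomial ℕ ℤ) :
    schubertCoeff w f = schubertCoeff (mulSimple w i h) (divDiff i.val f) := by
  rw [schubertCoeff, revCoeff_of_ascent _ i h ((revPerm_mul_lt _ _ _).2 hw)]
  simp only [schubertCoeff, mulSimple, mul_assoc, LinearMap.comp_apply, divDiffLin_apply]

theorem schubertCoeff_mulSimple (w : Perm (Fin n)) (i : Fin n) (h : i.val + 1 < n)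
    (hw : w i < w ⟨i.val + 1, h⟩) (f : MvPolynomial ℕ ℤ) :
    schubertCoeff (mulSimple w i h) f = schubertCoeff w (divDiff i.val f) := by
  rw [schubertCoeff_of_descent _ i h (by simpa using hw), mulSimple_mulSimple]

theorem schubertCoeff_divDiff_of_descent (w : Perm (Fin n)) (i : Fin n) (h : i.val + 1 < n)
    (hw : w ⟨i.val + 1, h⟩ < w i) (f : MvPolynomial ℕ ℤ) :
    schubertCoeff w (divDiff i.val f) = 0 := by
  rw [schubertCoeff_of_descent w i h hw, divDiff_divDiff, map_zero]

theorem schubertCoeff_schubert (z y : Perm (Fin n)) :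
    schubertCoeff z (schubert y) = if y = z then 1 else 0 := by
  induction z using perm_induction generalizing y with
  | one => rw [schubertCoeff_one, constantCoeff_schubert]
  | step z i h hz ih =>
    rw [schubertCoeff_mulSimple z i h hz]
    rcases lt_or_gt_next y i h with hy | hy
    · rw [divDiff_schubert_of_ascent y i h hy, map_zero, if_neg]
      rintro rfl
      simp only [mulSimple_apply_left, mulSimple_apply_right] at hy
      exact absurd hy (not_lt.2 hz.le)
    · rw [divDiff_schubert_of_descent y i h hy, ih]
      refine if_congr ?_ rfl rfl
      constructor
      · rintro rfl; rw [mulSimple_mulSimple]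
      · rintro rfl; rw [mulSimple_mulSimple]

/-- The pairing of the variable `x_k` with the root of the transposition of `a` and `b`. -/
def rootPairing (k a b : Fin n) : ℤ := (if k = a then 1 else 0) - (if k = b then 1 else 0)

/-- The dual form of Monk's rule for multiplication by a variable. -/
theorem schubertCoeff_X_mul (w : Perm (Fin n)) (k : Fin n) (f : MvPolynomial ℕ ℤ) :
    schubertCoeff w (X k.val * f) = ∑ p : Fin n × Fin n,
      if p.1 < p.2 ∧ inv (w * swap p.1 p.2) + 1 = inv w then
        rootPairing k p.1 p.2 * schubertCoeff (w * swap p.1 p.2) f else 0 := by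
  induction w using perm_induction generalizing k f with
  | one =>
    rw [schubertCoeff_one, map_mul, constantCoeff_X, zero_mul]
    refine (Finset.sum_eq_zero fun p _ => if_neg ?_).symm
    rw [inv_one]; omega
  | step w i h hw ih =>
    set i' : Fin n := ⟨i.val + 1, h⟩ with hi'
    set s : Perm (Fin n) := swap i i' with hs
    have hii : i < i' := lt_next
    have hws : mulSimple w i h = w * s := rfl
    have hinv : inv (w * s) = inv w + 1 := inv_mulSimple w i h hw
    have hsk : (swap i.val (i.val + 1)) k.val = (s k).val := by
      by_cases h1 : k = i
      · subst h1; simp [hs, hi']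
      · by_cases h2 : k = i'
        · rw [h2, hs, swap_apply_right]; simp [hi']
        · rw [hs, swap_apply_of_ne_of_ne h1 h2, swap_apply_of_ne_of_ne (fun e => h1 (Fin.ext e))
            (fun e => h2 (Fin.ext e))]
    have hpair : (((if k.val = i.val then 1 else 0) - (if k.val = i.val + 1 then 1 else 0) : ℤ))
        = rootPairing k i i' := by
      simp [rootPairing, Fin.ext_iff, hi']
    rw [schubertCoeff_mulSimple w i h hw, divDiff_mul, divDiff_X, rename_X, hsk, hpair, map_add,
      ← smul_eq_C_mul, map_smul, ih, hws]
    have hss : w * s * swap i i' = w := by rw [hs, mul_assoc, swap_mul_self, mul_one]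
    have hord : ∀ a b : Fin n, a < b → (a, b) ≠ (i, i') → s a < s b := by
      intro a b hab hne
      have hne' : a.val = i.val → b.val ≠ i.val + 1 := fun e1 e2 =>
        hne (Prod.ext (Fin.ext e1) (Fin.ext e2))
      have hv : i'.val = i.val + 1 := rfl
      simp only [hs, swap_apply_def, Fin.ext_iff]
      rw [Fin.lt_def] at hab ⊢
      split_ifs <;> omega
    -- The pair `(i, i')` gives the extra summand; the others are matched by conjugation with `s`.
    rw [← (Equiv.prodCongr s s).sum_comp,
      show rootPairing k i i' • schubertCoeff w f = ∑ p : Fin n × Fin n,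
        if p = (i, i') then rootPairing k i i' * schubertCoeff w f else 0 by simp,
      ← Finset.sum_add_distrib]
    refine Finset.sum_congr rfl ?_
    rintro ⟨a, b⟩ -
    simp only [prodCongr_apply, Prod.map_apply]
    by_cases hp : (a, b) = (i, i')
    · obtain ⟨rfl, rfl⟩ := Prod.mk.inj hp
      rw [if_pos rfl, if_neg, add_zero, if_pos ⟨hii, by rw [hss, hinv]⟩, hss]
      rw [hs, swap_apply_left, swap_apply_right]
      exact fun hc => absurd hc.1 (not_lt.2 hii.le)
    rw [if_neg hp, zero_add]
    have hconj : w * s * swap a b = w * swap (s a) (s b) * s := by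
      rw [mul_assoc, mul_swap_eq_swap_mul s a b, ← mul_assoc]
    have hss' : ∀ x, s (s x) = x := fun x => by rw [hs, swap_apply_self]
    by_cases hab : a < b
    · have hsab := hord a b hab hp
      have hroot : rootPairing (s k) (s a) (s b) = rootPairing k a b := by simp [rootPairing]
      rw [hconj, hroot]
      set z := w * swap (s a) (s b) with hz
      have hzs : z * s = mulSimple z i h := rfl
      rcases lt_or_gt_next z i h with hasc | hdesc
      · rw [hzs, inv_mulSimple z i h hasc, hinv, schubertCoeff_mulSimple z i h hasc]
        exact if_congr ⟨fun hc => ⟨hab, by omega⟩, fun hc => ⟨hsab, by omega⟩⟩ rfl rfl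
      · rw [schubertCoeff_divDiff_of_descent z i h hdesc, mul_zero, ite_self, if_neg]
        rintro ⟨-, hc⟩
        have h1 := inv_mulSimple_of_gt z i h hdesc
        rw [← hzs] at h1
        have h2 : w (s a) < w (s b) := lt_of_inv_lt_mul_swap hsab (by rw [← hz]; omega)
        have h3 := inv_lt_inv_mul_swap (w * s) a b hab h2
        rw [hconj] at h3
        omega
    · rw [if_neg (fun hc => ?_), if_neg (fun hc => hab hc.1)]
      obtain ⟨h1, h2⟩ := hc
      by_cases hq : (s a, s b) = (i, i')
      · obtain ⟨e1, e2⟩ := Prod.mk.inj hq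
        rw [e1, e2, ← hs, hinv] at h2
        omega
      · exact hab (by simpa only [hss'] using hord _ _ h1 hq)

/-! ### The ideal of polynomials with vanishing coefficients -/

theorem divDiff_X_mul_of_le {i k : ℕ} (h : i + 1 < k) (f : MvPolynomial ℕ ℤ) :
    divDiff i (X k * f) = X k * divDiff i f :=
  divDiff_mul_of_symm (by rw [divDiff_X, if_neg (by omega), if_neg (by omega), sub_zero, map_zero])

theorem schubertCoeff_X_mul_of_le (w : Perm (Fin n)) {k : ℕ} (hk : n ≤ k) (f : MvPolynomial ℕ ℤ) :
    schubertCoeff w (X k * f) = 0 := by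
  induction w using perm_induction generalizing f with
  | one => rw [schubertCoeff_one, map_mul, constantCoeff_X, zero_mul]
  | step w i h hw ih =>
    rw [schubertCoeff_mulSimple w i h hw, divDiff_X_mul_of_le (by omega), ih]

/-- The polynomials annihilated by all functionals of `S_n` form an ideal. -/
theorem schubertCoeff_mul_eq_zero {f : MvPolynomial ℕ ℤ}
    (hf : ∀ w : Perm (Fin n), schubertCoeff w f = 0) (g : MvPolynomial ℕ ℤ) (w : Perm (Fin n)) :
    schubertCoeff w (f * g) = 0 := by
  induction g using MvPolynomial.induction_on generalizing w with
  | C a => rw [mul_comm, ← smul_eq_C_mul, map_smul, hf, smul_zero]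
  | add p q hp hq => rw [mul_add, map_add, hp, hq, add_zero]
  | mul_X p k hp =>
    rw [← mul_assoc, mul_comm]
    by_cases hk : k < n
    · rw [schubertCoeff_X_mul w ⟨k, hk⟩]
      exact Finset.sum_eq_zero fun q _ => by rw [hp, mul_zero, ite_self]
    · exact schubertCoeff_X_mul_of_le w (not_lt.1 hk) _

/-- Modulo the ideal of polynomials with vanishing coefficients, every polynomial equals its
Schubert expansion in `S_n`. -/
theorem schubertCoeff_mul (w : Perm (Fin n)) (f g : MvPolynomial ℕ ℤ) :
    schubertCoeff w (f * g)
      = ∑ z : Perm (Fin n), schubertCoeff z f * schubertCoeff w (schubert z * g) := by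
  have h := schubertCoeff_mul_eq_zero (f := f - ∑ z : Perm (Fin n), schubertCoeff z f • schubert z)
    (fun y => by
      simp only [map_sub, map_sum, map_smul, schubertCoeff_schubert, smul_eq_mul, mul_ite, mul_one,
        mul_zero, Finset.sum_ite_eq', Finset.mem_univ, if_true, sub_self]) g w
  rw [sub_mul, map_sub, sub_eq_zero] at h
  rw [h, Finset.sum_mul, map_sum]
  exact Finset.sum_congr rfl fun z _ => by rw [smul_mul_assoc, map_smul, smul_eq_mul]

/-- Monk's rule for multiplication by a variable, read off in `S_n`. -/
theorem schubertCoeff_X_mul_schubert_mul (w u : Perm (Fin n)) (k : Fin n)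
    (g : MvPolynomial ℕ ℤ) :
    schubertCoeff w (X k.val * (schubert u * g)) = ∑ p : Fin n × Fin n,
      if p.1 < p.2 ∧ inv (u * swap p.1 p.2) = inv u + 1 then
        rootPairing k p.1 p.2 * schubertCoeff w (schubert (u * swap p.1 p.2) * g) else 0 := by
  rw [← mul_assoc, schubertCoeff_mul]
  simp only [schubertCoeff_X_mul, schubertCoeff_schubert, Finset.sum_mul]
  rw [Finset.sum_comm]
  refine Finset.sum_congr rfl fun p _ => ?_
  have hp : ∀ z : Perm (Fin n), u = z * swap p.1 p.2 ↔ z = u * swap p.1 p.2 := fun z =>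
    ⟨fun h => by rw [h, mul_assoc, swap_mul_self, mul_one],
      fun h => by rw [h, mul_assoc, swap_mul_self, mul_one]⟩
  rw [Finset.sum_eq_single (u * swap p.1 p.2)]
  · have : u * swap p.1 p.2 * swap p.1 p.2 = u := by rw [mul_assoc, swap_mul_self, mul_one]
    rw [this, if_pos rfl, mul_one, ite_mul, zero_mul]
    exact if_congr (and_congr_right fun _ => eq_comm) rfl rfl
  · intro z _ hz
    rw [if_neg (fun h => hz ((hp z).1 h)), mul_zero, ite_self, zero_mul]
  · simp

/-! ### The recurrence for structure constants -/

/-- The coefficient of `schubert w` in the product of the Schubert polynomials of `u` and `v`. -/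
noncomputable def structureCoeff {n : ℕ} (u v w : Perm (Fin n)) : ℤ :=
  schubertCoeff w (schubert u * schubert v)

section Recurrence

variable {u v w : Perm (Fin n)} {i : Fin n} {h : i.val + 1 < n}

theorem structureCoeff_ascent_ascent (hu : u i < u ⟨i.val + 1, h⟩) (hv : v i < v ⟨i.val + 1, h⟩)
    (hw : w i < w ⟨i.val + 1, h⟩) :
    structureCoeff u v w = structureCoeff (mulSimple u i h) v (mulSimple w i h) := by
  rw [structureCoeff, structureCoeff, schubertCoeff_mulSimple w i h hw, mul_comm,
    mul_comm (schubert (mulSimple u i h)),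
    divDiff_mul_of_symm (divDiff_schubert_of_ascent v i h hv), ← schubert_eq_divDiff u i h hu]

theorem structureCoeff_ascent_descent (hu : u i < u ⟨i.val + 1, h⟩)
    (hv : v i < v ⟨i.val + 1, h⟩) (hw : w ⟨i.val + 1, h⟩ < w i) :
    structureCoeff u v w = 0 := by
  rw [structureCoeff, mul_comm, schubert_eq_divDiff u i h hu,
    ← divDiff_mul_of_symm (divDiff_schubert_of_ascent v i h hv),
    schubertCoeff_divDiff_of_descent w i h hw]

theorem structureCoeff_descent_descent (hu : u i < u ⟨i.val + 1, h⟩)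
    (hv : v ⟨i.val + 1, h⟩ < v i) (hw : w ⟨i.val + 1, h⟩ < w i) :
    structureCoeff u v w = structureCoeff (mulSimple u i h) (mulSimple v i h) w := by
  rw [structureCoeff, structureCoeff, schubertCoeff_of_descent w i h hw,
    schubertCoeff_of_descent w i h hw,
    divDiff_mul_of_symm (divDiff_schubert_of_ascent u i h hu),
    mul_comm (schubert (mulSimple u i h)),
    divDiff_mul_of_symm (divDiff_schubert_of_ascent (mulSimple v i h) i h (by simpa using hv)),
    divDiff_schubert_of_descent v i h hv, ← schubert_eq_divDiff u i h hu, mul_comm]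

/-- The multiplicity of the transposition of `a` and `b` in the mixed case of the recurrence at
position `i`: its pairing with `x_i - x_{i+1}`, diminished by one for the simple transposition. -/
def mixedCoeff (i i' a b : Fin n) : ℤ :=
  rootPairing i a b - rootPairing i' a b - if a = i ∧ b = i' then 1 else 0

/-- The mixed case of the recurrence. With `A`, `B` the Schubert polynomials of `u s_i` and `v`,
the Leibniz rule reads `∂A ∂B (x_i - x_{i+1}) = ∂A B + A ∂B - ∂(AB)`, and
`x_i - x_{i+1}` is expanded by Monk's rule. -/
theorem structureCoeff_descent_ascent (hu : u i < u ⟨i.val + 1, h⟩)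
    (hv : v ⟨i.val + 1, h⟩ < v i) (hw : w i < w ⟨i.val + 1, h⟩) :
    structureCoeff u v w = structureCoeff (mulSimple u i h) v (mulSimple w i h) +
      ∑ p : Fin n × Fin n, if p.1 < p.2 ∧ inv (u * swap p.1 p.2) = inv u + 1 then
        mixedCoeff i ⟨i.val + 1, h⟩ p.1 p.2 *
          structureCoeff (u * swap p.1 p.2) (mulSimple v i h) w else 0 := by
  set i' : Fin n := ⟨i.val + 1, h⟩ with hi'
  set A := schubert (mulSimple u i h) with hA
  have e1 : divDiff i.val (A * schubert v) = schubert u * schubert v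
      + (A - (X i.val - X (i.val + 1)) * schubert u) * schubert (mulSimple v i h) := by
    rw [divDiff_mul, ← schubert_eq_divDiff u i h hu, divDiff_schubert_of_descent v i h hv]
    congr 2
    have := divDiff_spec i.val A
    rw [← schubert_eq_divDiff u i h hu] at this
    linear_combination this
  have e2 : schubert u * schubert v = divDiff i.val (A * schubert v)
      - A * schubert (mulSimple v i h)
      + X i.val * (schubert u * schubert (mulSimple v i h))
      - X i'.val * (schubert u * schubert (mulSimple v i h)) := by
    rw [e1, hi']; ring
  have hsum : schubertCoeff w (A * schubert (mulSimple v i h)) = ∑ p : Fin n × Fin n,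
      if p.1 < p.2 ∧ inv (u * swap p.1 p.2) = inv u + 1 then
        (if p.1 = i ∧ p.2 = i' then 1 else 0) *
          structureCoeff (u * swap p.1 p.2) (mulSimple v i h) w else 0 := by
    rw [Finset.sum_eq_single (i, i')]
    · rw [if_pos ⟨lt_next, inv_mulSimple u i h hu⟩, if_pos ⟨rfl, rfl⟩, one_mul]
      rfl
    · rintro ⟨a, b⟩ _ hne
      rw [if_neg (fun hc : a = i ∧ b = i' => hne (Prod.ext hc.1 hc.2)), zero_mul, ite_self]
    · simp
  rw [structureCoeff, e2, map_sub, map_add, map_sub, hsum, schubertCoeff_X_mul_schubert_mul,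
    schubertCoeff_X_mul_schubert_mul, ← schubertCoeff_mulSimple w i h hw]
  have hterm : ∀ p : Fin n × Fin n,
      (if p.1 < p.2 ∧ inv (u * swap p.1 p.2) = inv u + 1 then
        mixedCoeff i i' p.1 p.2 * structureCoeff (u * swap p.1 p.2) (mulSimple v i h) w else 0)
      = (if p.1 < p.2 ∧ inv (u * swap p.1 p.2) = inv u + 1 then rootPairing i p.1 p.2 *
          schubertCoeff w (schubert (u * swap p.1 p.2) * schubert (mulSimple v i h)) else 0)
        - (if p.1 < p.2 ∧ inv (u * swap p.1 p.2) = inv u + 1 then rootPairing i' p.1 p.2 *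
          schubertCoeff w (schubert (u * swap p.1 p.2) * schubert (mulSimple v i h)) else 0)
        - (if p.1 < p.2 ∧ inv (u * swap p.1 p.2) = inv u + 1 then
          (if p.1 = i ∧ p.2 = i' then 1 else 0) *
            structureCoeff (u * swap p.1 p.2) (mulSimple v i h) w else 0) := by
    intro p
    by_cases hc : p.1 < p.2 ∧ inv (u * swap p.1 p.2) = inv u + 1
    · simp only [if_pos hc, mixedCoeff, structureCoeff]; ring
    · simp only [if_neg hc, sub_zero]
  rw [Finset.sum_congr rfl fun p _ => hterm p, Finset.sum_sub_distrib, Finset.sum_sub_distrib,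
    structureCoeff]
  ring

end Recurrence

theorem structureCoeff_revPerm :
    structureCoeff (Fin.revPerm : Perm (Fin n)) 1 Fin.revPerm = 1 := by
  rw [structureCoeff, schubert_one, mul_one, schubertCoeff_schubert, if_pos rfl]

/-! ### Expansions into Schubert polynomials -/

theorem degreeOf_X_sub_X (i j : ℕ) : degreeOf j (X i - X (i + 1) : MvPolynomial ℕ ℤ)
    = if j = i ∨ j = i + 1 then 1 else 0 := by
  rw [sub_eq_add_neg]
  have e : ∀ k : ℕ, k ≠ k + 1 := fun k => (Nat.succ_ne_self k).symm
  by_cases h1 : j = i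
  · subst h1
    rw [degreeOf_add_eq_of_degreeOf_lt, degreeOf_X_self, if_pos (Or.inl rfl)]
    rw [degreeOf_neg, degreeOf_X_self, degreeOf_X_of_ne (e j)]
    exact Nat.one_pos
  · by_cases h2 : j = i + 1
    · subst h2
      rw [add_comm (X i) _, degreeOf_add_eq_of_degreeOf_lt, degreeOf_neg, degreeOf_X_self,
        if_pos (Or.inr rfl)]
      rw [degreeOf_neg, degreeOf_X_self, degreeOf_X_of_ne (e i).symm]
      exact Nat.one_pos
    · rw [if_neg (by tauto), ← Nat.le_zero]
      refine (degreeOf_add_le _ _ _).trans ?_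
      rw [degreeOf_neg, degreeOf_X_of_ne h1, degreeOf_X_of_ne h2, max_self]

theorem degreeOf_divDiff_le {i j : ℕ} {f : MvPolynomial ℕ ℤ} (h : divDiff i f ≠ 0) :
    degreeOf j (divDiff i f) + (if j = i ∨ j = i + 1 then 1 else 0)
      ≤ max (degreeOf j f) (degreeOf (swap i (i + 1) j) f) := by
  have h1 : degreeOf j (rename (swap i (i + 1)) f) = degreeOf (swap i (i + 1) j) f := by
    conv_lhs => rw [← swap_apply_self i (i + 1) j]
    exact degreeOf_rename_of_injective (swap i (i + 1)).injective _
  rw [← degreeOf_X_sub_X, ← h1, add_comm,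
    ← degreeOf_mul_eq (X_sub_X_ne_zero (Nat.succ_ne_self i).symm) h, divDiff_spec]
  exact degreeOf_sub_le _ _ _

/-- The exponents of `f` are bounded by the staircase `N - 1, N - 2, …, 0, 0, …`, that is by the
exponents in the Schubert polynomial of the long element of `S_N`. -/
def InStaircase (N : ℕ) (f : MvPolynomial ℕ ℤ) : Prop := ∀ j, degreeOf j f ≤ N - 1 - j

theorem InStaircase.divDiff {N i : ℕ} {f : MvPolynomial ℕ ℤ} (hf : InStaircase N f) :
    InStaircase N (divDiff i f) := by
  intro j
  by_cases h : SchubertPuzzle.divDiff i f = 0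
  · rw [h, degreeOf_zero]; exact Nat.zero_le _
  have h1 := degreeOf_divDiff_le (j := j) h
  have h2 := hf j
  have h3 := hf (swap i (i + 1) j)
  by_cases h4 : j = i
  · subst h4
    rw [swap_apply_left] at h1 h3
    rw [if_pos (Or.inl rfl)] at h1
    omega
  · by_cases h5 : j = i + 1
    · subst h5
      rw [swap_apply_right] at h1 h3
      rw [if_pos (Or.inr rfl)] at h1
      omega
    · rw [swap_apply_of_ne_of_ne h4 h5] at h1 h3
      omega

theorem InStaircase.divDiff_eq_zero {N i : ℕ} {f : MvPolynomial ℕ ℤ} (hf : InStaircase N f)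
    (hi : N ≤ i + 1) : SchubertPuzzle.divDiff i f = 0 := by
  by_contra h
  have h1 := degreeOf_divDiff_le (j := i) h
  rw [swap_apply_left, if_pos (Or.inl rfl)] at h1
  have h2 := hf i
  have h3 := hf (i + 1)
  omega

theorem inStaircase_schubert (w : Perm (Fin n)) : InStaircase n (schubert w) := by
  induction hk : weight w using Nat.strong_induction_on generalizing w with
  | _ k ih =>
    by_cases hw : w = Fin.revPerm
    · subst hw
      intro j
      rw [schubert_revPerm]
      refine (degreeOf_prod_le _ _ _).trans ?_
      by_cases hj : j < n
      · rw [Finset.sum_eq_single (⟨j, hj⟩ : Fin n)]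
        · simp
        · intro k _ hk
          exact degreeOf_X_pow_of_ne _ fun e => hk (Fin.ext e.symm)
        · simp
      · rw [Finset.sum_eq_zero fun k _ => degreeOf_X_pow_of_ne _ (by omega)]
        exact Nat.zero_le _
    · obtain ⟨i, h, hi, -⟩ := exists_first_ascent hw
      rw [schubert_eq_divDiff w i h hi]
      exact (ih _ (hk ▸ weight_mulSimple_lt w i h hi) _ rfl).divDiff

/-- A polynomial annihilated by all divided differences is symmetric in infinitely many variables,
hence constant. -/
theorem eq_C_of_divDiff_eq_zero {N : ℕ} {f : MvPolynomial ℕ ℤ} (hf : InStaircase N f)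
    (h : ∀ i, divDiff i f = 0) : f = C (constantCoeff f) := by
  have h1 : ∀ i, degreeOf i f = degreeOf (i + 1) f := by
    intro i
    have h2 := degreeOf_rename_of_injective (p := f) (swap i (i + 1)).injective i
    rw [divDiff_eq_zero_iff.1 (h i), swap_apply_left] at h2
    exact h2.symm
  have h2 : ∀ i, degreeOf i f = degreeOf 0 f := by
    intro i
    induction i with
    | zero => rfl
    | succ i ih => rw [← h1, ih]
  have h3 : ∀ i, degreeOf i f = 0 := by
    intro i
    rw [h2, ← h2 N]
    have := hf N
    omega
  rw [constantCoeff_eq, ← totalDegree_eq_zero_iff_eq_C, totalDegree_eq_zero_iff]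
  intro m hm x
  exact Nat.le_zero.1 ((degreeOf_le_iff.1 (h3 x).le) m hm)

/-- By induction on the degree, the divided differences of `f` vanish. -/
theorem eq_zero_of_schubertCoeff_eq_zero {N : ℕ} {f : MvPolynomial ℕ ℤ} (hf : InStaircase N f)
    (h : ∀ w : Perm (Fin N), schubertCoeff w f = 0) : f = 0 := by
  induction hk : f.totalDegree using Nat.strong_induction_on generalizing f with
  | _ k ih =>
    have hz : ∀ i, divDiff i f = 0 := by
      intro i
      by_contra hne
      by_cases hi : i + 1 < N
      · refine hne (ih _ ?_ hf.divDiff ?_ rfl)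
        · have := totalDegree_divDiff_lt hne; omega
        · intro w
          rcases lt_or_gt_next w ⟨i, by omega⟩ hi with hw | hw
          · exact (schubertCoeff_mulSimple w ⟨i, by omega⟩ hi hw f).symm.trans (h _)
          · exact schubertCoeff_divDiff_of_descent w ⟨i, by omega⟩ hi hw f
      · exact hne (hf.divDiff_eq_zero (not_lt.1 hi))
    rw [eq_C_of_divDiff_eq_zero hf hz, ← schubertCoeff_one (n := N), h, map_zero]

theorem exists_inStaircase (n : ℕ) (f : MvPolynomial ℕ ℤ) : ∃ N, n ≤ N ∧ InStaircase N f := by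
  have hv : ∃ m, ∀ j, m ≤ j → degreeOf j f = 0 := by
    induction f using MvPolynomial.induction_on with
    | C a => exact ⟨0, fun j _ => degreeOf_C _ _⟩
    | add p q hp hq =>
      obtain ⟨a, ha⟩ := hp
      obtain ⟨b, hb⟩ := hq
      refine ⟨max a b, fun j hj => Nat.le_zero.1 ((degreeOf_add_le _ _ _).trans ?_)⟩
      rw [ha j (by omega), hb j (by omega), max_self]
    | mul_X p k hp =>
      obtain ⟨a, ha⟩ := hp
      refine ⟨max a (k + 1), fun j hj => ?_⟩
      rw [degreeOf_mul_X_of_ne _ (by omega), ha j (by omega)]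
  obtain ⟨m, hm⟩ := hv
  refine ⟨n + m + f.totalDegree, by omega, fun j => ?_⟩
  by_cases hj : m ≤ j
  · rw [hm j hj]; exact Nat.zero_le _
  · have := degreeOf_le_totalDegree f j
    omega

theorem eq_sum_schubert {N : ℕ} {f : MvPolynomial ℕ ℤ} (hf : InStaircase N f) :
    f = ∑ z : Perm (Fin N), schubertCoeff z f • schubert z := by
  rw [← sub_eq_zero]
  refine eq_zero_of_schubertCoeff_eq_zero (N := N) (fun j => ?_) fun w => ?_
  · refine (degreeOf_sub_le _ _ _).trans (max_le (hf j) ((degreeOf_sum_le _ _ _).trans ?_))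
    refine Finset.sup_le fun z _ => ?_
    rw [smul_eq_C_mul]
    exact (degreeOf_C_mul_le _ _ _).trans (inStaircase_schubert z j)
  · simp only [map_sub, map_sum, map_smul, schubertCoeff_schubert, smul_eq_mul, mul_ite, mul_one,
      mul_zero, Finset.sum_ite_eq', Finset.mem_univ, if_true, sub_self]

/-! ### Independence of the ambient symmetric group -/

theorem embed_castLE {N : ℕ} (h : n ≤ N) (w : Perm (Fin n)) (i : Fin n) :
    embed h w (Fin.castLE h i) = Fin.castLE h (w i) :=
  Perm.viaEmbedding_apply w (Fin.castLEEmb h) i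

theorem embed_mul {N : ℕ} (h : n ≤ N) (w z : Perm (Fin n)) :
    embed h (w * z) = embed h w * embed h z :=
  map_mul (Perm.viaEmbeddingHom (Fin.castLEEmb h)) w z

theorem embed_one {N : ℕ} (h : n ≤ N) : embed h (1 : Perm (Fin n)) = 1 :=
  map_one (Perm.viaEmbeddingHom (Fin.castLEEmb h))

theorem embed_swap {N : ℕ} (h : n ≤ N) (i j : Fin n) :
    embed h (swap i j) = swap (Fin.castLE h i) (Fin.castLE h j) := by
  ext x
  by_cases hx : ∃ y, Fin.castLE h y = x
  · obtain ⟨y, rfl⟩ := hx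
    rw [embed_castLE]
    by_cases h1 : y = i
    · subst h1; simp
    · by_cases h2 : y = j
      · subst h2; simp
      · rw [swap_apply_of_ne_of_ne h1 h2, swap_apply_of_ne_of_ne]
        · exact fun e => h1 (Fin.castLE_injective h e)
        · exact fun e => h2 (Fin.castLE_injective h e)
  · rw [swap_apply_of_ne_of_ne (fun e => hx ⟨i, e.symm⟩) (fun e => hx ⟨j, e.symm⟩)]
    exact congrArg Fin.val (Perm.viaEmbedding_apply_of_notMem _ (Fin.castLEEmb h) x
      (fun ⟨y, hy⟩ => hx ⟨y, hy⟩))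

theorem schubertCoeff_embed {N : ℕ} (h : n ≤ N) (w : Perm (Fin n)) (f : MvPolynomial ℕ ℤ) :
    schubertCoeff (embed h w) f = schubertCoeff w f := by
  induction w using perm_induction generalizing f with
  | one => rw [embed_one, schubertCoeff_one, schubertCoeff_one]
  | step w i hi hw ih =>
    have hlt : embed h w (Fin.castLE h i)
        < embed h w ⟨(Fin.castLE h i).val + 1, lt_of_lt_of_le hi h⟩ := by
      have e : (⟨(Fin.castLE h i).val + 1, lt_of_lt_of_le hi h⟩ : Fin N)
        = Fin.castLE h ⟨i.val + 1, hi⟩ := rfl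
      rw [e, embed_castLE, embed_castLE]
      exact hw
    have := schubertCoeff_mulSimple (embed h w) (Fin.castLE h i) (lt_of_lt_of_le hi h) hlt f
    rw [schubertCoeff_mulSimple w i hi hw, ← ih]
    refine Eq.trans ?_ this
    congr 2
    rw [mulSimple, embed_mul, embed_swap]
    rfl

theorem isSchubertCoeff_iff (u v w : Perm (Fin n)) (k : ℤ) :
    IsSchubertCoeff u v w k ↔ k = structureCoeff u v w := by
  constructor
  · rintro ⟨N, hN, c, hc, rfl⟩
    rw [structureCoeff, ← schubertCoeff_embed hN, hc]
    simp only [map_sum, map_smul, schubertCoeff_schubert, smul_eq_mul, mul_ite, mul_one,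
      mul_zero, Finset.sum_ite_eq', Finset.mem_univ, if_true]
  · rintro rfl
    obtain ⟨N, hN, hst⟩ := exists_inStaircase n (schubert u * schubert v)
    exact ⟨N, hN, fun z => schubertCoeff z (schubert u * schubert v), eq_sum_schubert hst,
      schubertCoeff_embed hN w _⟩

end Polynomials

/-! ### The number of puzzle pieces -/

/-- Substitution of letters in the labels of a side. -/
def Side.relabel {m n : ℕ} (f : Fin m → Fin n) : Side m → Side n :=
  Prod.map id (Prod.map (Option.map (Prod.map f (Prod.map f f)))
    (Prod.map (Option.map (Prod.map (Option.map f) (Prod.map (Option.map f) (Option.map f))))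
      (Option.map (Prod.map (Option.map f) (Option.map f)))))

/-- Substitution of letters in the labels of a piece. -/
def Piece.relabel {m n : ℕ} (f : Fin m → Fin n) : Piece m → Piece n :=
  Prod.map id (Prod.map (Side.relabel f) (Prod.map (Side.relabel f) (Prod.map f (Prod.map f f))))

/-- A puzzle piece involves at most nine letters. -/
theorem exists_relabel_eq {t : Piece n} (ht : IsWhite t ∨ IsShaded t ∨ IsDark t) :
    ∃ (t₀ : Piece 9) (f : Fin 9 → Fin n), Piece.relabel f t₀ = t := by
  rcases ht with ht | ht | ht
  · cases ht with
    | perm s x =>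
      obtain ⟨a, b, c⟩ := x
      exact ⟨(.white, plain s (some (0, 1, 2)), plain s (some (0, 1, 2)), 0, 1, 2),
        ![a, b, c, a, a, a, a, a, a], rfl⟩
    | boundary x =>
      obtain ⟨a, b, c⟩ := x
      exact ⟨(.white, plain .circ none, plain .circ (some (0, 1, 2)), 0, 1, 2),
        ![a, b, c, a, a, a, a, a, a], rfl⟩
    | transmuter s x g h =>
      obtain ⟨a, b, c⟩ := x
      exact ⟨(.white, withTr s (some (0, 1, 2)) 3 4, withTr s (some (0, 1, 2)) 3 4, 0, 1, 2),
        ![a, b, c, g, h, a, a, a, a], rfl⟩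
    | feedback x d e f =>
      obtain ⟨a, b, c⟩ := x
      exact ⟨(.white, withFb .star (some (0, 1, 2)) (d.map fun _ => 3) (e.map fun _ => 4)
          (f.map fun _ => 5), withFb .star (some (0, 1, 2)) (d.map fun _ => 3) (e.map fun _ => 4)
          (f.map fun _ => 5), 0, 1, 2),
        ![a, b, c, d.getD a, e.getD a, f.getD a, a, a, a], by
          cases d <;> cases e <;> cases f <;> rfl⟩
    | both x e g h =>
      obtain ⟨a, b, c⟩ := x
      exact ⟨(.white, withFbTr .star (some (0, 1, 2)) 3 4 5, withFbTr .star (some (0, 1, 2)) 3 4 5,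
        0, 1, 2), ![a, b, c, e, g, h, a, a, a], rfl⟩
    | blank x e =>
      obtain ⟨a, b, c⟩ := x
      exact ⟨(.white, withFbBlank .star (some (0, 1, 2)) 3, withFbBlank .star (some (0, 1, 2)) 3,
        0, 1, 2), ![a, b, c, e, a, a, a, a, a], rfl⟩
  · -- An optional label `y` is encoded by the letters `6, 7, 8`.
    have key : ∀ (s : Indicator) (a b c d e g : Fin n) (y : Option (Triple n))
        (l : Side 9) (h : Triple 9), ∃ (t₀ : Piece 9) (f : Fin 9 → Fin n),
        Piece.relabel f t₀ = (.shaded, Side.relabel f l, plain s y, f h.1, f h.2.1, f h.2.2) ∧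
          f 0 = a ∧ f 1 = b ∧ f 2 = c ∧ f 3 = d ∧ f 4 = e ∧ f 5 = g := by
      intro s a b c d e g y l h
      exact ⟨(.shaded, l, plain s (y.map fun _ => (6, 7, 8)), h),
        ![a, b, c, d, e, g, (y.getD (a, b, c)).1, (y.getD (a, b, c)).2.1,
          (y.getD (a, b, c)).2.2], by cases y <;> rfl, rfl, rfl, rfl, rfl, rfl, rfl⟩
    cases ht with
    | perm s a b c y =>
      obtain ⟨t₀, f, e, rfl, rfl, rfl, -⟩ :=
        key s a b c a a a y (plain s (some (0, 1, 2))) (0, 1, 2)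
      exact ⟨t₀, f, e⟩
    | pass s a b c g h y =>
      obtain ⟨p, q, r⟩ := y
      exact ⟨(.shaded, withTr s (some (0, 1, 2)) 3 4, withTr s (some (6, 7, 8)) 3 4, 0, 1, 2),
        ![a, b, c, g, h, a, p, q, r], rfl⟩
    | emit s a b c h y =>
      obtain ⟨p, q, r⟩ := y
      exact ⟨(.shaded, plain s (some (0, 1, 2)), withTr s (some (6, 7, 8)) 0 3, 3, 1, 2),
        ![a, b, c, h, a, a, p, q, r], rfl⟩
    | absorb s a b c g y =>
      obtain ⟨t₀, f, e, rfl, rfl, rfl, rfl, -⟩ :=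
        key s a b c g a a y (withTr s (some (0, 1, 2)) 3 0) (3, 1, 2)
      exact ⟨t₀, f, e⟩
    | fbUW s a b c d f y =>
      obtain ⟨t₀, f, e, rfl, rfl, rfl, rfl, rfl, -⟩ :=
        key s a b c d f a y (withFb s (some (0, 1, 2)) (some 3) none (some 4)) (3, 1, 4)
      exact ⟨t₀, f, e⟩
    | fbUV s a b c d e y =>
      obtain ⟨t₀, f, e, rfl, rfl, rfl, rfl, rfl, -⟩ :=
        key s a b c d e a y (withFb s (some (0, 1, 2)) (some 3) (some 4) none) (3, 4, 2)
      exact ⟨t₀, f, e⟩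
    | fbV s a b c e y =>
      obtain ⟨t₀, f, e, rfl, rfl, rfl, rfl, -⟩ :=
        key s a b c e a a y (withFb s (some (0, 1, 2)) none (some 3) none) (0, 3, 2)
      exact ⟨t₀, f, e⟩
    | fbVPass s a b c e g h y =>
      obtain ⟨p, q, r⟩ := y
      exact ⟨(.shaded, withFbTr s (some (0, 1, 2)) 3 4 5, withTr s (some (6, 7, 8)) 4 5, 0, 3, 2),
        ![a, b, c, e, g, h, p, q, r], rfl⟩
    | fbVAbsorb s a b c e g y =>
      obtain ⟨t₀, f, e, rfl, rfl, rfl, rfl, rfl, -⟩ :=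
        key s a b c e g a y (withFbTr s (some (0, 1, 2)) 3 4 0) (4, 3, 2)
      exact ⟨t₀, f, e⟩
    | fbVEmit s a b c e h y =>
      obtain ⟨p, q, r⟩ := y
      exact ⟨(.shaded, withFbBlank s (some (0, 1, 2)) 3, withTr s (some (6, 7, 8)) 0 4, 4, 3, 2),
        ![a, b, c, e, h, a, p, q, r], rfl⟩
  · cases ht with
    | yellow1 a b c p q r =>
      exact ⟨(.yellow1, plain .circ (some (0, 1, 2)),
        withFb .star (some (6, 7, 8)) (some 0) none (some 2), 6, 1, 8),
        ![a, b, c, a, a, a, p, q, r], rfl⟩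
    | yellow2 a b c p q r =>
      exact ⟨(.yellow2, plain .circ (some (0, 1, 2)),
        withFb .star (some (6, 7, 8)) (some 0) (some 1) none, 6, 7, 2),
        ![a, b, c, a, a, a, p, q, r], rfl⟩
    | yellow3 a b c p q r =>
      exact ⟨(.yellow3, plain .circ (some (0, 1, 2)),
        withFb .star (some (6, 7, 8)) (some 0) none (some 2), 6, 1, 8),
        ![a, b, c, a, a, a, p, q, r], rfl⟩
    | yellow4 a b c p q r =>
      exact ⟨(.yellow4, plain .circ (some (0, 1, 2)),
        withFb .star (some (6, 7, 8)) (some 0) (some 1) none, 6, 7, 2),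
        ![a, b, c, a, a, a, p, q, r], rfl⟩
    | blue1 a b c p q r h =>
      exact ⟨(.blue1, plain .circ (some (0, 1, 2)), withFbTr .star (some (6, 7, 8)) 1 0 3,
        3, 7, 2), ![a, b, c, h, a, a, p, q, r], rfl⟩
    | blue2 a b c p q r g =>
      exact ⟨(.blue2, withTr .circ (some (0, 1, 2)) 3 6, withFbTr .star (some (6, 7, 8)) 1 3 6,
        0, 7, 2), ![a, b, c, g, a, a, p, q, r], rfl⟩
    | red1 a b c p q r g =>
      exact ⟨(.red1, withTr .circ (some (0, 1, 2)) 3 0,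
        withFb .star (some (6, 7, 8)) none (some 1) none, 3, 7, 2),
        ![a, b, c, g, a, a, p, q, r], rfl⟩
    | red2 a b c p q r =>
      exact ⟨(.red2, plain .circ (some (0, 1, 2)), withFbBlank .star (some (6, 7, 8)) 1, 0, 7, 2),
        ![a, b, c, a, a, a, p, q, r], rfl⟩

theorem card_le_card_mul_pow {A B : Type*} [Fintype A] (k n : ℕ) (s : Finset B)
    (F : A → (Fin k → Fin n) → B) (h : ∀ b ∈ s, ∃ a f, F a f = b) :
    s.card ≤ Fintype.card A * n ^ k := by
  classical
  calc s.card ≤ ((Finset.univ : Finset (A × (Fin k → Fin n))).image fun q => F q.1 q.2).card := by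
        refine Finset.card_le_card fun t ht => ?_
        obtain ⟨a, f, h⟩ := h t ht
        exact Finset.mem_image.2 ⟨(a, f), Finset.mem_univ _, h⟩
    _ ≤ Fintype.card (A × (Fin k → Fin n)) := Finset.card_image_le
    _ = Fintype.card A * n ^ k := by
        rw [Fintype.card_prod, Fintype.card_fun, Fintype.card_fin, Fintype.card_fin]

theorem mem_pieces {t : Piece n} : t ∈ pieces n ↔ IsWhite t ∨ IsShaded t ∨ IsDark t := by
  simp [pieces]

theorem card_pieces_le (n : ℕ) : (pieces n).card ≤ Fintype.card (Piece 9) * n ^ 9 :=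
  card_le_card_mul_pow 9 n (pieces n) (fun t f => Piece.relabel f t) fun _ ht =>
    exists_relabel_eq (mem_pieces.1 ht)

/-! ### Determinism of pieces -/

/-- A shaded or dark piece is determined by its left side, its bottom labels and the permutation
labels on its right side. -/
theorem piece_ext {t t' : Piece n} (ht : IsShaded t ∨ IsDark t) (ht' : IsShaded t' ∨ IsDark t')
    (hl : t.left = t'.left) (hh : t.horiz = t'.horiz) (hr : t.right.2.1 = t'.right.2.1) :
    t = t' := by
  rcases ht with ht | ht <;> rcases ht' with ht' | ht' <;> cases ht <;> cases ht' <;>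
    simp only [Piece.left, Piece.horiz, Piece.right, plain, withTr, withFb, withFbTr, withFbBlank,
      Prod.mk.injEq, Option.some.injEq, reduceCtorEq, and_false, false_and, and_true, true_and]
      at hl hh hr <;>
    simp_all only [ShadedOK, reduceCtorEq, lt_irrefl, ne_eq, not_true_eq_false, and_false,
      imp_false] <;>
    order

section Rows

variable {l : ℕ}

/-! ### Rows of a puzzle -/

/-- A candidate for a row of a puzzle: its white and its shaded positions, from left to right. -/
abbrev Row (n : ℕ) := (Fin n → Piece n) × (Fin n → Piece n)

/-- `R` is a valid row of a puzzle with top labels `x`. -/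
structure IsRow (x : Fin n → Triple n) (R : Row n) : Prop where
  white : ∀ i, IsWhite (R.1 i)
  shaded : ∀ i, IsShaded (R.2 i) ∨ IsDark (R.2 i)
  column : ∀ i, (R.1 i).right = (R.2 i).left
  next : ∀ (i : Fin n) (h : i.val + 1 < n), (R.2 i).right = (R.1 ⟨i.val + 1, h⟩).left
  top : ∀ i, (R.1 i).horiz = x i
  left : ∀ i : Fin n, i.val = 0 → (R.1 i).left = plain .circ none
  right : ∀ i : Fin n, i.val + 1 = n → (R.2 i).right = plain .star none

noncomputable instance : Fintype (Row n) :=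
  @instFintypeProd (Fin n → Piece n) (Fin n → Piece n) inferInstance inferInstance

/-- The bottom labels of a row. -/
def Row.bottom (R : Row n) (i : Fin n) : Triple n := (R.2 i).horiz

open Classical in
/-- The sign contributed by a piece. -/
noncomputable def pieceSign (t : Piece n) : ℤ := if t.IsRed then -1 else 1

/-- The sign contributed by a row. -/
noncomputable def rowSign (R : Row n) : ℤ := ∏ i, pieceSign (R.2 i)

theorem IsWhite.kind_eq {t : Piece n} (h : IsWhite t) : t.kind = .white := by
  cases h <;> rfl

theorem kind_ne_white {t : Piece n} (h : IsShaded t ∨ IsDark t) : t.kind ≠ .white := by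
  rcases h with h | h <;> cases h <;> simp [Piece.kind]

theorem pieceSign_of_kind_eq_white {t : Piece n} (h : t.kind = .white) : pieceSign t = 1 := by
  rw [pieceSign, if_neg]
  rintro (h' | h') <;> rw [h] at h' <;> cases h'

theorem isWhite_iff {t : Piece n} : t ∈ pieces n ∧ t.kind = .white ↔ IsWhite t := by
  rw [mem_pieces]
  constructor
  · rintro ⟨h | h, hk⟩
    · exact h
    · exact absurd hk (kind_ne_white h)
  · exact fun h => ⟨Or.inl h, h.kind_eq⟩

theorem isShaded_or_isDark_iff {t : Piece n} :
    t ∈ pieces n ∧ t.kind ≠ .white ↔ IsShaded t ∨ IsDark t := by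
  rw [mem_pieces]
  constructor
  · rintro ⟨h | h, hk⟩
    · exact absurd h.kind_eq hk
    · exact h
  · exact fun h => ⟨Or.inr h, kind_ne_white h⟩

/-- The bottom labels of the region. -/
def bottomLabels (n : ℕ) (i : Fin n) : Triple n := (i.rev, i, i.rev)

/-- The region with `l` rows, top labels `x`, and the remaining boundary as in `gamma`. -/
def regionWithTop (l : ℕ) (x : Fin n → Triple n) : Region n l where
  top := x
  bottom := bottomLabels n
  left _ := plain .circ none
  right _ := plain .star none

/-- Puzzles with `l` rows and top labels `x`, where a puzzle without rows is required to have equal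
top and bottom labels. -/
def IsTiling (l : ℕ) (x : Fin n → Triple n) (T : Position n l → Piece n) : Prop :=
  IsPuzzle (pieces n) (regionWithTop l x) T ∧ (l = 0 → x = bottomLabels n)

/-- Stacking a row on top of a filling of `l` rows. -/
def stack (R : Row n) (T : Position n l → Piece n) : Position n (l + 1) → Piece n
  | .white r i => Fin.cases (R.1 i) (fun r => T (.white r i)) r
  | .shaded r i => Fin.cases (R.2 i) (fun r => T (.shaded r i)) r

/-- A filling of `l + 1` rows is a top row and a filling of `l` rows. -/
def stackEquiv (n l : ℕ) :
    Row n × (Position n l → Piece n) ≃ (Position n (l + 1) → Piece n) where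
  toFun q := stack q.1 q.2
  invFun T := ((fun i => T (.white 0 i), fun i => T (.shaded 0 i)),
    fun p => match p with
      | .white r i => T (.white r.succ i)
      | .shaded r i => T (.shaded r.succ i))
  left_inv := by
    rintro ⟨⟨W, S⟩, T⟩
    refine Prod.ext rfl ?_
    funext p
    cases p <;> rfl
  right_inv := by
    intro T
    funext p
    cases p with
    | white r i => cases r using Fin.cases <;> rfl
    | shaded r i => cases r using Fin.cases <;> rfl

theorem isTiling_stack_iff (x : Fin n → Triple n) (R : Row n) (T : Position n l → Piece n) :
    IsTiling (l + 1) x (stack R T) ↔ IsRow x R ∧ IsTiling l R.bottom T := by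
  constructor
  · rintro ⟨h, -⟩
    refine ⟨⟨fun i => isWhite_iff.1 ⟨h.mem (.white 0 i), h.white_kind 0 i⟩,
      fun i => isShaded_or_isDark_iff.1 ⟨h.mem (.shaded 0 i), h.shaded_kind 0 i⟩,
      fun i => h.match_column 0 i, fun i hi => h.match_next 0 i hi, fun i => h.top 0 i rfl,
      fun i hi => h.left 0 i hi, fun i hi => h.right 0 i hi⟩,
      ⟨?_, ?_, ?_, ?_, ?_, ?_, ?_, ?_, ?_, ?_⟩, ?_⟩
    · rintro (⟨r, i⟩ | ⟨r, i⟩)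
      · exact h.mem (.white r.succ i)
      · exact h.mem (.shaded r.succ i)
    · exact fun r i => h.white_kind r.succ i
    · exact fun r i => h.shaded_kind r.succ i
    · exact fun r i => h.match_column r.succ i
    · exact fun r i hi => h.match_next r.succ i hi
    · exact fun r i hi => h.match_down r.succ i (Nat.succ_lt_succ hi)
    · rintro ⟨r, hr⟩ i h0
      obtain rfl : r = 0 := h0
      exact (h.match_down 0 i (Nat.succ_lt_succ hr)).symm
    · exact fun r i hr => h.bottom r.succ i (congrArg Nat.succ hr)
    · exact fun r i hi => h.left r.succ i hi
    · exact fun r i hi => h.right r.succ i hi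
    · rintro rfl
      funext i
      exact h.bottom 0 i rfl
  · rintro ⟨hR, h, h0⟩
    refine ⟨⟨?_, ?_, ?_, ?_, ?_, ?_, ?_, ?_, ?_, ?_⟩, fun e => absurd e (Nat.succ_ne_zero l)⟩
    · rintro (⟨r, i⟩ | ⟨r, i⟩)
      · cases r using Fin.cases with
        | zero => exact (isWhite_iff.2 (hR.white i)).1
        | succ r => exact h.mem (.white r i)
      · cases r using Fin.cases with
        | zero => exact (isShaded_or_isDark_iff.2 (hR.shaded i)).1
        | succ r => exact h.mem (.shaded r i)
    · intro r i
      cases r using Fin.cases with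
      | zero => exact (hR.white i).kind_eq
      | succ r => exact h.white_kind r i
    · intro r i
      cases r using Fin.cases with
      | zero => exact kind_ne_white (hR.shaded i)
      | succ r => exact h.shaded_kind r i
    · intro r i
      cases r using Fin.cases with
      | zero => exact hR.column i
      | succ r => exact h.match_column r i
    · intro r i hi
      cases r using Fin.cases with
      | zero => exact hR.next i hi
      | succ r => exact h.match_next r i hi
    · intro r i hr
      cases r using Fin.cases with
      | zero => exact (h.top ⟨0, Nat.lt_of_succ_lt_succ hr⟩ i rfl).symm
      | succ r => exact h.match_down r i (Nat.lt_of_succ_lt_succ hr)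
    · intro r i hr
      cases r using Fin.cases with
      | zero => exact hR.top i
      | succ r => exact absurd hr (Nat.succ_ne_zero _)
    · intro r i hr
      cases r using Fin.cases with
      | zero =>
        have hl : l = 0 := (Nat.succ.inj hr).symm
        exact congrFun (h0 hl) i
      | succ r => exact h.bottom r i (Nat.succ.inj hr)
    · intro r i hi
      cases r using Fin.cases with
      | zero => exact hR.left i hi
      | succ r => exact h.left r i hi
    · intro r i hi
      cases r using Fin.cases with
      | zero => exact hR.right i hi
      | succ r => exact h.right r i hi

/-- The positions of a region as two copies of a rectangle. -/
def positionEquiv (n l : ℕ) : (Fin l × Fin n) ⊕ (Fin l × Fin n) ≃ Position n l where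
  toFun := Sum.elim (fun q => .white q.1 q.2) (fun q => .shaded q.1 q.2)
  invFun
    | .white r i => Sum.inl (r, i)
    | .shaded r i => Sum.inr (r, i)
  left_inv := by rintro (q | q) <;> rfl
  right_inv := by rintro (⟨r, i⟩ | ⟨r, i⟩) <;> rfl

theorem sign_eq_prod (T : Position n l → Piece n) :
    sign T = (∏ r, ∏ i, pieceSign (T (.white r i))) * ∏ r, ∏ i, pieceSign (T (.shaded r i)) := by
  classical
  have h1 : sign T = ∏ p, pieceSign (T p) := by
    simp only [sign, pieceSign, Finset.prod_ite, Finset.prod_const, one_pow, mul_one]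
  rw [h1, ← (positionEquiv n l).prod_comp, Fintype.prod_sum_type, Fintype.prod_prod_type,
    Fintype.prod_prod_type]
  rfl

theorem sign_stack {x : Fin n → Triple n} {R : Row n} (hR : IsRow x R)
    (T : Position n l → Piece n) : sign (stack R T) = rowSign R * sign T := by
  have h : ∏ i, pieceSign (R.1 i) = 1 :=
    Finset.prod_eq_one fun i _ => pieceSign_of_kind_eq_white (hR.white i).kind_eq
  rw [sign_eq_prod, sign_eq_prod, Fin.prod_univ_succ, Fin.prod_univ_succ]
  simp only [stack, Fin.cases_zero, Fin.cases_succ]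
  rw [h, rowSign]
  ring

open Classical in
/-- The signed number of puzzles with `l` rows and top labels `x`. -/
noncomputable def tilingCount (l : ℕ) (x : Fin n → Triple n) : ℤ :=
  ∑ T : Position n l → Piece n, if IsTiling l x T then sign T else 0

open Classical in
/-- The signed number of rows with given top and bottom labels. -/
noncomputable def rowWeight (x y : Fin n → Triple n) : ℤ :=
  ∑ R : Row n, if IsRow x R ∧ R.bottom = y then rowSign R else 0

theorem tilingCount_succ (l : ℕ) (x : Fin n → Triple n) :
    tilingCount (l + 1) x = ∑ y, rowWeight x y * tilingCount l y := by
  classical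
  simp only [tilingCount, rowWeight, Finset.sum_mul]
  rw [Finset.sum_comm, ← (stackEquiv n l).sum_comp, Fintype.sum_prod_type]
  refine Finset.sum_congr rfl fun R _ => ?_
  by_cases hR : IsRow x R
  · rw [Finset.sum_eq_single R.bottom]
    · rw [if_pos ⟨hR, rfl⟩, Finset.mul_sum]
      refine Finset.sum_congr rfl fun T _ => ?_
      change (if IsTiling (l + 1) x (stack R T) then sign (stack R T) else 0) = _
      by_cases hT : IsTiling l R.bottom T
      · rw [if_pos hT, if_pos ((isTiling_stack_iff x R T).2 ⟨hR, hT⟩), sign_stack hR]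
      · rw [if_neg hT, if_neg fun h => hT ((isTiling_stack_iff x R T).1 h).2, mul_zero]
    · intro y _ hy
      rw [if_neg fun h => hy h.2.symm, zero_mul]
    · simp
  · rw [Finset.sum_eq_zero, Finset.sum_eq_zero]
    · intro y _
      rw [if_neg fun h => hR h.1, zero_mul]
    · intro T _
      exact if_neg fun h => hR ((isTiling_stack_iff x R T).1 h).1

theorem tilingCount_zero (x : Fin n → Triple n) :
    tilingCount 0 x = if x = bottomLabels n then 1 else 0 := by
  classical
  have hemp : IsEmpty (Position n 0) := ⟨fun p => by
    rcases p with ⟨r, -⟩ | ⟨r, -⟩ <;> exact r.elim0⟩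
  rw [tilingCount, Fintype.sum_unique]
  refine if_congr ⟨fun h => h.2 rfl, fun h => ⟨?_, fun _ => h⟩⟩ ?_ rfl
  · refine ⟨fun p => isEmptyElim p, ?_, ?_, ?_, ?_, ?_, ?_, ?_, ?_, ?_⟩ <;>
      exact fun r => r.elim0
  · simp [sign_eq_prod]

theorem signedCount_gamma (u v w : Perm (Fin n))
    (h : n.choose 2 - inv u = 0 → (fun i => (u i, v i, w i)) = bottomLabels n) :
    signedCount (pieces n) (gamma u v w)
      = tilingCount (n.choose 2 - inv u) fun i => (u i, v i, w i) := by
  classical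
  rw [signedCount, tilingCount, Finset.sum_filter]
  refine Finset.sum_congr rfl fun T _ => ?_
  exact if_congr ⟨fun hT => ⟨hT, h⟩, fun hT => hT.1⟩ rfl rfl

/-! ### Rows as runs of an automaton -/

/-- The content of a left or right side apart from the permutation labels: indicator, feedback
labels and transmuter labels. -/
abbrev State (n : ℕ) := Indicator × Option (Option (Fin n) × Option (Fin n) × Option (Fin n)) ×
    Option (Option (Fin n) × Option (Fin n))

/-- The side with a given state and given permutation labels. -/
def State.side (σ : State n) (z : Option (Triple n)) : Side n := (σ.1, z, σ.2)

/-- The state of a side. -/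
def Side.state (s : Side n) : State n := (s.1, s.2.2)

/-- The permutation labels on the right side of column `i`; there are none on the right boundary. -/
def nextLabel (x : Fin n → Triple n) (i : Fin n) : Option (Triple n) :=
  if h : i.val + 1 < n then some (x ⟨i.val + 1, h⟩) else none

/-- `Run x y m σ s`: the columns from `m` on can be filled with shaded and dark pieces such that the
top labels are `x`, the bottom labels are `y`, the state on the left is `σ`, and the product of the
signs is `s`. -/
inductive Run (x y : Fin n → Triple n) : ℕ → State n → ℤ → Prop
  | done (m : ℕ) (hm : m = n) : Run x y m (.star, none, none) 1
  | step (m : ℕ) (hm : m < n) (σ σ' : State n) (s : ℤ) (t : Piece n)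
      (ht : IsShaded t ∨ IsDark t) (hl : t.left = σ.side (some (x ⟨m, hm⟩)))
      (hr : t.right = σ'.side (nextLabel x ⟨m, hm⟩)) (hh : t.horiz = y ⟨m, hm⟩)
      (hrun : Run x y (m + 1) σ' s) : Run x y m σ (pieceSign t * s)

theorem IsWhite.right_label {t : Piece n} (h : IsWhite t) : t.right.2.1 = some t.horiz := by
  cases h <;> rfl

theorem IsWhite.left_eq {t : Piece n} (h : IsWhite t) :
    t.left = t.right ∨ (t.left = plain .circ none ∧ t.right = plain .circ (some t.horiz)) := by
  cases h <;> first | exact Or.inl rfl | exact Or.inr ⟨rfl, rfl⟩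

theorem right_ne_boundary {t : Piece n} (h : IsShaded t ∨ IsDark t) :
    t.right ≠ plain .circ none := by
  rcases h with h | h <;> cases h <;>
    simp [Piece.right, plain, withTr, withFb, withFbTr, withFbBlank]
  all_goals
    rintro rfl rfl
    simp_all [ShadedOK]

theorem isWhite_of_right {t : Piece n} (h : IsShaded t ∨ IsDark t) {z : Triple n}
    (hz : t.right.2.1 = some z) : IsWhite (.white, t.right, t.right, z) := by
  rcases h with h | h <;> cases h <;>
    simp only [Piece.right, plain, withTr, withFb, withFbTr, withFbBlank, Option.some.injEq]
      at hz <;> subst hz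
  case inl.perm | inl.absorb | inl.fbUW | inl.fbUV | inl.fbV | inl.fbVAbsorb =>
    exact IsWhite.perm _ _
  case inl.pass h => exact IsWhite.transmuter _ _ _ _ h
  case inl.emit h => exact IsWhite.transmuter _ _ _ _ h
  case inl.fbVPass h => exact IsWhite.transmuter _ _ _ _ h
  case inl.fbVEmit h => exact IsWhite.transmuter _ _ _ _ h
  case inr.blue1 h _ => exact IsWhite.both _ _ _ _ h
  case inr.blue2 h => exact IsWhite.both _ _ _ _ h
  case inr.red2 => exact IsWhite.blank _ _
  case inr.yellow1 | inr.yellow3 => exact IsWhite.feedback _ _ _ _ (Or.inr (Or.inl rfl))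
  case inr.yellow2 | inr.yellow4 => exact IsWhite.feedback _ _ _ _ (Or.inr (Or.inr rfl))
  case inr.red1 => exact IsWhite.feedback _ _ _ _ (Or.inl rfl)

theorem IsRow.left_label {x : Fin n → Triple n} {R : Row n} (h : IsRow x R) (i : Fin n) :
    (R.2 i).left.2.1 = some (x i) := by
  rw [← h.column, (h.white i).right_label, h.top]

theorem IsRow.left_zero {x : Fin n → Triple n} {R : Row n} (h : IsRow x R) (i : Fin n)
    (hi : i.val = 0) : (R.2 i).left = plain .circ (some (x i)) := by
  have h1 := h.left_label i
  rw [← h.column] at h1 ⊢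
  rcases (h.white i).left_eq with h2 | ⟨-, h2⟩
  · rw [← h2, h.left i hi] at h1
    cases h1
  · rw [h2, h.top]

theorem IsRow.left_eq {x : Fin n → Triple n} {R : Row n} (h : IsRow x R) (i : Fin n)
    (hi : i.val + 1 < n) : (R.2 i).right = (R.2 ⟨i.val + 1, hi⟩).left := by
  rw [h.next i hi, ← h.column]
  refine (h.white _).left_eq.resolve_right fun h2 => ?_
  rw [← h.next i hi] at h2
  exact right_ne_boundary (h.shaded i) h2.1

theorem IsRow.right_label {x : Fin n → Triple n} {R : Row n} (h : IsRow x R) (i : Fin n) :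
    (R.2 i).right.2.1 = nextLabel x i := by
  rw [nextLabel]
  split_ifs with hi
  · rw [h.left_eq i hi, h.left_label]
  · rw [h.right i (by omega)]
    rfl

/-- A row is determined by its top and bottom labels. -/
theorem IsRow.eq_of_bottom_eq {x : Fin n → Triple n} {R R' : Row n} (h : IsRow x R)
    (h' : IsRow x R') (hb : R.bottom = R'.bottom) : R = R' := by
  have hl : ∀ (m : ℕ) (hm : m < n), (R.2 ⟨m, hm⟩).left = (R'.2 ⟨m, hm⟩).left →
      R.2 ⟨m, hm⟩ = R'.2 ⟨m, hm⟩ := fun m hm e =>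
    piece_ext (h.shaded _) (h'.shaded _) e (congrFun hb _) (by rw [h.right_label, h'.right_label])
  have hS : ∀ (m : ℕ) (hm : m < n), R.2 ⟨m, hm⟩ = R'.2 ⟨m, hm⟩ := by
    intro m
    induction m with
    | zero => exact fun hm => hl 0 hm (by rw [h.left_zero _ rfl, h'.left_zero _ rfl])
    | succ m ih =>
      exact fun hm => hl _ hm (by
        rw [← h.left_eq ⟨m, by omega⟩ hm, ← h'.left_eq ⟨m, by omega⟩ hm, ih])
  have hS' : R.2 = R'.2 := funext fun i => hS i.val i.isLt
  refine Prod.ext (funext fun i => ?_) hS'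
  have hk := (h.white i).kind_eq.trans (h'.white i).kind_eq.symm
  have hr : (R.1 i).right = (R'.1 i).right := by rw [h.column, h'.column, hS']
  have ht : (R.1 i).horiz = (R'.1 i).horiz := by rw [h.top, h'.top]
  have hl : (R.1 i).left = (R'.1 i).left := by
    by_cases h0 : i.val = 0
    · rw [h.left i h0, h'.left i h0]
    · obtain ⟨m, hm⟩ := i
      obtain ⟨m, rfl⟩ : ∃ k, m = k + 1 := ⟨m - 1, by simp only at h0; omega⟩
      rw [← h.next ⟨m, by omega⟩ hm, ← h'.next ⟨m, by omega⟩ hm, hS']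
  exact Prod.ext hk (Prod.ext hl (Prod.ext hr ht))

theorem filter_le_eq_insert (m : ℕ) (hm : m < n) :
    (Finset.univ.filter fun i : Fin n => m ≤ i.val)
      = insert ⟨m, hm⟩ (Finset.univ.filter fun i : Fin n => m + 1 ≤ i.val) := by
  ext i
  simp only [Finset.mem_filter, Finset.mem_univ, true_and, Finset.mem_insert, Fin.ext_iff]
  omega

theorem IsRow.run {x : Fin n → Triple n} {R : Row n} (h : IsRow x R) (hn : 0 < n) :
    Run x R.bottom 0 (.circ, none, none) (rowSign R) := by
  have key : ∀ (d m : ℕ), m + d = n → Run x R.bottom m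
      (if hm : m < n then (R.2 ⟨m, hm⟩).left.state else (.star, none, none))
      (∏ i ∈ Finset.univ.filter (fun i : Fin n => m ≤ i.val), pieceSign (R.2 i)) := by
    intro d
    induction d with
    | zero =>
      intro m hm
      rw [dif_neg (by omega), Finset.filter_false_of_mem fun i _ => by omega]
      exact Run.done m hm
    | succ d ih =>
      intro m hm
      have hmn : m < n := by omega
      rw [dif_pos hmn, filter_le_eq_insert m hmn, Finset.prod_insert (by simp)]
      refine Run.step m hmn _ _ _ (R.2 ⟨m, hmn⟩) (h.shaded _) ?_ ?_ rfl (ih (m + 1) (by omega))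
      · exact Prod.ext rfl (Prod.ext (h.left_label _) rfl)
      · split_ifs with hm1
        · refine Prod.ext ?_ (Prod.ext (h.right_label _) ?_) <;>
            rw [h.left_eq ⟨m, hmn⟩ hm1] <;> rfl
        · rw [h.right ⟨m, hmn⟩ (by simp only; omega), nextLabel, dif_neg hm1]
          rfl
  have h0 := key n 0 (by omega)
  rw [dif_pos hn, h.left_zero _ rfl] at h0
  simpa [rowSign, plain, Side.state] using h0

theorem Run.exists_pieces {x y : Fin n → Triple n} {m : ℕ} {σ : State n} {s : ℤ}
    (h : Run x y m σ s) : ∃ S : Fin n → Piece n,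
      (∀ i : Fin n, m ≤ i.val → (IsShaded (S i) ∨ IsDark (S i)) ∧ (S i).horiz = y i ∧
        (S i).left.2.1 = some (x i) ∧ ((i.val + 1 = n → (S i).right = plain .star none) ∧
        ∀ hi : i.val + 1 < n, (S i).right = (S ⟨i.val + 1, hi⟩).left)) ∧
      (∀ hm : m < n, (S ⟨m, hm⟩).left = σ.side (some (x ⟨m, hm⟩))) ∧
      (m = n → σ = (.star, none, none)) ∧
      ∏ i ∈ Finset.univ.filter (fun i : Fin n => m ≤ i.val), pieceSign (S i) = s := by
  classical
  induction h with
  | done m hm =>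
    refine ⟨fun i => (.white, plain .circ none, plain .circ none, x i), fun i hi => ?_,
      fun h => ?_, fun _ => rfl, ?_⟩
    · omega
    · omega
    · rw [Finset.filter_false_of_mem fun i _ => by omega, Finset.prod_empty]
  | step m hm σ σ' s t ht hl hr hh _ ih =>
    obtain ⟨S, h1, h2, h3, h4⟩ := ih
    have hne : ∀ i : Fin n, m + 1 ≤ i.val → i ≠ ⟨m, hm⟩ := by
      rintro i hi rfl
      exact absurd hi (by simp)
    refine ⟨Function.update S ⟨m, hm⟩ t, fun i hi => ?_, fun _ => ?_, fun e => by omega, ?_⟩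
    · by_cases hi' : m + 1 ≤ i.val
      · rw [Function.update_of_ne (hne i hi')]
        obtain ⟨a, b, c, d, e⟩ := h1 i hi'
        refine ⟨a, b, c, d, fun hi => ?_⟩
        rw [Function.update_of_ne (hne _ (by simp only; omega))]
        exact e hi
      · obtain rfl : i = ⟨m, hm⟩ := Fin.ext (by simp only; omega)
        rw [Function.update_self]
        refine ⟨ht, hh, by rw [hl]; rfl, fun e => ?_, fun e => ?_⟩
        · rw [hr, h3 e, nextLabel, dif_neg (by simp only; simp only at e; omega)]
          rfl
        · rw [hr, Function.update_of_ne (hne _ (by simp)), h2 e, nextLabel, dif_pos e]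
    · rw [Function.update_self, hl]
    · rw [filter_le_eq_insert m hm, Finset.prod_insert (by simp), Function.update_self, ← h4]
      congr 1
      refine Finset.prod_congr rfl fun i hi => ?_
      rw [Function.update_of_ne (hne i (Finset.mem_filter.1 hi).2)]

theorem Run.exists_row {x y : Fin n → Triple n} {s : ℤ}
    (h : Run x y 0 (.circ, none, none) s) : ∃ R, IsRow x R ∧ R.bottom = y ∧ rowSign R = s := by
  obtain ⟨S, h1, h2, -, h4⟩ := h.exists_pieces
  refine ⟨(fun i => (.white, if i.val = 0 then plain .circ none else (S i).left, (S i).left, x i),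
    S), ⟨fun i => ?_, fun i => (h1 i (Nat.zero_le _)).1, fun i => rfl, fun i hi => ?_,
    fun i => rfl, fun i hi => ?_, fun i hi => ?_⟩, ?_, ?_⟩
  · by_cases h0 : i.val = 0
    · obtain ⟨m, hm⟩ := i
      obtain rfl : m = 0 := h0
      simp only [if_true, h2 hm]
      exact IsWhite.boundary _
    · simp only [if_neg h0]
      obtain ⟨m, hm⟩ := i
      obtain ⟨m, rfl⟩ : ∃ k, m = k + 1 := ⟨m - 1, by simp only at h0; omega⟩
      obtain ⟨a, -, -, -, e⟩ := h1 ⟨m, by omega⟩ (Nat.zero_le _)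
      have h5 := (h1 ⟨m + 1, hm⟩ (Nat.zero_le _)).2.2.1
      rw [← e hm] at h5 ⊢
      exact isWhite_of_right a h5
  · have e : (if i.val + 1 = 0 then plain .circ none else (S ⟨i.val + 1, hi⟩).left)
        = (S ⟨i.val + 1, hi⟩).left := if_neg (Nat.succ_ne_zero _)
    exact ((h1 i (Nat.zero_le _)).2.2.2.2 hi).trans e.symm
  · exact if_pos hi
  · exact (h1 i (Nat.zero_le _)).2.2.2.1 hi
  · exact funext fun i => (h1 i (Nat.zero_le _)).2.1
  · rw [rowSign, ← h4]
    simp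

theorem rowWeight_eq {x y : Fin n → Triple n} {s : ℤ} (h : Run x y 0 (.circ, none, none) s) :
    rowWeight x y = s := by
  classical
  obtain ⟨R, hR, rfl, rfl⟩ := h.exists_row
  rw [rowWeight, Finset.sum_eq_single R]
  · exact if_pos ⟨hR, rfl⟩
  · intro R' _ hne
    exact if_neg fun h => hne (h.1.eq_of_bottom_eq hR h.2)
  · simp

theorem exists_run_of_rowWeight_ne_zero {x y : Fin n → Triple n} (hn : 0 < n)
    (h : rowWeight x y ≠ 0) : Run x y 0 (.circ, none, none) (rowWeight x y) := by
  classical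
  obtain ⟨R, -, hR⟩ := Finset.exists_ne_zero_of_sum_ne_zero h
  have hc : IsRow x R ∧ R.bottom = y := by
    by_contra hc
    exact hR (if_neg hc)
  have hrun := hc.1.run hn
  rw [hc.2] at hrun
  rwa [rowWeight_eq hrun]

end Rows

/-! ### Transitions of the automaton -/

section Transitions

variable {t : Piece n} {a b c p q r d e f g h : Fin n} {z : Option (Triple n)} {σ : State n}

/-- The transitions from `∗` without other labels. -/
theorem step_star (ht : IsShaded t ∨ IsDark t) (hl : t.left = plain .star (some (a, b, c)))
    (hr : t.right = σ.side z) : pieceSign t = 1 ∧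
      ((σ = (.star, none, none) ∧ t.horiz = (a, b, c)) ∨
        ∃ h, a < h ∧ σ = (.star, none, some (some a, some h)) ∧ t.horiz = (h, b, c)) := by
  obtain ⟨i, fb, tr⟩ := σ
  rcases ht with ht | ht <;> cases ht <;>
    simp_all [Piece.left, Piece.right, Piece.horiz, State.side, plain, withTr, withFb, withFbTr,
      withFbBlank, pieceSign, Piece.IsRed, Piece.kind]

/-- The transitions from `∗` with a transmuter signal. -/
theorem step_star_tr (ht : IsShaded t ∨ IsDark t) (hl : t.left = withTr .star (some (a, b, c)) g h)
    (hr : t.right = σ.side z) : pieceSign t = 1 ∧ g < h ∧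
      ((σ = (.star, none, some (some g, some h)) ∧ t.horiz = (a, b, c)) ∨
        (h = a ∧ σ = (.star, none, none) ∧ t.horiz = (g, b, c))) := by
  obtain ⟨i, fb, tr⟩ := σ
  rcases ht with ht | ht <;> cases ht <;>
    simp_all [Piece.left, Piece.right, Piece.horiz, State.side, plain, withTr, withFb, withFbTr,
      withFbBlank, pieceSign, Piece.IsRed, Piece.kind]

theorem step_fbUW (ht : IsShaded t ∨ IsDark t)
    (hl : t.left = withFb .star (some (a, b, c)) (some d) none (some f))
    (hr : t.right = σ.side z) :
    pieceSign t = 1 ∧ σ = (.star, none, none) ∧ t.horiz = (d, b, f) := by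
  obtain ⟨i, fb, tr⟩ := σ
  rcases ht with ht | ht <;> cases ht <;>
    simp_all [Piece.left, Piece.right, Piece.horiz, State.side, plain, withTr, withFb, withFbTr,
      withFbBlank, pieceSign, Piece.IsRed, Piece.kind]

theorem step_fbUV (ht : IsShaded t ∨ IsDark t)
    (hl : t.left = withFb .star (some (a, b, c)) (some d) (some e) none)
    (hr : t.right = σ.side z) :
    pieceSign t = 1 ∧ σ = (.star, none, none) ∧ t.horiz = (d, e, c) := by
  obtain ⟨i, fb, tr⟩ := σ
  rcases ht with ht | ht <;> cases ht <;>
    simp_all [Piece.left, Piece.right, Piece.horiz, State.side, plain, withTr, withFb, withFbTr,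
      withFbBlank, pieceSign, Piece.IsRed, Piece.kind]

theorem step_fbV (ht : IsShaded t ∨ IsDark t)
    (hl : t.left = withFb .star (some (a, b, c)) none (some e) none)
    (hr : t.right = σ.side z) :
    pieceSign t = 1 ∧ σ = (.star, none, none) ∧ t.horiz = (a, e, c) := by
  obtain ⟨i, fb, tr⟩ := σ
  rcases ht with ht | ht <;> cases ht <;>
    simp_all [Piece.left, Piece.right, Piece.horiz, State.side, plain, withTr, withFb, withFbTr,
      withFbBlank, pieceSign, Piece.IsRed, Piece.kind]

theorem step_fbTr (ht : IsShaded t ∨ IsDark t)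
    (hl : t.left = withFbTr .star (some (a, b, c)) e g h)
    (hr : t.right = σ.side z) : pieceSign t = 1 ∧
      ((σ = (.star, none, some (some g, some h)) ∧ t.horiz = (a, e, c)) ∨
        (h = a ∧ σ = (.star, none, none) ∧ t.horiz = (g, e, c))) := by
  obtain ⟨i, fb, tr⟩ := σ
  rcases ht with ht | ht <;> cases ht <;>
    simp_all [Piece.left, Piece.right, Piece.horiz, State.side, plain, withTr, withFb, withFbTr,
      withFbBlank, pieceSign, Piece.IsRed, Piece.kind]

theorem step_fbBlank (ht : IsShaded t ∨ IsDark t)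
    (hl : t.left = withFbBlank .star (some (a, b, c)) e)
    (hr : t.right = σ.side z) : pieceSign t = 1 ∧
      ∃ h, a < h ∧ σ = (.star, none, some (some a, some h)) ∧ t.horiz = (h, e, c) := by
  obtain ⟨i, fb, tr⟩ := σ
  rcases ht with ht | ht <;> cases ht <;>
    simp_all [Piece.left, Piece.right, Piece.horiz, State.side, plain, withTr, withFb, withFbTr,
      withFbBlank, pieceSign, Piece.IsRed, Piece.kind]

/-- The transitions from `∘` at a descent of the first labels. -/
theorem step_circ_of_descent (ht : IsShaded t ∨ IsDark t)
    (hl : t.left = plain .circ (some (a, b, c))) (hr : t.right = σ.side (some (p, q, r)))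
    (hp : p < a) : pieceSign t = 1 ∧
      ((σ = (.circ, none, none) ∧ t.horiz = (a, b, c)) ∨
        ∃ h, a < h ∧ σ = (.circ, none, some (some a, some h)) ∧ t.horiz = (h, b, c)) := by
  obtain ⟨i, fb, tr⟩ := σ
  rcases ht with ht | ht <;> cases ht <;>
    simp_all [Piece.left, Piece.right, Piece.horiz, State.side, plain, withTr, withFb, withFbTr,
      withFbBlank, pieceSign, Piece.IsRed, Piece.kind]
  all_goals order

theorem step_circ_tr_of_descent (ht : IsShaded t ∨ IsDark t)
    (hl : t.left = withTr .circ (some (a, b, c)) g h) (hr : t.right = σ.side (some (p, q, r)))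
    (hp : p < a) : pieceSign t = 1 ∧ g < h ∧
      ((σ = (.circ, none, some (some g, some h)) ∧ t.horiz = (a, b, c)) ∨
        (h = a ∧ σ = (.circ, none, none) ∧ t.horiz = (g, b, c))) := by
  obtain ⟨i, fb, tr⟩ := σ
  rcases ht with ht | ht <;> cases ht <;>
    simp_all [Piece.left, Piece.right, Piece.horiz, State.side, plain, withTr, withFb, withFbTr,
      withFbBlank, pieceSign, Piece.IsRed, Piece.kind]
  all_goals order

/-- The transitions from `∘` at an ascent of the first labels. -/
theorem step_circ_of_ascent (ht : IsShaded t ∨ IsDark t)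
    (hl : t.left = plain .circ (some (a, b, c))) (hr : t.right = σ.side (some (p, q, r)))
    (hp : a < p) :
    (pieceSign t = 1 ∧ (b < q ∨ q < b) ∧ c < r ∧
      σ = (.star, some (some a, none, some c), none) ∧ t.horiz = (p, b, r)) ∨
    (pieceSign t = 1 ∧ q < b ∧
      σ = (.star, some (some a, some b, none), none) ∧ t.horiz = (p, q, c)) ∨
    (pieceSign t = 1 ∧ q < b ∧ c < r ∧ ∃ h, a < h ∧ h ≠ p ∧
      σ = (.star, some (none, some b, none), some (some a, some h)) ∧ t.horiz = (h, q, c)) ∨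
    (pieceSign t = -1 ∧ q < b ∧ c < r ∧
      σ = (.star, some (none, some b, none), some (none, none)) ∧ t.horiz = (a, q, c)) := by
  obtain ⟨i, fb, tr⟩ := σ
  rcases ht with ht | ht <;> cases ht <;>
    simp_all [Piece.left, Piece.right, Piece.horiz, State.side, plain, withTr, withFb, withFbTr,
      withFbBlank, pieceSign, Piece.IsRed, Piece.kind, ShadedOK]
  all_goals aesop

theorem step_circ_tr_of_ascent (ht : IsShaded t ∨ IsDark t)
    (hl : t.left = withTr .circ (some (a, b, c)) g h) (hr : t.right = σ.side (some (p, q, r)))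
    (hp : a < p) : g < h ∧ q < b ∧ c < r ∧
      ((pieceSign t = 1 ∧ h = p ∧
        σ = (.star, some (none, some b, none), some (some g, some h)) ∧ t.horiz = (a, q, c)) ∨
      (pieceSign t = -1 ∧ h = a ∧
        σ = (.star, some (none, some b, none), none) ∧ t.horiz = (g, q, c))) := by
  obtain ⟨i, fb, tr⟩ := σ
  rcases ht with ht | ht <;> cases ht <;>
    simp_all [Piece.left, Piece.right, Piece.horiz, State.side, plain, withTr, withFb, withFbTr,
      withFbBlank, pieceSign, Piece.IsRed, Piece.kind, ShadedOK]
  all_goals aesop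

theorem not_step_circ_none {s : Side n} (ht : IsShaded t ∨ IsDark t) (hl : t.left = s)
    (hs : s.1 = .circ) : t.right.2.1 ≠ none := by
  subst hl
  rcases ht with ht | ht <;> cases ht <;>
    simp_all [Piece.left, Piece.right, plain, withTr, withFb, withFbTr, withFbBlank]
  all_goals
    rintro rfl
    simp_all [ShadedOK]

end Transitions

/-! ### The bottom labels of a row -/

/-- The labels given by three permutations. -/
def labels (u v w : Perm (Fin n)) (i : Fin n) : Triple n := (u i, v i, w i)

theorem Run.exists_step {x y : Fin n → Triple n} {m : ℕ} {σ : State n} {s : ℤ}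
    (h : Run x y m σ s) (hm : m < n) : ∃ (t : Piece n) (σ' : State n) (s' : ℤ),
      (IsShaded t ∨ IsDark t) ∧ t.left = σ.side (some (x ⟨m, hm⟩)) ∧
      t.right = σ'.side (nextLabel x ⟨m, hm⟩) ∧ t.horiz = y ⟨m, hm⟩ ∧ Run x y (m + 1) σ' s' ∧
      s = pieceSign t * s' := by
  cases h with
  | done _ h => omega
  | step _ _ _ σ' s' t ht hl hr hh hrun => exact ⟨t, σ', s', ht, hl, hr, hh, hrun, rfl⟩

theorem Run.eq_of_end {x y : Fin n → Triple n} {m : ℕ} {σ : State n} {s : ℤ}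
    (h : Run x y m σ s) (hm : m = n) : σ = (.star, none, none) ∧ s = 1 := by
  cases h with
  | done _ h => exact ⟨rfl, rfl⟩
  | step _ h => omega

theorem nextLabel_of_lt (x : Fin n → Triple n) (i : Fin n) (h : i.val + 1 < n) :
    nextLabel x i = some (x ⟨i.val + 1, h⟩) := dif_pos h

/-- The part of a row with indicator `∗` and no feedback changes the first permutation by
transpositions that create inversions. A pending transmuter signal `(g, h)` is resolved in the
column `k` with `u k = h`. -/
theorem Run.star_scan (u v w : Perm (Fin n)) (y : Fin n → Triple n) (d : ℕ) :
    ∀ (m : ℕ) (s : ℤ), m + d = n →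
    (Run (labels u v w) y m (.star, none, none) s → s = 1 ∧ ∃ u' : Perm (Fin n),
      (u' = u ∨ inv u < inv u') ∧ (∀ c : Fin n, c.val < m → u' c = u c) ∧
      ∀ c : Fin n, m ≤ c.val → y c = (u' c, v c, w c)) ∧
    (∀ g h : Fin n, Run (labels u v w) y m (.star, none, some (some g, some h)) s →
      s = 1 ∧ g < h ∧ ∃ k : Fin n, m ≤ k.val ∧ u k = h ∧ ∃ u' : Perm (Fin n),
        (u' = u ∨ inv u < inv u') ∧ (∀ c : Fin n, c ≤ k → u' c = u c) ∧ y k = (g, v k, w k) ∧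
        ∀ c : Fin n, m ≤ c.val → c ≠ k → y c = (u' c, v c, w c)) := by
  induction d with
  | zero =>
    intro m s hm
    refine ⟨fun hrun => ⟨(hrun.eq_of_end hm).2, u, Or.inl rfl, fun _ _ => rfl, ?_⟩, ?_⟩
    · intro c hc; omega
    · intro g h hrun
      cases (hrun.eq_of_end hm).1
  | succ d ih =>
    intro m s hm
    have hmn : m < n := by omega
    set j : Fin n := ⟨m, hmn⟩ with hj
    have hsucc : ∀ c : Fin n, m ≤ c.val → c ≠ j → m + 1 ≤ c.val := fun c hc hne =>
      lt_of_le_of_ne hc fun e => hne (Fin.ext e.symm)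
    constructor
    · intro hrun
      obtain ⟨t, σ, s', ht, hl, hr, hh, hrun', rfl⟩ := hrun.exists_step hmn
      obtain ⟨hs, ⟨rfl, e⟩ | ⟨h, hlt, rfl, e⟩⟩ := step_star ht hl hr
      · obtain ⟨rfl, u', h1, h2, h3⟩ := (ih (m + 1) s' (by omega)).1 hrun'
        refine ⟨by rw [hs, mul_one], u', h1, fun c hc => h2 c (by omega), fun c hc => ?_⟩
        by_cases hcj : c = j
        · subst hcj; rw [← hh, e, h2 _ (Nat.lt_succ_self _)]
        · exact h3 c (hsucc c hc hcj)
      · obtain ⟨rfl, -, k, hk, rfl, u', h1, h2, h3, h4⟩ := (ih (m + 1) s' (by omega)).2 _ _ hrun'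
        have hjk : j < k := Fin.lt_def.2 hk
        refine ⟨by rw [hs, mul_one], u' * swap j k, Or.inr ?_, fun c hc => ?_, fun c hc => ?_⟩
        · have := inv_lt_inv_mul_swap u' j k hjk (by rw [h2 j hjk.le, h2 k le_rfl]; exact hlt)
          rcases h1 with rfl | h1 <;> omega
        · have hcj : c < j := Fin.lt_def.2 hc
          rw [Perm.mul_apply, swap_apply_of_ne_of_ne hcj.ne (hcj.trans hjk).ne,
            h2 c (hcj.trans hjk).le]
        · rw [Perm.mul_apply]
          by_cases hcj : c = j
          · rw [hcj, swap_apply_left, h2 k le_rfl, ← hh, e]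
          · by_cases hck : c = k
            · rw [hck, swap_apply_right, h2 j hjk.le, h3]
            · rw [swap_apply_of_ne_of_ne hcj hck, h4 c (hsucc c hc hcj) hck]
    · intro g h hrun
      obtain ⟨t, σ, s', ht, hl, hr, hh, hrun', rfl⟩ := hrun.exists_step hmn
      obtain ⟨hs, hgh, ⟨rfl, e⟩ | ⟨rfl, rfl, e⟩⟩ := step_star_tr ht hl hr
      · obtain ⟨rfl, -, k, hk, rfl, u', h1, h2, h3, h4⟩ := (ih (m + 1) s' (by omega)).2 _ _ hrun'
        have hjk : j < k := Fin.lt_def.2 hk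
        refine ⟨by rw [hs, mul_one], hgh, k, by omega, rfl, u', h1, h2, h3, fun c hc hck => ?_⟩
        by_cases hcj : c = j
        · rw [hcj, h2 j hjk.le, ← hh, e]
        · exact h4 c (hsucc c hc hcj) hck
      · obtain ⟨rfl, u', h1, h2, h3⟩ := (ih (m + 1) s' (by omega)).1 hrun'
        exact ⟨by rw [hs, mul_one], hgh, j, le_rfl, rfl, u', h1,
          fun c hc => h2 c (Nat.lt_succ_of_le hc), by rw [← hh, e],
          fun c hc hcj => h3 c (hsucc c hc hcj)⟩

/-- The terms of the recurrence at the position `i`, with their signs. -/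
inductive IsTransition (u v w : Perm (Fin n)) (i : Fin n) (h : i.val + 1 < n) :
    Perm (Fin n) → Perm (Fin n) → Perm (Fin n) → ℤ → Prop
  | third (hw : w i < w ⟨i.val + 1, h⟩) :
      IsTransition u v w i h (mulSimple u i h) v (mulSimple w i h) 1
  | second (hv : v ⟨i.val + 1, h⟩ < v i) :
      IsTransition u v w i h (mulSimple u i h) (mulSimple v i h) w 1
  | mixed (a b : Fin n) (hab : a < b) (hv : v ⟨i.val + 1, h⟩ < v i) (hw : w i < w ⟨i.val + 1, h⟩)
      (he : mixedCoeff i ⟨i.val + 1, h⟩ a b ≠ 0) :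
      IsTransition u v w i h (u * swap a b) (mulSimple v i h) w
        (mixedCoeff i ⟨i.val + 1, h⟩ a b)

theorem mixedCoeff_left {i i' k : Fin n} (hi : i < i') (hk : i' < k) :
    mixedCoeff i i' i k = 1 := by
  simp [mixedCoeff, rootPairing, hi.ne', hk.ne, hk.ne', (hi.trans hk).ne]

theorem mixedCoeff_right {i i' k : Fin n} (hi : i < i') (hk : i' < k) :
    mixedCoeff i i' i' k = -1 := by
  simp [mixedCoeff, rootPairing, hi.ne, hi.ne', hk.ne, hk.ne', (hi.trans hk).ne]

theorem mixedCoeff_to_left {i i' j : Fin n} (hi : i < i') (hj : j < i) :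
    mixedCoeff i i' j i = -1 := by
  simp [mixedCoeff, rootPairing, hi.ne, hi.ne', hj.ne, hj.ne', (hj.trans hi).ne']

theorem mixedCoeff_to_right {i i' j : Fin n} (hi : i < i') (hj : j < i) :
    mixedCoeff i i' j i' = 1 := by
  simp [mixedCoeff, rootPairing, hi.ne, hj.ne, hj.ne', (hj.trans hi).ne']

theorem mixedCoeff_self {i i' : Fin n} (hi : i < i') :
    mixedCoeff i i' i i' = 1 := by
  simp [mixedCoeff, rootPairing, hi.ne, hi.ne']

section Scan

variable {u v w : Perm (Fin n)} {y : Fin n → Triple n} {i : Fin n} {h : i.val + 1 < n} {s : ℤ}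

theorem cases_of_le {P : Fin n → Prop} (h0 : P i) (h1 : P ⟨i.val + 1, h⟩)
    (h2 : ∀ c : Fin n, i.val + 2 ≤ c.val → c ≠ i → c ≠ ⟨i.val + 1, h⟩ → P c) (c : Fin n)
    (hc : i.val ≤ c.val) : P c := by
  by_cases e0 : c = i
  · exact e0 ▸ h0
  · by_cases e1 : c = ⟨i.val + 1, h⟩
    · exact e1 ▸ h1
    · refine h2 c ?_ e0 e1
      have e0' : c.val ≠ i.val := fun e => e0 (Fin.ext e)
      have e1' : c.val ≠ i.val + 1 := fun e => e1 (Fin.ext e)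
      omega

theorem mulSimple_apply_of_lt {z : Perm (Fin n)} {c : Fin n} (hc : c.val < i.val) :
    mulSimple z i h c = z c :=
  mulSimple_apply_of_ne z i h c (fun e => by subst e; omega) (fun e => by
    subst e; simp only at hc; omega)

/-- The part of a row that starts with `∘` and no signal at the ascent `i`. -/
theorem Run.circ_scan_ascent (hu : u i < u ⟨i.val + 1, h⟩)
    (hrun : Run (labels u v w) y i.val (.circ, none, none) s) :
    ∃ u' v' w' : Perm (Fin n),
      (∀ c : Fin n, c.val < i.val → u' c = u c ∧ v' c = v c ∧ w' c = w c) ∧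
      (∀ c : Fin n, i.val ≤ c.val → y c = (u' c, v' c, w' c)) ∧ inv u < inv u' ∧
      (inv u' = inv u + 1 → IsTransition u v w i h u' v' w' s) := by
  set i' : Fin n := ⟨i.val + 1, h⟩ with hi'
  have hii : i < i' := lt_next
  obtain ⟨t, σ, s', ht, hl, hr, hh, hrun', rfl⟩ := hrun.exists_step i.isLt
  rw [nextLabel_of_lt _ _ h] at hr
  have hscan := fun s => Run.star_scan u v w y (n - (i.val + 2)) (i.val + 2) s (by omega)
  rcases step_circ_of_ascent ht hl hr hu with ⟨hs, -, hw, rfl, e⟩ | ⟨hs, hv, rfl, e⟩ |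
    ⟨hs, hv, hw, q, hq, hqp, rfl, e⟩ | ⟨hs, hv, hw, rfl, e⟩
  · obtain ⟨t', σ', s'', ht', hl', hr', hh', hrun'', rfl⟩ := hrun'.exists_step h
    obtain ⟨hs', rfl, e'⟩ := step_fbUW ht' hl' hr'
    obtain ⟨rfl, u', h1, h2, h3⟩ := (hscan s'').1 hrun''
    have h2i : u' i = u i := h2 i (by omega)
    have h2i' : u' i' = u i' := h2 i' (by simp [hi'])
    have hinv := inv_mulSimple u' i h (by rw [h2i, ← hi', h2i']; exact hu)
    refine ⟨mulSimple u' i h, v, mulSimple w i h, fun c hc => ?_, cases_of_le (h := h) ?_ ?_ ?_, ?_,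
      fun h5 => ?_⟩
    · rw [mulSimple_apply_of_lt hc, mulSimple_apply_of_lt hc, h2 c (by omega)]
      exact ⟨rfl, rfl, rfl⟩
    · rw [mulSimple_apply_left, mulSimple_apply_left, ← hi', h2i']
      exact hh.symm.trans e
    · rw [mulSimple_apply_right, mulSimple_apply_right, h2i]
      exact hh'.symm.trans e'
    · intro c hc n1 n2
      rw [mulSimple_apply_of_ne _ _ _ _ n1 n2, mulSimple_apply_of_ne _ _ _ _ n1 n2, h3 c hc]
    · rcases h1 with rfl | h1 <;> omega
    · obtain rfl : u' = u := h1.resolve_right (by omega)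
      rw [hs, hs', mul_one, mul_one]
      exact IsTransition.third hw
  · obtain ⟨t', σ', s'', ht', hl', hr', hh', hrun'', rfl⟩ := hrun'.exists_step h
    obtain ⟨hs', rfl, e'⟩ := step_fbUV ht' hl' hr'
    obtain ⟨rfl, u', h1, h2, h3⟩ := (hscan s'').1 hrun''
    have h2i : u' i = u i := h2 i (by omega)
    have h2i' : u' i' = u i' := h2 i' (by simp [hi'])
    have hinv := inv_mulSimple u' i h (by rw [h2i, ← hi', h2i']; exact hu)
    refine ⟨mulSimple u' i h, mulSimple v i h, w, fun c hc => ?_, cases_of_le (h := h) ?_ ?_ ?_, ?_,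
      fun h5 => ?_⟩
    · rw [mulSimple_apply_of_lt hc, mulSimple_apply_of_lt hc, h2 c (by omega)]
      exact ⟨rfl, rfl, rfl⟩
    · rw [mulSimple_apply_left, mulSimple_apply_left, ← hi', h2i']
      exact hh.symm.trans e
    · rw [mulSimple_apply_right, mulSimple_apply_right, h2i]
      exact hh'.symm.trans e'
    · intro c hc n1 n2
      rw [mulSimple_apply_of_ne _ _ _ _ n1 n2, mulSimple_apply_of_ne _ _ _ _ n1 n2, h3 c hc]
    · rcases h1 with rfl | h1 <;> omega
    · obtain rfl : u' = u := h1.resolve_right (by omega)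
      rw [hs, hs', mul_one, mul_one]
      exact IsTransition.second hv
  · obtain ⟨t', σ', s'', ht', hl', hr', hh', hrun'', rfl⟩ := hrun'.exists_step h
    obtain ⟨hs', ⟨rfl, e'⟩ | ⟨hqp', -⟩⟩ := step_fbTr ht' hl' hr'
    swap
    · exact absurd hqp' hqp
    obtain ⟨rfl, -, k, hk, rfl, u', h1, h2, h3, h4⟩ := (hscan s'').2 _ _ hrun''
    have hik' : i' < k := Fin.lt_def.2 (by simp only [hi']; omega)
    have hik : i < k := hii.trans hik'
    have hinv := inv_lt_inv_mul_swap u' i k hik (by rw [h2 i hik.le, h2 k le_rfl]; exact hq)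
    refine ⟨u' * swap i k, mulSimple v i h, w, fun c hc => ?_, cases_of_le (h := h) ?_ ?_ ?_, ?_,
      fun h5 => ?_⟩
    · have hci : c < i := Fin.lt_def.2 hc
      rw [mulSimple_apply_of_lt hc, Perm.mul_apply,
        swap_apply_of_ne_of_ne hci.ne (hci.trans hik).ne, h2 c (hci.trans hik).le]
      exact ⟨rfl, rfl, rfl⟩
    · rw [mulSimple_apply_left, Perm.mul_apply, swap_apply_left, h2 k le_rfl]
      exact hh.symm.trans e
    · rw [mulSimple_apply_right, ← hi', Perm.mul_apply, swap_apply_of_ne_of_ne hii.ne' hik'.ne,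
        h2 i' hik'.le]
      exact hh'.symm.trans e'
    · intro c hc n1 n2
      rw [mulSimple_apply_of_ne _ _ _ _ n1 n2, Perm.mul_apply]
      by_cases hck : c = k
      · rw [hck, swap_apply_right, h2 i hik.le, h3]
      · rw [swap_apply_of_ne_of_ne n1 hck, h4 c hc hck]
    · rcases h1 with rfl | h1 <;> omega
    · obtain rfl : u' = u := h1.resolve_right (by omega)
      rw [hs, hs', mul_one, mul_one]
      have := IsTransition.mixed (u := u') (h := h) i k hik hv hw
        (by rw [mixedCoeff_left hii hik']; exact one_ne_zero)
      rwa [mixedCoeff_left hii hik'] at this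
  · obtain ⟨t', σ', s'', ht', hl', hr', hh', hrun'', rfl⟩ := hrun'.exists_step h
    obtain ⟨hs', q, hq, rfl, e'⟩ := step_fbBlank ht' hl' hr'
    obtain ⟨rfl, -, k, hk, rfl, u', h1, h2, h3, h4⟩ := (hscan s'').2 _ _ hrun''
    have hik' : i' < k := Fin.lt_def.2 (by simp only [hi']; omega)
    have hik : i < k := hii.trans hik'
    have hinv := inv_lt_inv_mul_swap u' i' k hik' (by rw [h2 i' hik'.le, h2 k le_rfl]; exact hq)
    refine ⟨u' * swap i' k, mulSimple v i h, w, fun c hc => ?_, cases_of_le (h := h) ?_ ?_ ?_, ?_,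
      fun h5 => ?_⟩
    · have hci : c < i := Fin.lt_def.2 hc
      rw [mulSimple_apply_of_lt hc, Perm.mul_apply,
        swap_apply_of_ne_of_ne (hci.trans hii).ne (hci.trans hik).ne, h2 c (hci.trans hik).le]
      exact ⟨rfl, rfl, rfl⟩
    · rw [mulSimple_apply_left, Perm.mul_apply, swap_apply_of_ne_of_ne hii.ne hik.ne,
        h2 i hik.le]
      exact hh.symm.trans e
    · rw [mulSimple_apply_right, ← hi', Perm.mul_apply, swap_apply_left, h2 k le_rfl]
      exact hh'.symm.trans e'
    · intro c hc n1 n2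
      rw [mulSimple_apply_of_ne _ _ _ _ n1 n2, Perm.mul_apply]
      by_cases hck : c = k
      · rw [hck, swap_apply_right, h2 i' hik'.le, h3]
      · rw [swap_apply_of_ne_of_ne n2 hck, h4 c hc hck]
    · rcases h1 with rfl | h1 <;> omega
    · obtain rfl : u' = u := h1.resolve_right (by omega)
      rw [hs, hs', mul_one, mul_one]
      have := IsTransition.mixed (u := u') (h := h) i' k hik' hv hw
        (by rw [mixedCoeff_right hii hik']; exact neg_ne_zero.2 one_ne_zero)
      rwa [mixedCoeff_right hii hik'] at this

/-- The part of a row that starts with `∘` and a transmuter signal at the ascent `i`. -/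
theorem Run.circ_tr_scan_ascent (hu : u i < u ⟨i.val + 1, h⟩) {g q : Fin n}
    (hrun : Run (labels u v w) y i.val (.circ, none, some (some g, some q)) s) :
    g < q ∧ ∃ k : Fin n, i.val ≤ k.val ∧ u k = q ∧ ∃ u' v' w' : Perm (Fin n),
      (∀ c : Fin n, c ≤ k → u' c = u c) ∧
      (∀ c : Fin n, c.val < i.val → v' c = v c ∧ w' c = w c) ∧ y k = (g, v' k, w' k) ∧
      (∀ c : Fin n, i.val ≤ c.val → c ≠ k → y c = (u' c, v' c, w' c)) ∧ inv u ≤ inv u' ∧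
      (inv u' = inv u → u' = u ∧ v ⟨i.val + 1, h⟩ < v i ∧ w i < w ⟨i.val + 1, h⟩ ∧
        v' = mulSimple v i h ∧ w' = w ∧ (k = i ∧ s = -1 ∨ k = ⟨i.val + 1, h⟩ ∧ s = 1)) := by
  set i' : Fin n := ⟨i.val + 1, h⟩ with hi'
  have hii : i < i' := lt_next
  obtain ⟨t, σ, s', ht, hl, hr, hh, hrun', rfl⟩ := hrun.exists_step i.isLt
  rw [nextLabel_of_lt _ _ h] at hr
  have hscan := fun s => Run.star_scan u v w y (n - (i.val + 2)) (i.val + 2) s (by omega)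
  obtain ⟨hgq, hv, hw, ⟨hs, rfl, rfl, e⟩ | ⟨hs, rfl, rfl, e⟩⟩ := step_circ_tr_of_ascent ht hl hr hu
  · obtain ⟨t', σ', s'', ht', hl', hr', hh', hrun'', rfl⟩ := hrun'.exists_step h
    obtain ⟨hs', ⟨rfl, e'⟩ | ⟨-, rfl, e'⟩⟩ := step_fbTr ht' hl' hr'
    · obtain ⟨-, -, k, hk, hk', -⟩ := (hscan s'').2 _ _ hrun''
      have : k = i' := u.injective hk'
      rw [this] at hk
      simp [hi'] at hk
    · obtain ⟨rfl, u', h1, h2, h3⟩ := (hscan s'').1 hrun''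
      refine ⟨hgq, i', hii.le, rfl, u', mulSimple v i h, w,
        fun c hc => h2 c (Nat.lt_succ_of_le hc), fun c hc => ⟨mulSimple_apply_of_lt hc, rfl⟩, ?_,
        cases_of_le (h := h) (fun _ => ?_) (fun hne => absurd rfl hne) (fun c hc n1 n2 _ => ?_), ?_,
        fun h5 => ?_⟩
      · rw [hi', mulSimple_apply_right]
        exact hh'.symm.trans e'
      · rw [mulSimple_apply_left, h2 i (by omega)]
        exact hh.symm.trans e
      · rw [mulSimple_apply_of_ne _ _ _ _ n1 n2, h3 c hc]
      · rcases h1 with rfl | h1 <;> omega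
      · exact ⟨h1.resolve_right (by omega), hv, hw, rfl, rfl, Or.inr ⟨rfl, by rw [hs, hs']; rfl⟩⟩
  · obtain ⟨t', σ', s'', ht', hl', hr', hh', hrun'', rfl⟩ := hrun'.exists_step h
    obtain ⟨hs', rfl, e'⟩ := step_fbV ht' hl' hr'
    obtain ⟨rfl, u', h1, h2, h3⟩ := (hscan s'').1 hrun''
    refine ⟨hgq, i, le_rfl, rfl, u', mulSimple v i h, w,
      fun c hc => h2 c (lt_of_le_of_lt hc (by omega)),
      fun c hc => ⟨mulSimple_apply_of_lt hc, rfl⟩, ?_,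
      cases_of_le (h := h) (fun hne => absurd rfl hne) (fun _ => ?_) (fun c hc n1 n2 _ => ?_), ?_,
      fun h5 => ?_⟩
    · rw [mulSimple_apply_left]
      exact hh.symm.trans e
    · rw [mulSimple_apply_right, h2 _ (by simp)]
      exact hh'.symm.trans e'
    · rw [mulSimple_apply_of_ne _ _ _ _ n1 n2, h3 c hc]
    · rcases h1 with rfl | h1 <;> omega
    · exact ⟨h1.resolve_right (by omega), hv, hw, rfl, rfl, Or.inl ⟨rfl, by rw [hs, hs']; rfl⟩⟩

/-- The part of a row up to the first ascent `i`, read from the column `m ≤ i` on. -/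
theorem Run.circ_scan (hu : u i < u ⟨i.val + 1, h⟩)
    (hfirst : ∀ (j : Fin n) (h' : j.val + 1 < n), j < i → u ⟨j.val + 1, h'⟩ < u j) (d : ℕ) :
    ∀ (m : ℕ) (s : ℤ), m + d = i.val →
    (Run (labels u v w) y m (.circ, none, none) s → ∃ u' v' w' : Perm (Fin n),
      (∀ c : Fin n, c.val < m → u' c = u c ∧ v' c = v c ∧ w' c = w c) ∧
      (∀ c : Fin n, m ≤ c.val → y c = (u' c, v' c, w' c)) ∧ inv u < inv u' ∧
      (inv u' = inv u + 1 → IsTransition u v w i h u' v' w' s)) ∧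
    (∀ g q : Fin n, Run (labels u v w) y m (.circ, none, some (some g, some q)) s →
      g < q ∧ ∃ k : Fin n, m ≤ k.val ∧ u k = q ∧ ∃ u' v' w' : Perm (Fin n),
        (∀ c : Fin n, c ≤ k → u' c = u c) ∧
        (∀ c : Fin n, c.val < m → v' c = v c ∧ w' c = w c) ∧ y k = (g, v' k, w' k) ∧
        (∀ c : Fin n, m ≤ c.val → c ≠ k → y c = (u' c, v' c, w' c)) ∧ inv u ≤ inv u' ∧
        (inv u' = inv u → u' = u ∧ v ⟨i.val + 1, h⟩ < v i ∧ w i < w ⟨i.val + 1, h⟩ ∧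
          v' = mulSimple v i h ∧ w' = w ∧ (k = i ∧ s = -1 ∨ k = ⟨i.val + 1, h⟩ ∧ s = 1))) := by
  induction d with
  | zero =>
    rintro m s hm
    obtain rfl : m = i.val := hm
    exact ⟨fun hrun => hrun.circ_scan_ascent hu, fun g q hrun => hrun.circ_tr_scan_ascent hu⟩
  | succ d ih =>
    intro m s hm
    have hmn : m < n := by omega
    have hm1 : m + 1 < n := by omega
    set j : Fin n := ⟨m, hmn⟩ with hj
    have hji : j < i := Fin.lt_def.2 (by simp only [hj]; omega)
    have hdesc := hfirst j hm1 hji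
    have hsucc : ∀ c : Fin n, m ≤ c.val → c ≠ j → m + 1 ≤ c.val := fun c hc hne =>
      lt_of_le_of_ne hc fun e => hne (Fin.ext e.symm)
    constructor
    · intro hrun
      obtain ⟨t, σ, s', ht, hl, hr, hh, hrun', rfl⟩ := hrun.exists_step hmn
      rw [nextLabel_of_lt _ _ hm1] at hr
      obtain ⟨hs, ⟨rfl, e⟩ | ⟨q, hq, rfl, e⟩⟩ := step_circ_of_descent ht hl hr hdesc
      · obtain ⟨u', v', w', h1, h2, h3, h4⟩ := (ih (m + 1) s' (by omega)).1 hrun'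
        refine ⟨u', v', w', fun c hc => h1 c (by omega), fun c hc => ?_, h3, ?_⟩
        · by_cases hcj : c = j
          · obtain ⟨e1, e2, e3⟩ := h1 j (Nat.lt_succ_self _)
            rw [hcj, e1, e2, e3]
            exact hh.symm.trans e
          · exact h2 c (hsucc c hc hcj)
        · rw [hs, one_mul]; exact h4
      · obtain ⟨-, k, hk, rfl, u', v', w', h1, h2, h3, h4, h5, h6⟩ :=
          (ih (m + 1) s' (by omega)).2 _ _ hrun'
        have hjk : j < k := Fin.lt_def.2 hk
        have hinv := inv_lt_inv_mul_swap u' j k hjk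
          (by rw [h1 j hjk.le, h1 k le_rfl]; exact hq)
        refine ⟨u' * swap j k, v', w', fun c hc => ?_, fun c hc => ?_, by omega, fun h7 => ?_⟩
        · have hcj : c < j := Fin.lt_def.2 hc
          rw [Perm.mul_apply, swap_apply_of_ne_of_ne hcj.ne (hcj.trans hjk).ne,
            h1 c (hcj.trans hjk).le]
          exact ⟨rfl, h2 c (by omega)⟩
        · rw [Perm.mul_apply]
          by_cases hcj : c = j
          · obtain ⟨e2, e3⟩ := h2 j (Nat.lt_succ_self _)
            rw [hcj, swap_apply_left, h1 k le_rfl, e2, e3]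
            exact hh.symm.trans e
          · by_cases hck : c = k
            · rw [hck, swap_apply_right, h1 j hjk.le, h3]
            · rw [swap_apply_of_ne_of_ne hcj hck, h4 c (hsucc c hc hcj) hck]
        · obtain ⟨rfl, hv, hw, rfl, rfl, hk⟩ := h6 (by omega)
          rw [hs, one_mul]
          rcases hk with ⟨rfl, rfl⟩ | ⟨rfl, rfl⟩
          · have := IsTransition.mixed (u := u') (h := h) j k hjk hv hw
              (by rw [mixedCoeff_to_left lt_next hji]; exact neg_ne_zero.2 one_ne_zero)
            rwa [mixedCoeff_to_left lt_next hji] at this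
          · have := IsTransition.mixed (u := u') (h := h) j _ hjk hv hw
              (by rw [mixedCoeff_to_right lt_next hji]; exact one_ne_zero)
            rwa [mixedCoeff_to_right lt_next hji] at this
    · intro g q hrun
      obtain ⟨t, σ, s', ht, hl, hr, hh, hrun', rfl⟩ := hrun.exists_step hmn
      rw [nextLabel_of_lt _ _ hm1] at hr
      obtain ⟨hs, hgq, ⟨rfl, e⟩ | ⟨rfl, rfl, e⟩⟩ := step_circ_tr_of_descent ht hl hr hdesc
      · obtain ⟨-, k, hk, rfl, u', v', w', h1, h2, h3, h4, h5, h6⟩ :=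
          (ih (m + 1) s' (by omega)).2 _ _ hrun'
        have hjk : j < k := Fin.lt_def.2 hk
        refine ⟨hgq, k, by omega, rfl, u', v', w', h1, fun c hc => h2 c (by omega), h3,
          fun c hc hck => ?_, h5, ?_⟩
        · by_cases hcj : c = j
          · obtain ⟨e2, e3⟩ := h2 j (Nat.lt_succ_self _)
            rw [hcj, h1 j hjk.le, e2, e3]
            exact hh.symm.trans e
          · exact h4 c (hsucc c hc hcj) hck
        · rw [hs, one_mul]; exact h6
      · obtain ⟨u', v', w', h1, h2, h3, h4⟩ := (ih (m + 1) s' (by omega)).1 hrun'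
        obtain ⟨-, e2, e3⟩ := h1 j (Nat.lt_succ_self _)
        refine ⟨hgq, j, le_rfl, rfl, u', v', w', fun c hc => (h1 c (Nat.lt_succ_of_le hc)).1,
          fun c hc => (h1 c (by omega)).2, ?_, fun c hc hcj => h2 c (hsucc c hc hcj), h3.le,
          fun h5 => by omega⟩
        rw [e2, e3]
        exact hh.symm.trans e

/-- A row changes the first permutation so that inversions are created; if it creates only one, then
it is one of the terms of the recurrence. -/
theorem Run.exists_labels (hu : u i < u ⟨i.val + 1, h⟩)
    (hfirst : ∀ (j : Fin n) (h' : j.val + 1 < n), j < i → u ⟨j.val + 1, h'⟩ < u j) {s : ℤ}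
    (hrun : Run (labels u v w) y 0 (.circ, none, none) s) : ∃ u' v' w' : Perm (Fin n),
      y = labels u' v' w' ∧ inv u < inv u' ∧
      (inv u' = inv u + 1 → IsTransition u v w i h u' v' w' s) := by
  obtain ⟨u', v', w', -, h2, h3, h4⟩ :=
    (Run.circ_scan (v := v) (w := w) (y := y) hu hfirst i.val 0 s (by omega)).1 hrun
  exact ⟨u', v', w', funext fun c => h2 c (Nat.zero_le _), h3, h4⟩

/-- Without ascents the indicator `∘` persists up to the right boundary, so there are no rows. -/
theorem not_run_of_forall_descent
    (hu : ∀ (j : Fin n) (h' : j.val + 1 < n), u ⟨j.val + 1, h'⟩ < u j) (d : ℕ) :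
    ∀ (m : ℕ) (s : ℤ), m + d = n →
      ¬ Run (labels u v w) y m (.circ, none, none) s ∧
      ∀ g q : Fin n, ¬ Run (labels u v w) y m (.circ, none, some (some g, some q)) s := by
  induction d with
  | zero =>
    intro m s hm
    constructor
    · intro hrun
      cases (hrun.eq_of_end hm).1
    · intro g q hrun
      cases (hrun.eq_of_end hm).1
  | succ d ih =>
    intro m s hm
    have hmn : m < n := by omega
    have hend : ∀ {t : Piece n} {σ : State n}, ¬ m + 1 < n →
        t.right = σ.side (nextLabel (labels u v w) ⟨m, hmn⟩) → t.right.2.1 = none := by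
      intro t σ h1 h2
      rw [h2, nextLabel, dif_neg h1]
      rfl
    constructor
    · intro hrun
      obtain ⟨t, σ, s', ht, hl, hr, hh, hrun', rfl⟩ := hrun.exists_step hmn
      by_cases hm1 : m + 1 < n
      · rw [nextLabel_of_lt _ _ hm1] at hr
        obtain ⟨hs, ⟨rfl, e⟩ | ⟨q, hq, rfl, e⟩⟩ :=
          step_circ_of_descent ht hl hr (hu ⟨m, hmn⟩ hm1)
        · exact (ih (m + 1) s' (by omega)).1 hrun'
        · exact (ih (m + 1) s' (by omega)).2 _ _ hrun'
      · exact not_step_circ_none ht hl rfl (hend hm1 hr)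
    · intro g q hrun
      obtain ⟨t, σ, s', ht, hl, hr, hh, hrun', rfl⟩ := hrun.exists_step hmn
      by_cases hm1 : m + 1 < n
      · rw [nextLabel_of_lt _ _ hm1] at hr
        obtain ⟨hs, -, ⟨rfl, e⟩ | ⟨rfl, rfl, e⟩⟩ :=
          step_circ_tr_of_descent ht hl hr (hu ⟨m, hmn⟩ hm1)
        · exact (ih (m + 1) s' (by omega)).2 _ _ hrun'
        · exact (ih (m + 1) s' (by omega)).1 hrun'
      · exact not_step_circ_none ht hl rfl (hend hm1 hr)

end Scan

/-! ### Construction of rows -/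

section Build

variable {u v w : Perm (Fin n)} {y : Fin n → Triple n} {i : Fin n} {h : i.val + 1 < n}

theorem shadedOK_nextLabel (u v w : Perm (Fin n)) (c : Fin n) :
    ShadedOK .star (labels u v w c) (nextLabel (labels u v w) c) := by
  rw [nextLabel]
  split_ifs with h
  · exact ⟨u.injective.ne lt_next.ne, v.injective.ne lt_next.ne, w.injective.ne lt_next.ne,
      fun _ => rfl⟩
  · rfl

theorem shadedOK_of_descent (v w : Perm (Fin n)) (c : Fin n) (h : c.val + 1 < n)
    (hu : u ⟨c.val + 1, h⟩ < u c) :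
    ShadedOK .circ (labels u v w c) (some (labels u v w ⟨c.val + 1, h⟩)) :=
  ⟨u.injective.ne lt_next.ne, v.injective.ne lt_next.ne, w.injective.ne lt_next.ne,
    fun hlt => absurd hlt (not_lt.2 hu.le)⟩

theorem pieceSign_of_kind {t : Piece n} (h1 : t.kind ≠ .red1) (h2 : t.kind ≠ .red2) :
    pieceSign t = 1 := if_neg fun h => h.elim h1 h2

/-- Extension of a run by one column that contributes the sign `1`. -/
theorem Run.cons {x : Fin n → Triple n} {m : ℕ} (hm : m < n) {σ σ' : State n} {s : ℤ} {t : Piece n}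
    (hrun : Run x y (m + 1) σ' s) (ht : IsShaded t ∨ IsDark t)
    (hl : t.left = σ.side (some (x ⟨m, hm⟩))) (hr : t.right = σ'.side (nextLabel x ⟨m, hm⟩))
    (hh : t.horiz = y ⟨m, hm⟩) (h1 : t.kind ≠ .red1) (h2 : t.kind ≠ .red2) : Run x y m σ s := by
  have := Run.step m hm σ σ' s t ht hl hr hh hrun
  rwa [pieceSign_of_kind h1 h2, one_mul] at this

/-- Extension of a run by one column that contributes the sign `-1`. -/
theorem Run.cons_red {x : Fin n → Triple n} {m : ℕ} (hm : m < n) {σ σ' : State n} {s : ℤ}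
    {t : Piece n} (hrun : Run x y (m + 1) σ' s) (ht : IsShaded t ∨ IsDark t)
    (hl : t.left = σ.side (some (x ⟨m, hm⟩))) (hr : t.right = σ'.side (nextLabel x ⟨m, hm⟩))
    (hh : t.horiz = y ⟨m, hm⟩) (h1 : t.IsRed) : Run x y m σ (-s) := by
  have := Run.step m hm σ σ' s t ht hl hr hh hrun
  rwa [pieceSign, if_pos h1, neg_one_mul] at this

/-- With indicator `∗` and no signal, the top labels can be copied down. -/
theorem run_star (d : ℕ) : ∀ m : ℕ, m + d = n →
    (∀ c : Fin n, m ≤ c.val → y c = labels u v w c) →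
    Run (labels u v w) y m (.star, none, none) 1 := by
  induction d with
  | zero => exact fun m hm _ => Run.done m hm
  | succ d ih =>
    intro m hm hy
    have hmn : m < n := by omega
    exact (ih (m + 1) (by omega) fun c hc => hy c (by omega)).cons hmn
      (Or.inl (IsShaded.perm .star _ _ _ _ (shadedOK_nextLabel u v w ⟨m, hmn⟩))) rfl rfl
      (hy ⟨m, hmn⟩ le_rfl).symm (fun e => nomatch e) (fun e => nomatch e)

/-- With indicator `∗`, a transmuter signal `(g, u k)` can be carried to the column `k`. -/
theorem run_star_tr {g : Fin n} {k : Fin n} (hg : g < u k) (d : ℕ) : ∀ m : ℕ, m + d = k.val →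
    (∀ c : Fin n, m ≤ c.val → c ≠ k → y c = labels u v w c) → y k = (g, v k, w k) →
    Run (labels u v w) y m (.star, none, some (some g, some (u k))) 1 := by
  induction d with
  | zero =>
    rintro m hm hy hk
    obtain rfl : m = k.val := hm
    refine (run_star (n - (k.val + 1)) (k.val + 1) (by omega) fun c hc =>
      hy c (by omega) (fun e => by subst e; omega)).cons k.isLt
      (Or.inl (IsShaded.absorb .star _ _ _ g _ (shadedOK_nextLabel u v w k) hg)) rfl rfl hk.symm
      (fun e => nomatch e) (fun e => nomatch e)
  | succ d ih =>
    intro m hm hy hk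
    have hmn : m < n := by omega
    have hm1 : m + 1 < n := by omega
    have hok := shadedOK_nextLabel u v w ⟨m, hmn⟩
    rw [nextLabel_of_lt _ _ hm1] at hok
    exact (ih (m + 1) (by omega) (fun c hc => hy c (by omega)) hk).cons hmn
      (Or.inl (IsShaded.pass .star _ _ _ g (u k) _ hok hg)) rfl
      (by rw [nextLabel_of_lt _ _ hm1]; rfl)
      (hy ⟨m, hmn⟩ le_rfl (fun e => by have := congrArg Fin.val e; simp only at this; omega)).symm
      (fun e => nomatch e) (fun e => nomatch e)

variable {s : ℤ}

/-- Columns before the first ascent that carry no signal copy the top labels. -/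
theorem Run.extend_left
    (hfirst : ∀ (j : Fin n) (h' : j.val + 1 < n), j < i → u ⟨j.val + 1, h'⟩ < u j) (m : ℕ)
    (hm : m ≤ i.val) (hy : ∀ c : Fin n, c.val < m → y c = labels u v w c)
    (hrun : Run (labels u v w) y m (.circ, none, none) s) :
    Run (labels u v w) y 0 (.circ, none, none) s := by
  induction m with
  | zero => exact hrun
  | succ m ih =>
    have hm1 : m + 1 < n := by omega
    exact ih (by omega) (fun c hc => hy c (by omega)) (hrun.cons (by omega)
      (Or.inl (IsShaded.perm .circ _ _ _ _ (shadedOK_of_descent v w ⟨m, by omega⟩ hm1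
        (hfirst _ hm1 (Fin.lt_def.2 (by simp only; omega)))))) rfl
      (by rw [nextLabel_of_lt _ _ hm1]; rfl)
      (hy ⟨m, by omega⟩ (Nat.lt_succ_self m)).symm (fun e => nomatch e) (fun e => nomatch e))

/-- A transmuter signal in a column `m` before the first ascent can come from any column `j < m`. -/
theorem Run.extend_left_tr
    (hfirst : ∀ (j : Fin n) (h' : j.val + 1 < n), j < i → u ⟨j.val + 1, h'⟩ < u j) {j q : Fin n}
    (hq : u j < q) (m : ℕ) (hm : m ≤ i.val) (hj : j.val < m)
    (hy : ∀ c : Fin n, c.val < m → c ≠ j → y c = labels u v w c) (hyj : y j = (q, v j, w j))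
    (hrun : Run (labels u v w) y m (.circ, none, some (some (u j), some q)) s) :
    Run (labels u v w) y 0 (.circ, none, none) s := by
  induction m with
  | zero => omega
  | succ m ih =>
    have hm1 : m + 1 < n := by omega
    have hok := shadedOK_of_descent v w ⟨m, by omega⟩ hm1
      (hfirst _ hm1 (Fin.lt_def.2 (by simp only; omega)))
    by_cases hjm : j.val = m
    · obtain rfl : m = j.val := hjm.symm
      exact Run.extend_left hfirst j.val (by omega)
        (fun c hc => hy c (by omega) (fun e => by subst e; omega)) (hrun.cons (by omega)
          (Or.inl (IsShaded.emit .circ _ _ _ q _ hok hq)) rfl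
          (by rw [nextLabel_of_lt _ _ hm1]; rfl) hyj.symm (fun e => nomatch e) (fun e => nomatch e))
    · have hne : (⟨m, by omega⟩ : Fin n) ≠ j := fun e => hjm (congrArg Fin.val e).symm
      exact ih (by omega) (by omega) (fun c hc => hy c (by omega)) (hrun.cons (by omega)
        (Or.inl (IsShaded.pass .circ _ _ _ (u j) q _ hok hq)) rfl
        (by rw [nextLabel_of_lt _ _ hm1]; rfl)
        (hy ⟨m, by omega⟩ (Nat.lt_succ_self m) hne).symm (fun e => nomatch e) (fun e => nomatch e))

theorem labels_congr {u' v' w' : Perm (Fin n)} {c : Fin n} (hu : u' c = u c) (hv : v' c = v c)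
    (hw : w' c = w c) : labels u' v' w' c = labels u v w c := by
  rw [labels, labels, hu, hv, hw]

theorem ne_of_val_lt {c : Fin n} (hc : c.val < i.val) : c ≠ i ∧ c ≠ ⟨i.val + 1, h⟩ :=
  ⟨fun e => by subst e; omega, fun e => by subst e; simp only at hc; omega⟩

theorem ne_of_add_two_le {c : Fin n} (hc : i.val + 2 ≤ c.val) : c ≠ i ∧ c ≠ ⟨i.val + 1, h⟩ :=
  ⟨fun e => by subst e; omega, fun e => by subst e; simp only at hc; omega⟩

/-- Exchange of positions `i` and `i + 1` in the first and third permutations: yellow 1 or 3. -/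
theorem run_third (hu : u i < u ⟨i.val + 1, h⟩)
    (hfirst : ∀ (j : Fin n) (h' : j.val + 1 < n), j < i → u ⟨j.val + 1, h'⟩ < u j)
    (hw : w i < w ⟨i.val + 1, h⟩) :
    Run (labels u v w) (labels (mulSimple u i h) v (mulSimple w i h)) 0 (.circ, none, none) 1 := by
  refine Run.extend_left hfirst i.val le_rfl (fun c hc => labels_congr
    (mulSimple_apply_of_lt hc) rfl (mulSimple_apply_of_lt hc)) ?_
  have hrest := run_star (u := u) (v := v) (w := w)
    (y := labels (mulSimple u i h) v (mulSimple w i h)) (n - (i.val + 2)) (i.val + 2) (by omega)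
    fun c hc => labels_congr
      (mulSimple_apply_of_ne _ _ _ _ (ne_of_add_two_le (h := h) hc).1 (ne_of_add_two_le hc).2) rfl
      (mulSimple_apply_of_ne _ _ _ _ (ne_of_add_two_le (h := h) hc).1 (ne_of_add_two_le hc).2)
  have hnext := hrest.cons h (σ := (.star, some (some (u i), none, some (w i)), none))
    (Or.inl (IsShaded.fbUW .star _ _ _ (u i) (w i) _ (shadedOK_nextLabel u v w ⟨i.val + 1, h⟩)))
    rfl rfl (by rw [labels, mulSimple_apply_right, mulSimple_apply_right]; rfl)
    (fun e => nomatch e) (fun e => nomatch e)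
  have hh : ((u ⟨i.val + 1, h⟩, v i, w ⟨i.val + 1, h⟩) : Triple n)
      = labels (mulSimple u i h) v (mulSimple w i h) i := by
    rw [labels, mulSimple_apply_left, mulSimple_apply_left]
  rcases lt_or_gt_next v i h with hv | hv
  · exact hnext.cons i.isLt (Or.inr (IsDark.yellow1 _ _ _ _ _ _ hu hv hw)) rfl
      (by rw [nextLabel_of_lt _ _ h]; rfl) hh (fun e => nomatch e) (fun e => nomatch e)
  · exact hnext.cons i.isLt (Or.inr (IsDark.yellow3 _ _ _ _ _ _ hu hv hw)) rfl
      (by rw [nextLabel_of_lt _ _ h]; rfl) hh (fun e => nomatch e) (fun e => nomatch e)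

/-- Exchange of positions `i` and `i + 1` in the first and second permutations: yellow 2 or 4. -/
theorem run_second (hu : u i < u ⟨i.val + 1, h⟩)
    (hfirst : ∀ (j : Fin n) (h' : j.val + 1 < n), j < i → u ⟨j.val + 1, h'⟩ < u j)
    (hv : v ⟨i.val + 1, h⟩ < v i) :
    Run (labels u v w) (labels (mulSimple u i h) (mulSimple v i h) w) 0 (.circ, none, none) 1 := by
  refine Run.extend_left hfirst i.val le_rfl (fun c hc => labels_congr
    (mulSimple_apply_of_lt hc) (mulSimple_apply_of_lt hc) rfl) ?_
  have hrest := run_star (u := u) (v := v) (w := w)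
    (y := labels (mulSimple u i h) (mulSimple v i h) w) (n - (i.val + 2)) (i.val + 2) (by omega)
    fun c hc => labels_congr
      (mulSimple_apply_of_ne _ _ _ _ (ne_of_add_two_le (h := h) hc).1 (ne_of_add_two_le hc).2)
      (mulSimple_apply_of_ne _ _ _ _ (ne_of_add_two_le (h := h) hc).1 (ne_of_add_two_le hc).2) rfl
  have hnext := hrest.cons h (σ := (.star, some (some (u i), some (v i), none), none))
    (Or.inl (IsShaded.fbUV .star _ _ _ (u i) (v i) _ (shadedOK_nextLabel u v w ⟨i.val + 1, h⟩)))
    rfl rfl (by rw [labels, mulSimple_apply_right, mulSimple_apply_right]; rfl)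
    (fun e => nomatch e) (fun e => nomatch e)
  have hh : ((u ⟨i.val + 1, h⟩, v ⟨i.val + 1, h⟩, w i) : Triple n)
      = labels (mulSimple u i h) (mulSimple v i h) w i := by
    rw [labels, mulSimple_apply_left, mulSimple_apply_left]
  rcases lt_or_gt_next w i h with hw | hw
  · exact hnext.cons i.isLt (Or.inr (IsDark.yellow4 _ _ _ _ _ _ hu hv hw)) rfl
      (by rw [nextLabel_of_lt _ _ h]; rfl) hh (fun e => nomatch e) (fun e => nomatch e)
  · exact hnext.cons i.isLt (Or.inr (IsDark.yellow2 _ _ _ _ _ _ hu hv hw)) rfl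
      (by rw [nextLabel_of_lt _ _ h]; rfl) hh (fun e => nomatch e) (fun e => nomatch e)

/-- A transposition of `i` and a later position `k > i + 1`: blue 1. -/
theorem run_left (hu : u i < u ⟨i.val + 1, h⟩)
    (hfirst : ∀ (j : Fin n) (h' : j.val + 1 < n), j < i → u ⟨j.val + 1, h'⟩ < u j)
    (hv : v ⟨i.val + 1, h⟩ < v i) (hw : w i < w ⟨i.val + 1, h⟩) {k : Fin n}
    (hk : ⟨i.val + 1, h⟩ < k) (huk : u i < u k) :
    Run (labels u v w) (labels (u * swap i k) (mulSimple v i h) w) 0 (.circ, none, none) 1 := by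
  have hk' : i.val + 1 < k.val := hk
  have hik : i < k := lt_next.trans hk
  refine Run.extend_left hfirst i.val le_rfl (fun c hc => labels_congr ?_
    (mulSimple_apply_of_lt hc) rfl) ?_
  · rw [Perm.mul_apply, swap_apply_of_ne_of_ne (ne_of_val_lt (h := h) hc).1
      (fun e => by subst e; omega)]
  have hrest := run_star_tr (u := u) (v := v) (w := w)
    (y := labels (u * swap i k) (mulSimple v i h) w) huk (k.val - (i.val + 2)) (i.val + 2)
    (by omega)
    (fun c hc hck => labels_congr
      (by rw [Perm.mul_apply, swap_apply_of_ne_of_ne (ne_of_add_two_le (h := h) hc).1 hck])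
      (mulSimple_apply_of_ne _ _ _ _ (ne_of_add_two_le (h := h) hc).1 (ne_of_add_two_le hc).2) rfl)
    (by rw [labels, Perm.mul_apply, swap_apply_right,
      mulSimple_apply_of_ne _ _ _ _ hik.ne' hk.ne'])
  have hok := shadedOK_nextLabel u v w ⟨i.val + 1, h⟩
  rw [nextLabel_of_lt _ _ (by simp only; omega)] at hok
  have hh : ((u ⟨i.val + 1, h⟩, v i, w ⟨i.val + 1, h⟩) : Triple n)
      = labels (u * swap i k) (mulSimple v i h) w ⟨i.val + 1, h⟩ := by
    rw [labels, Perm.mul_apply, swap_apply_of_ne_of_ne lt_next.ne' hk.ne, mulSimple_apply_right]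
  have hnext := hrest.cons h
    (σ := (.star, some (none, some (v i), none), some (some (u i), some (u k))))
    (Or.inl (IsShaded.fbVPass .star _ _ _ (v i) (u i) (u k) _ hok huk))
    rfl (by rw [nextLabel_of_lt _ _ (by simp only; omega)]; rfl)
    hh
    (fun e => nomatch e) (fun e => nomatch e)
  exact hnext.cons i.isLt
    (Or.inr (IsDark.blue1 _ _ _ _ _ _ (u k) hu hv hw huk (u.injective.ne hk.ne'))) rfl
    (by rw [nextLabel_of_lt _ _ h]; rfl)
    (by rw [labels, Perm.mul_apply, swap_apply_left, mulSimple_apply_left]; rfl)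
    (fun e => nomatch e) (fun e => nomatch e)

/-- A transposition of `i + 1` and a later position `k`: red 2. -/
theorem run_right (hu : u i < u ⟨i.val + 1, h⟩)
    (hfirst : ∀ (j : Fin n) (h' : j.val + 1 < n), j < i → u ⟨j.val + 1, h'⟩ < u j)
    (hv : v ⟨i.val + 1, h⟩ < v i) (hw : w i < w ⟨i.val + 1, h⟩) {k : Fin n}
    (hk : ⟨i.val + 1, h⟩ < k) (huk : u ⟨i.val + 1, h⟩ < u k) :
    Run (labels u v w) (labels (u * swap ⟨i.val + 1, h⟩ k) (mulSimple v i h) w) 0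
      (.circ, none, none) (-1) := by
  have hk' : i.val + 1 < k.val := hk
  have hik : i < k := lt_next.trans hk
  refine Run.extend_left hfirst i.val le_rfl (fun c hc => labels_congr ?_
    (mulSimple_apply_of_lt hc) rfl) ?_
  · rw [Perm.mul_apply, swap_apply_of_ne_of_ne (ne_of_val_lt (h := h) hc).2
      (fun e => by subst e; omega)]
  have hrest := run_star_tr (u := u) (v := v) (w := w)
    (y := labels (u * swap ⟨i.val + 1, h⟩ k) (mulSimple v i h) w) huk (k.val - (i.val + 2))
    (i.val + 2) (by omega)
    (fun c hc hck => labels_congr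
      (by rw [Perm.mul_apply, swap_apply_of_ne_of_ne (ne_of_add_two_le (h := h) hc).2 hck])
      (mulSimple_apply_of_ne _ _ _ _ (ne_of_add_two_le (h := h) hc).1 (ne_of_add_two_le hc).2) rfl)
    (by rw [labels, Perm.mul_apply, swap_apply_right,
      mulSimple_apply_of_ne _ _ _ _ hik.ne' hk.ne'])
  have hok := shadedOK_nextLabel u v w ⟨i.val + 1, h⟩
  rw [nextLabel_of_lt _ _ (by simp only; omega)] at hok
  have hh : ((u k, v i, w ⟨i.val + 1, h⟩) : Triple n)
      = labels (u * swap ⟨i.val + 1, h⟩ k) (mulSimple v i h) w ⟨i.val + 1, h⟩ := by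
    rw [labels, Perm.mul_apply, swap_apply_left, mulSimple_apply_right]
  have hnext := hrest.cons h
    (σ := (.star, some (none, some (v i), none), some (none, none)))
    (Or.inl (IsShaded.fbVEmit .star _ _ _ (v i) (u k) _ hok huk))
    rfl (by rw [nextLabel_of_lt _ _ (by simp only; omega)]; rfl)
    hh
    (fun e => nomatch e) (fun e => nomatch e)
  exact hnext.cons_red i.isLt
    (Or.inr (IsDark.red2 _ _ _ _ _ _ hu hv hw)) rfl
    (by rw [nextLabel_of_lt _ _ h]; rfl)
    (by rw [labels, Perm.mul_apply, swap_apply_of_ne_of_ne lt_next.ne hik.ne,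
      mulSimple_apply_left]; rfl)
    (Or.inr rfl)

/-- A transposition of an earlier position `j` and `i`: red 1. -/
theorem run_to_left (hu : u i < u ⟨i.val + 1, h⟩)
    (hfirst : ∀ (j : Fin n) (h' : j.val + 1 < n), j < i → u ⟨j.val + 1, h'⟩ < u j)
    (hv : v ⟨i.val + 1, h⟩ < v i) (hw : w i < w ⟨i.val + 1, h⟩) {j : Fin n}
    (hj : j < i) (huj : u j < u i) :
    Run (labels u v w) (labels (u * swap j i) (mulSimple v i h) w) 0 (.circ, none, none) (-1) := by
  have hj' : j < ⟨i.val + 1, h⟩ := hj.trans lt_next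
  refine Run.extend_left_tr hfirst huj i.val le_rfl hj (fun c hc hcj => labels_congr ?_
    (mulSimple_apply_of_lt hc) rfl) ?_ ?_
  · rw [Perm.mul_apply, swap_apply_of_ne_of_ne hcj (ne_of_val_lt (h := h) hc).1]
  · rw [labels, Perm.mul_apply, swap_apply_left, mulSimple_apply_of_lt hj]
  have hrest := run_star (u := u) (v := v) (w := w)
    (y := labels (u * swap j i) (mulSimple v i h) w) (n - (i.val + 2)) (i.val + 2) (by omega)
    fun c hc => labels_congr
      (by rw [Perm.mul_apply, swap_apply_of_ne_of_ne
        (fun e => by subst e; have := Fin.lt_def.1 hj; omega) (ne_of_add_two_le (h := h) hc).1])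
      (mulSimple_apply_of_ne _ _ _ _ (ne_of_add_two_le (h := h) hc).1 (ne_of_add_two_le hc).2) rfl
  have hnext := hrest.cons h (σ := (.star, some (none, some (v i), none), none))
    (Or.inl (IsShaded.fbV .star _ _ _ (v i) _ (shadedOK_nextLabel u v w ⟨i.val + 1, h⟩)))
    rfl rfl (by rw [labels, Perm.mul_apply, swap_apply_of_ne_of_ne hj'.ne' lt_next.ne',
      mulSimple_apply_right]; rfl)
    (fun e => nomatch e) (fun e => nomatch e)
  exact hnext.cons_red i.isLt (Or.inr (IsDark.red1 _ _ _ _ _ _ (u j) hu hv hw huj)) rfl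
    (by rw [nextLabel_of_lt _ _ h]; rfl)
    (by rw [labels, Perm.mul_apply, swap_apply_right, mulSimple_apply_left]; rfl) (Or.inl rfl)

/-- A transposition of an earlier position `j` and `i + 1`: blue 2. -/
theorem run_to_right (hu : u i < u ⟨i.val + 1, h⟩)
    (hfirst : ∀ (j : Fin n) (h' : j.val + 1 < n), j < i → u ⟨j.val + 1, h'⟩ < u j)
    (hv : v ⟨i.val + 1, h⟩ < v i) (hw : w i < w ⟨i.val + 1, h⟩) {j : Fin n}
    (hj : j < i) (huj : u j < u ⟨i.val + 1, h⟩) :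
    Run (labels u v w) (labels (u * swap j ⟨i.val + 1, h⟩) (mulSimple v i h) w) 0
      (.circ, none, none) 1 := by
  refine Run.extend_left_tr hfirst huj i.val le_rfl hj (fun c hc hcj => labels_congr ?_
    (mulSimple_apply_of_lt hc) rfl) ?_ ?_
  · rw [Perm.mul_apply, swap_apply_of_ne_of_ne hcj (ne_of_val_lt (h := h) hc).2]
  · rw [labels, Perm.mul_apply, swap_apply_left, mulSimple_apply_of_lt hj]
  have hrest := run_star (u := u) (v := v) (w := w)
    (y := labels (u * swap j ⟨i.val + 1, h⟩) (mulSimple v i h) w) (n - (i.val + 2)) (i.val + 2)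
    (by omega) fun c hc => labels_congr
      (by rw [Perm.mul_apply, swap_apply_of_ne_of_ne
        (fun e => by subst e; have := Fin.lt_def.1 hj; omega) (ne_of_add_two_le (h := h) hc).2])
      (mulSimple_apply_of_ne _ _ _ _ (ne_of_add_two_le (h := h) hc).1 (ne_of_add_two_le hc).2) rfl
  have hnext := hrest.cons h
    (σ := (.star, some (none, some (v i), none), some (some (u j), some (u ⟨i.val + 1, h⟩))))
    (Or.inl (IsShaded.fbVAbsorb .star _ _ _ (v i) (u j) _
      (shadedOK_nextLabel u v w ⟨i.val + 1, h⟩) huj))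
    rfl rfl (by rw [labels, Perm.mul_apply, swap_apply_right, mulSimple_apply_right]; rfl)
    (fun e => nomatch e) (fun e => nomatch e)
  exact hnext.cons i.isLt (Or.inr (IsDark.blue2 _ _ _ _ _ _ (u j) hu hv hw huj)) rfl
    (by rw [nextLabel_of_lt _ _ h]; rfl)
    (by rw [labels, Perm.mul_apply, swap_apply_of_ne_of_ne hj.ne' lt_next.ne,
      mulSimple_apply_left]; rfl) (fun e => nomatch e) (fun e => nomatch e)

/-- The support of `mixedCoeff`. -/
theorem mixedCoeff_cases {a b : Fin n} (hab : a < b)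
    (he : mixedCoeff i ⟨i.val + 1, h⟩ a b ≠ 0) :
    (a = i ∧ b = ⟨i.val + 1, h⟩) ∨ (a = i ∧ ⟨i.val + 1, h⟩ < b) ∨
      (a = ⟨i.val + 1, h⟩ ∧ ⟨i.val + 1, h⟩ < b) ∨ (a < i ∧ b = i) ∨
      (a < i ∧ b = ⟨i.val + 1, h⟩) := by
  by_contra hc
  refine he ?_
  have hab' : a.val < b.val := hab
  simp only [Fin.ext_iff, Fin.lt_def] at hc
  simp only [mixedCoeff, rootPairing, Fin.ext_iff]
  split_ifs <;> omega

/-- Every term of the recurrence is realized by a row. -/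
theorem IsTransition.run (hu : u i < u ⟨i.val + 1, h⟩)
    (hfirst : ∀ (j : Fin n) (h' : j.val + 1 < n), j < i → u ⟨j.val + 1, h'⟩ < u j)
    {u' v' w' : Perm (Fin n)} (ht : IsTransition u v w i h u' v' w' s)
    (hinv : inv u' = inv u + 1) :
    Run (labels u v w) (labels u' v' w') 0 (.circ, none, none) s := by
  cases ht with
  | third hw => exact run_third hu hfirst hw
  | second hv => exact run_second hu hfirst hv
  | mixed a b hab hv hw he =>
    have hlt : u a < u b := lt_of_inv_lt_mul_swap hab (by omega)
    rcases mixedCoeff_cases hab he with ⟨rfl, rfl⟩ | ⟨rfl, hb⟩ | ⟨rfl, hb⟩ | ⟨ha, rfl⟩ | ⟨ha, rfl⟩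
    · rw [mixedCoeff_self lt_next]
      exact run_second hu hfirst hv
    · rw [mixedCoeff_left lt_next hb]
      exact run_left hu hfirst hv hw hb hlt
    · rw [mixedCoeff_right lt_next hb]
      exact run_right hu hfirst hv hw hb hlt
    · rw [mixedCoeff_to_left lt_next ha]
      exact run_to_left hu hfirst hv hw ha hlt
    · rw [mixedCoeff_to_right lt_next ha]
      exact run_to_right hu hfirst hv hw ha hlt

end Build

/-! ### The recurrence for the signed number of puzzles -/

theorem labels_inj {u v w u' v' w' : Perm (Fin n)} (h : labels u v w = labels u' v' w') :
    u = u' ∧ v = v' ∧ w = w' :=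
  ⟨Equiv.ext fun c => congrArg Prod.fst (congrFun h c),
    Equiv.ext fun c => congrArg (fun t => t.2.1) (congrFun h c),
    Equiv.ext fun c => congrArg (fun t => t.2.2) (congrFun h c)⟩

theorem mulSimple_ne_self (v : Perm (Fin n)) (i : Fin n) (h : i.val + 1 < n) :
    mulSimple v i h ≠ v := fun e => by
  have := Equiv.congr_fun e i
  rw [mulSimple_apply_left] at this
  exact lt_next.ne' (v.injective this)

theorem swap_inj_of_lt {a b a' b' : Fin n} (hab : a < b) (hab' : a' < b')
    (h : swap a b = swap a' b') : a = a' ∧ b = b' := by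
  have h1 := Equiv.congr_fun h a
  rw [swap_apply_left, swap_apply_def] at h1
  split_ifs at h1 with e1 e2
  · exact ⟨e1, h1⟩
  · subst e2 h1
    exact absurd hab hab'.not_gt
  · exact absurd h1 hab.ne'

section Recurrence

variable {u v w : Perm (Fin n)} {i : Fin n} {h : i.val + 1 < n} {F : (Fin n → Triple n) → ℤ}

/-- If `F` vanishes on permutations with too many inversions, then only the terms of the recurrence
contribute to the sum over the bottom labels of a row. -/
theorem exists_transition (hu : u i < u ⟨i.val + 1, h⟩)
    (hfirst : ∀ (j : Fin n) (h' : j.val + 1 < n), j < i → u ⟨j.val + 1, h'⟩ < u j)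
    (hF : ∀ u' v' w' : Perm (Fin n), inv u + 1 < inv u' → F (labels u' v' w') = 0)
    {y : Fin n → Triple n} (hy : rowWeight (labels u v w) y * F y ≠ 0) :
    ∃ (u' v' w' : Perm (Fin n)) (s : ℤ), y = labels u' v' w' ∧ inv u' = inv u + 1 ∧
      IsTransition u v w i h u' v' w' s := by
  have hrun := exists_run_of_rowWeight_ne_zero (lt_of_le_of_lt (Nat.zero_le _) i.isLt)
    (left_ne_zero_of_mul hy)
  obtain ⟨u', v', w', rfl, h1, h2⟩ := hrun.exists_labels hu hfirst
  have h3 : inv u' = inv u + 1 :=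
    le_antisymm (not_lt.1 fun hlt => right_ne_zero_of_mul hy (hF _ _ _ hlt)) h1
  exact ⟨u', v', w', _, rfl, h3, h2 h3⟩

theorem sum_rowWeight_ascent_ascent (hu : u i < u ⟨i.val + 1, h⟩)
    (hfirst : ∀ (j : Fin n) (h' : j.val + 1 < n), j < i → u ⟨j.val + 1, h'⟩ < u j)
    (hF : ∀ u' v' w' : Perm (Fin n), inv u + 1 < inv u' → F (labels u' v' w') = 0)
    (hv : v i < v ⟨i.val + 1, h⟩) (hw : w i < w ⟨i.val + 1, h⟩) :
    ∑ y, rowWeight (labels u v w) y * F y = F (labels (mulSimple u i h) v (mulSimple w i h)) := by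
  rw [Finset.sum_eq_single (labels (mulSimple u i h) v (mulSimple w i h)),
    rowWeight_eq (run_third hu hfirst hw), one_mul]
  · intro y _ hne
    by_contra hy
    obtain ⟨u', v', w', s, rfl, -, ht⟩ := exists_transition hu hfirst hF hy
    cases ht with
    | third => exact hne rfl
    | second hv' => exact hv.not_gt hv'
    | mixed a b _ hv' => exact hv.not_gt hv'
  · exact fun hc => absurd (Finset.mem_univ _) hc

theorem sum_rowWeight_ascent_descent (hu : u i < u ⟨i.val + 1, h⟩)
    (hfirst : ∀ (j : Fin n) (h' : j.val + 1 < n), j < i → u ⟨j.val + 1, h'⟩ < u j)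
    (hF : ∀ u' v' w' : Perm (Fin n), inv u + 1 < inv u' → F (labels u' v' w') = 0)
    (hv : v i < v ⟨i.val + 1, h⟩) (hw : w ⟨i.val + 1, h⟩ < w i) :
    ∑ y, rowWeight (labels u v w) y * F y = 0 := by
  refine Finset.sum_eq_zero fun y _ => ?_
  by_contra hy
  obtain ⟨u', v', w', s, rfl, -, ht⟩ := exists_transition hu hfirst hF hy
  cases ht with
  | third hw' => exact hw.not_gt hw'
  | second hv' => exact hv.not_gt hv'
  | mixed a b _ hv' => exact hv.not_gt hv'

theorem sum_rowWeight_descent_descent (hu : u i < u ⟨i.val + 1, h⟩)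
    (hfirst : ∀ (j : Fin n) (h' : j.val + 1 < n), j < i → u ⟨j.val + 1, h'⟩ < u j)
    (hF : ∀ u' v' w' : Perm (Fin n), inv u + 1 < inv u' → F (labels u' v' w') = 0)
    (hv : v ⟨i.val + 1, h⟩ < v i) (hw : w ⟨i.val + 1, h⟩ < w i) :
    ∑ y, rowWeight (labels u v w) y * F y = F (labels (mulSimple u i h) (mulSimple v i h) w) := by
  rw [Finset.sum_eq_single (labels (mulSimple u i h) (mulSimple v i h) w),
    rowWeight_eq (run_second hu hfirst hv), one_mul]
  · intro y _ hne
    by_contra hy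
    obtain ⟨u', v', w', s, rfl, -, ht⟩ := exists_transition hu hfirst hF hy
    cases ht with
    | third hw' => exact hw.not_gt hw'
    | second => exact hne rfl
    | mixed a b _ _ hw' => exact hw.not_gt hw'
  · exact fun hc => absurd (Finset.mem_univ _) hc

theorem sum_rowWeight_descent_ascent (hu : u i < u ⟨i.val + 1, h⟩)
    (hfirst : ∀ (j : Fin n) (h' : j.val + 1 < n), j < i → u ⟨j.val + 1, h'⟩ < u j)
    (hF : ∀ u' v' w' : Perm (Fin n), inv u + 1 < inv u' → F (labels u' v' w') = 0)
    (hv : v ⟨i.val + 1, h⟩ < v i) (hw : w i < w ⟨i.val + 1, h⟩) :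
    ∑ y, rowWeight (labels u v w) y * F y
      = F (labels (mulSimple u i h) v (mulSimple w i h)) + ∑ p : Fin n × Fin n,
        if p.1 < p.2 ∧ inv (u * swap p.1 p.2) = inv u + 1 then
          mixedCoeff i ⟨i.val + 1, h⟩ p.1 p.2 * F (labels (u * swap p.1 p.2) (mulSimple v i h) w)
        else 0 := by
  classical
  set Y : Fin n × Fin n → Fin n → Triple n := fun p =>
    labels (u * swap p.1 p.2) (mulSimple v i h) w with hY
  set y₀ := labels (mulSimple u i h) v (mulSimple w i h) with hy₀
  have hY₀ : ∀ p, Y p ≠ y₀ := fun p e => mulSimple_ne_self v i h (labels_inj e).2.1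
  have hinj : ∀ p q : Fin n × Fin n, p.1 < p.2 → q.1 < q.2 → Y p = Y q → p = q :=
    fun p q hp hq e =>
      have h1 := swap_inj_of_lt hp hq (mul_left_cancel (labels_inj e).1)
      Prod.ext h1.1 h1.2
  have hself : Y (i, ⟨i.val + 1, h⟩) = labels (mulSimple u i h) (mulSimple v i h) w := rfl
  -- Expand both terms on the right as sums over `y`.
  have hterm : ∀ y, rowWeight (labels u v w) y * F y = (if y = y₀ then F y₀ else 0)
      + ∑ p : Fin n × Fin n, if p.1 < p.2 ∧ inv (u * swap p.1 p.2) = inv u + 1 then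
          if y = Y p then mixedCoeff i ⟨i.val + 1, h⟩ p.1 p.2 * F (Y p) else 0 else 0 := by
    intro y
    by_cases h0 : y = y₀
    · rw [if_pos h0, h0, rowWeight_eq (run_third hu hfirst hw), one_mul, Finset.sum_eq_zero,
        add_zero]
      intro p _
      rw [if_neg (hY₀ p).symm, ite_self]
    rw [if_neg h0, zero_add]
    by_cases h1 : ∃ p : Fin n × Fin n, (p.1 < p.2 ∧ inv (u * swap p.1 p.2) = inv u + 1) ∧ y = Y p
    · obtain ⟨p, hp, rfl⟩ := h1
      rw [Finset.sum_eq_single p, if_pos hp, if_pos rfl]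
      · by_cases hm : mixedCoeff i ⟨i.val + 1, h⟩ p.1 p.2 = 0
        · rw [hm, zero_mul]
          by_contra hy
          obtain ⟨u', v', w', s, e, -, ht⟩ := exists_transition hu hfirst hF hy
          cases ht with
          | third => exact h0 e
          | second =>
            obtain rfl := hinj p (i, ⟨i.val + 1, h⟩) hp.1 lt_next (e.trans hself.symm)
            rw [mixedCoeff_self lt_next] at hm
            exact one_ne_zero hm
          | mixed a b hab _ _ he =>
            obtain rfl := hinj p (a, b) hp.1 hab e
            exact he hm
        · rw [rowWeight_eq ((IsTransition.mixed p.1 p.2 hp.1 hv hw hm).run hu hfirst hp.2)]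
      · intro q _ hqp
        split_ifs with hq e
        · exact absurd (hinj q p hq.1 hp.1 e.symm) hqp
        · rfl
        · rfl
      · exact fun hc => absurd (Finset.mem_univ _) hc
    · rw [Finset.sum_eq_zero]
      · by_contra hy
        obtain ⟨u', v', w', s, rfl, hinv, ht⟩ := exists_transition hu hfirst hF hy
        cases ht with
        | third => exact h0 rfl
        | second => exact h1 ⟨(i, ⟨i.val + 1, h⟩), ⟨lt_next, hinv⟩, rfl⟩
        | mixed a b hab => exact h1 ⟨(a, b), ⟨hab, hinv⟩, rfl⟩
      · intro p _
        split_ifs with hp e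
        · exact absurd ⟨p, hp, e⟩ h1
        · rfl
        · rfl
  rw [Finset.sum_congr rfl fun y _ => hterm y, Finset.sum_add_distrib, Finset.sum_ite_eq',
    if_pos (Finset.mem_univ _), Finset.sum_comm]
  congr 1
  refine Finset.sum_congr rfl fun p _ => ?_
  split_ifs
  · rw [Finset.sum_ite_eq', if_pos (Finset.mem_univ _)]
  · exact Finset.sum_const_zero

end Recurrence

/-- There are no puzzles with more than `n(n-1)/2 - inv u` rows. -/
theorem tilingCount_eq_zero (hn : 0 < n) (l : ℕ) : ∀ u v w : Perm (Fin n),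
    n.choose 2 < inv u + l → tilingCount l (labels u v w) = 0 := by
  induction l with
  | zero => exact fun u v w hl => absurd hl (inv_le_choose u).not_gt
  | succ l ih =>
    intro u v w hl
    rw [tilingCount_succ]
    refine Finset.sum_eq_zero fun y _ => ?_
    by_cases hy : rowWeight (labels u v w) y = 0
    · rw [hy, zero_mul]
    have hrun := exists_run_of_rowWeight_ne_zero hn hy
    by_cases hr : u = Fin.revPerm
    · refine absurd hrun (not_run_of_forall_descent (fun j h' => ?_) n 0 _ (by omega)).1
      rw [hr]
      exact Fin.rev_lt_rev.2 lt_next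
    · obtain ⟨i, h, hu, hfirst⟩ := exists_first_ascent hr
      obtain ⟨u', v', w', rfl, h1, -⟩ := hrun.exists_labels hu hfirst
      rw [ih u' v' w' (by omega), mul_zero]

/-- In the case without rows, the three permutations are determined by their inversion numbers. -/
theorem eq_revPerm_one_revPerm {u v w : Perm (Fin n)} (hu : n.choose 2 ≤ inv u)
    (hd : inv u + inv v = inv w) : u = Fin.revPerm ∧ v = 1 ∧ w = Fin.revPerm := by
  have hw := inv_le_choose w
  refine ⟨eq_revPerm_of_choose_le_inv hu, ?_, eq_revPerm_of_choose_le_inv (by omega)⟩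
  by_contra hv
  have := inv_pos hv
  omega

/-- The signed number of puzzles satisfies the recurrence of the Schubert structure constants. -/
theorem tilingCount_eq_structureCoeff (l : ℕ) : ∀ u v w : Perm (Fin n),
    inv u + l = n.choose 2 → inv u + inv v = inv w →
    tilingCount l (labels u v w) = structureCoeff u v w := by
  induction l with
  | zero =>
    intro u v w hl hd
    obtain ⟨rfl, rfl, rfl⟩ := eq_revPerm_one_revPerm (by omega) hd
    have hb : labels Fin.revPerm 1 Fin.revPerm = bottomLabels n := rfl
    rw [tilingCount_zero, if_pos hb, structureCoeff_revPerm]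
  | succ l ih =>
    intro u v w hl hd
    have hr : u ≠ Fin.revPerm := by
      rintro rfl
      rw [inv_revPerm] at hl
      omega
    obtain ⟨i, h, hu, hfirst⟩ := exists_first_ascent hr
    have hF : ∀ u' v' w' : Perm (Fin n), inv u + 1 < inv u' →
        tilingCount l (labels u' v' w') = 0 := fun u' v' w' hlt =>
      tilingCount_eq_zero (lt_of_le_of_lt (Nat.zero_le _) i.isLt) l u' v' w' (by omega)
    have hus := inv_mulSimple u i h hu
    rw [tilingCount_succ]
    rcases lt_or_gt_next v i h with hv | hv <;> rcases lt_or_gt_next w i h with hw | hw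
    · rw [sum_rowWeight_ascent_ascent hu hfirst hF hv hw, structureCoeff_ascent_ascent hu hv hw]
      have := inv_mulSimple w i h hw
      exact ih _ _ _ (by omega) (by omega)
    · rw [sum_rowWeight_ascent_descent hu hfirst hF hv hw, structureCoeff_ascent_descent hu hv hw]
    · rw [sum_rowWeight_descent_ascent hu hfirst hF hv hw, structureCoeff_descent_ascent hu hv hw]
      have := inv_mulSimple w i h hw
      have := inv_mulSimple_of_gt v i h hv
      rw [ih _ _ _ (by omega) (by omega)]
      congr 1
      refine Finset.sum_congr rfl fun p _ => ?_
      split_ifs with hp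
      · rw [ih _ _ _ (by omega) (by omega)]
      · rfl
    · rw [sum_rowWeight_descent_descent hu hfirst hF hv hw, structureCoeff_descent_descent hu hv hw]
      have := inv_mulSimple_of_gt v i h hv
      exact ih _ _ _ (by omega) (by omega)

theorem isSchubertCoeff_iff_eq_signedCount (u v w : Perm (Fin n)) (hd : inv u + inv v = inv w)
    (k : ℤ) : IsSchubertCoeff u v w k ↔ k = signedCount (pieces n) (gamma u v w) := by
  have hu := inv_le_choose u
  have h0 : n.choose 2 - inv u = 0 → labels u v w = bottomLabels n := by
    intro h0
    obtain ⟨rfl, rfl, rfl⟩ := eq_revPerm_one_revPerm (v := v) (w := w) (by omega) hd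
    rfl
  rw [isSchubertCoeff_iff, signedCount_gamma u v w h0,
    ← tilingCount_eq_structureCoeff (n.choose 2 - inv u) u v w (by omega) hd]
  rfl

end SchubertPuzzle

theorem theorem1p1 :
    (∃ C : ℕ, ∀ n : ℕ, (SchubertPuzzle.pieces n).card ≤ C * n ^ 9) ∧
    ∀ (n : ℕ) (u v w : Equiv.Perm (Fin n)),
      SchubertPuzzle.inv u + SchubertPuzzle.inv v = SchubertPuzzle.inv w →
      ∀ k : ℤ, SchubertPuzzle.IsSchubertCoeff u v w k ↔
        k = SchubertPuzzle.signedCount (SchubertPuzzle.pieces n)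
          (SchubertPuzzle.gamma u v w) := by
  exact ⟨⟨Fintype.card (SchubertPuzzle.Piece 9), SchubertPuzzle.card_pieces_le⟩,
    fun _ u v w h k => SchubertPuzzle.isSchubertCoeff_iff_eq_signedCount u v w h k⟩
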